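/- Let a convex body in $\mathbb{R}^2$ be a compact convex set with nonempty interior. For convex bodies $K,T\subset\mathbb{R}^2$ let $C=K\times T\subset\mathbb{R}^2\times\mathbb{R}^2=\mathbb{R}^4$ be their Lagrangian product. If the origin is an interior point of $C$, let $\mu_C$ be the Minkowski functional of $C$ and $\partial\mu_C$ its subdifferential, and let $J=\begin{pmatrix}0&\mathbb{1}\\-\mathbb{1}&0\end{pmatrix}$. A closed characteristic on $\partial C$ is an absolutely continuous loop $x:\mathbb{R}/\mathbb{Z}\to\mathbb{R}^4$ with $\mu_C(x(t))=1$ for all $t$ and $\dot x(t)\in\mathbb{R}_{>0}\,J\,\partial\mu_C(x(t))$ for almost every $t$; its action is $\mathbb{A}(x)=-\frac12\int_0^1\langle J\dot x(t),x(t)\rangle\,dt$. The EHZ-capacity $c_{EHZ}(C)$ is the minimum of $\mathbb{A}(x)$ over all closed characteristics $x$ on $\partial C$. For general $K$ and $T$ it is defined by translating $C$ so that the origin becomes an interior point (the value does not depend on the translation). We call $K\times T$ an equality case (of Viterbo's conjecture) if $$\mathrm{vol}(K\times T)=\frac{c_{EHZ}(K\times T)^2}{2}.$$ We say that $T$ is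 a scaled translate of $S$ if $T=rS+s$ for some $r>0$ and $s\in\mathbb{R}^2$. In $\mathbb{R}^2$ write $J(a,b)=(b,-a)$. All triangles, quadrilaterals and parallelograms are nondegenerate and filled. A trapezoid is a triangle or a quadrilateral with at least one pair of parallel sides. (i) Let $\Delta\subset\mathbb{R}^2$ be any triangle, and let $\mathcal{T}_\Delta$ be the set of all $\mathrm{conv}\{J\Delta,-J\Delta+t\}$ for which $t\in\mathbb{R}^2$ minimizes $\mathrm{vol}(\mathrm{conv}\{J\Delta,-J\Delta+\tilde t\})$ over all $\tilde t\in\mathbb{R}^2$. Then, for $T\subset\mathbb{R}^2$, $\Delta\times T$ is an equality case if and only if $T$ is a scaled translate of a member of $\mathcal{T}_\Delta$. (ii) For $a_1,a_2\in[0,1]$ let $\diamondsuit(a_1,a_2)=\mathrm{conv}\big((\{a_1\}\times[0,1])\cup([0,1]\times\{a_2\})\big)$. Let $\square\subset\mathbb{R}^2$ be any square with sides parallel to the coordinate axes. Then, for $T\subset\mathbb{R}^2$, $\square\times T$ is an equality case if and only if $T$ is a scaled translate of $\diamondsuit(a_1,a_2)$ for some $a_1,a_2\in[0,1]$. (iii)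 Let $Q\subset\mathbb{R}^2$ be any trapezoid which is neither a triangle nor a parallelogram. Then there is a parallelogram $P\subset\mathbb{R}^2$ such that, for $T\subset\mathbb{R}^2$, $Q\times T$ is an equality case if and only if $T$ is a scaled translate of $P$. Moreover, $P$ can be chosen as $P=(\phi^{T})^{-1}([0,1]^2)$, where $\phi$ is a linear automorphism of $\mathbb{R}^2$ with $Q=\phi(\diamondsuit(a_1,a_2))+c$ for some $a_1,a_2\in[0,1]$ and $c\in\mathbb{R}^2$. -/

import Mathlib

open MeasureTheory Set
open scoped Pointwise

noncomputable section

namespace Viterbo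

/-- The Euclidean plane. -/
abbrev Plane : Type := EuclideanSpace ℝ (Fin 2)

/-- The phase space `ℝ⁴ = ℝ²(x) × ℝ²(y)`. Only its linear and topological structure, its product
Lebesgue measure and the Euclidean inner product `dot` below are used. -/
abbrev Phase : Type := Plane × Plane

/-- The Euclidean inner product of `ℝ⁴`. -/
def dot (z w : Phase) : ℝ := inner ℝ z.1 w.1 + inner ℝ z.2 w.2

/-- The symplectic matrix of `ℝ⁴`: `J (x, y) = (y, -x)`. -/
def J4 (z : Phase) : Phase := (z.2, -z.1)

/-- The symplectic matrix of `ℝ²`: `J (a, b) = (b, -a)`. -/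
def J2 (v : Plane) : Plane := !₂[v 1, -v 0]

/-- Compact convex subsets of the plane with nonempty interior. -/
def IsConvexBody (K : Set Plane) : Prop :=
  IsCompact K ∧ Convex ℝ K ∧ (interior K).Nonempty

/-- The subdifferential of `f : ℝ⁴ → ℝ` at `z`. -/
def subdifferential (f : Phase → ℝ) (z : Phase) : Set Phase :=
  {n | ∀ w, f z + dot n (w - z) ≤ f w}

/-- `x`, restricted to `[0, 1]`, is a (generalized) closed characteristic on the boundary of `C`,
where the origin is an interior point of the compact convex set `C`. -/
structure IsClosedCharacteristic (C : Set Phase) (x : ℝ → Phase) : Prop where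
  absCont : AbsolutelyContinuousOnInterval x 0 1
  closed : x 0 = x 1
  velocity : ∀ᵐ t : ℝ, t ∈ Ioo (0 : ℝ) 1 →
    ∃ r : ℝ, 0 < r ∧ ∃ n ∈ subdifferential (gauge C) (x t), HasDerivAt x (r • J4 n) t
  boundary : ∀ t ∈ Icc (0 : ℝ) 1, gauge C (x t) = 1

/-- The action of a loop. -/
def action (x : ℝ → Phase) : ℝ :=
  -(1 / 2) * ∫ t in (0 : ℝ)..1, dot (J4 (deriv x t)) (x t)

/-- `c` is the EHZ-capacity of the compact convex set `C`: the minimal action of the closed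
characteristics on its boundary. Since the gauge function refers to an origin inside `C`, an
interior point `z` of `C` is translated to the origin; neither the characteristics, seen as loops
on the boundary of `C`, nor their actions depend on the choice of `z`. -/
def IsEHZCapacity (C : Set Phase) (c : ℝ) : Prop :=
  IsLeast {A : ℝ | ∃ z ∈ interior C, ∃ x : ℝ → Phase,
    IsClosedCharacteristic (-z +ᵥ C) x ∧ action x = A} c

/-- The Lagrangian product `K × T` of two convex bodies is an equality case of Viterbo's
conjecture: `vol (K × T) = c_EHZ (K × T) ^ 2 / 2`. -/
def IsEqualityCase (K T : Set Plane) : Prop :=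
  IsConvexBody K ∧ IsConvexBody T ∧
    ∃ c : ℝ, IsEHZCapacity (K ×ˢ T) c ∧ volume.real (K ×ˢ T) = c ^ 2 / 2

/-- `T` arises from `S` by scaling and translation. -/
def IsScaledTranslate (S T : Set Plane) : Prop :=
  ∃ r : ℝ, 0 < r ∧ ∃ s : Plane, T = s +ᵥ r • S

/-- Nondegenerate triangles. -/
def IsTriangle (D : Set Plane) : Prop :=
  ∃ v : Fin 3 → Plane, AffineIndependent ℝ v ∧ D = convexHull ℝ (range v)

/-- Nondegenerate parallelograms. -/
def IsParallelogram (P : Set Plane) : Prop :=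
  ∃ a u v : Plane, LinearIndependent ℝ ![u, v] ∧
    P = convexHull ℝ {a, a + u, a + u + v, a + v}

/-- Trapezoids: triangles, and quadrilaterals with consecutive vertices `a, b, c, d` whose sides
`ab` and `dc` are parallel. -/
def IsTrapezoid (Q : Set Plane) : Prop :=
  IsTriangle Q ∨
    ∃ a b c d : Plane, AffineIndependent ℝ ![a, b, d] ∧
      (∃ l : ℝ, 0 < l ∧ c - d = l • (b - a)) ∧ Q = convexHull ℝ {a, b, c, d}

/-- Squares with sides parallel to the coordinate axes. -/
def IsAxisParallelSquare (S : Set Plane) : Prop :=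
  ∃ x y a : ℝ, 0 < a ∧ S = {p | p 0 ∈ Icc x (x + a) ∧ p 1 ∈ Icc y (y + a)}

/-- The unit square `[0, 1] × [0, 1]`. -/
def unitSquare : Set Plane := {p | p 0 ∈ Icc (0 : ℝ) 1 ∧ p 1 ∈ Icc (0 : ℝ) 1}

/-- The diamond in basic form: the convex hull of `{a₁} × [0, 1]` and `[0, 1] × {a₂}`. -/
def diamond (a₁ a₂ : ℝ) : Set Plane :=
  convexHull ℝ ({p | p 0 = a₁ ∧ p 1 ∈ Icc (0 : ℝ) 1} ∪ {p | p 0 ∈ Icc (0 : ℝ) 1 ∧ p 1 = a₂})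

/-- The convex hull of `J D` and `-J D + t`. -/
def doubleHull (D : Set Plane) (t : Plane) : Set Plane :=
  convexHull ℝ (J2 '' D ∪ (t +ᵥ -(J2 '' D)))

/-- The set of the volume-minimizing convex hulls of `J D` and `-J D + t`, `t ∈ ℝ²`. -/
def minimalHulls (D : Set Plane) : Set (Set Plane) :=
  {T | ∃ t : Plane, (∀ t' : Plane, volume (doubleHull D t) ≤ volume (doubleHull D t')) ∧
    T = doubleHull D t}

/-- `Q` is the image of a diamond in basic form under an affine map with linear part `φ`, and `P`
is the image of the unit square under the inverse transpose of `φ`. -/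
def IsDualParallelogram (Q P : Set Plane) : Prop :=
  ∃ (φ : Plane ≃ₗ[ℝ] Plane) (c : Plane) (a₁ a₂ : ℝ), a₁ ∈ Icc (0 : ℝ) 1 ∧ a₂ ∈ Icc (0 : ℝ) 1 ∧
    Q = c +ᵥ (φ '' diamond a₁ a₂) ∧
    P = LinearMap.adjoint (φ.symm : Plane →ₗ[ℝ] Plane) '' unitSquare

end Viterbo

end

/-!
Let `h_K` be the support function of `K`. A closed polygon `W` has `K`-length
`∑ i, h_K (W i - W (i + 1))`, and a polygon of minimal `K`-length among those that cannot be
translated into the interior of `T` gives rise to a closed characteristic on the boundary of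
`K × T` whose action is at most that length. Hence every polygon of `K`-length at most
`c_EHZ (K × T)` can be translated into `T`. In an equality case this makes `T` contain translates of
certain polygons: the rotated triangle and its reflection, two segments parallel to the sides of the
square, or, if `K` is a trapezoid normalized to a diamond, the diagonal of a square and two
triangles. The equation for the volume says that `T` has the least area possible for such a set,
which determines it. Conversely, the action is bounded below on these products because neither
component of a closed characteristic can be translated into the interior of its factor.
-/

noncomputable section

namespace Viterbo

/-! ### Measures of convex sets -/

section Haar

variable {E : Type*} [NormedAddCommGroup E] [NormedSpace ℝ E] [MeasurableSpace E] [BorelSpace E]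
  {μ : Measure E} {S T : Set E}

lemma eq_of_subset_of_convex_of_measure_le [μ.IsOpenPosMeasure] (hT : Convex ℝ T)
    (hTi : (interior T).Nonempty) (hμT : μ T ≠ ⊤) (hS : IsClosed S) (hST : S ⊆ T)
    (hμ : μ T ≤ μ S) : S = T := by
  have hnull : μ (T \ S) = 0 := by
    rw [measure_sdiff hST hS.nullMeasurableSet (measure_ne_top_of_subset hST hμT),
      tsub_eq_zero_of_le hμ]
  have hempty : interior T \ S = ∅ :=
    ((isOpen_interior.sdiff hS).measure_eq_zero_iff μ).1
      (measure_mono_null (sdiff_subset_sdiff_left interior_subset) hnull)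
  refine hST.antisymm ?_
  calc T ⊆ closure T := subset_closure
    _ = closure (interior T) := (hT.closure_interior_eq_closure_of_nonempty_interior hTi).symm
    _ ⊆ S := closure_minimal (sdiff_eq_empty.1 hempty) hS

variable [FiniteDimensional ℝ E] [μ.IsAddHaarMeasure]

lemma addHaar_setOf_linearMap_eq {f : E →ₗ[ℝ] ℝ} (hf : f ≠ 0) (r : ℝ) :
    μ {x | f x = r} = 0 := by
  obtain ⟨x₀, rfl⟩ := LinearMap.surjective_iff_ne_zero.2 hf r
  have hfiber : {x | f x = f x₀} = x₀ +ᵥ (LinearMap.ker f : Set E) := by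
    ext x
    simp [mem_vadd_set_iff_neg_vadd_mem, sub_eq_zero, neg_add_eq_sub]
  rw [hfiber, measure_vadd]
  exact Measure.addHaar_submodule _ _ (by rwa [Ne, LinearMap.ker_eq_top])

lemma measureReal_inter_halfSpace_add {f : E →ₗ[ℝ] ℝ} (hf : f ≠ 0) (hS : μ S ≠ ⊤) (r : ℝ) :
    μ.real (S ∩ {x | f x ≤ r}) + μ.real (S ∩ {x | r ≤ f x}) = μ.real S := by
  have hm : MeasurableSet {x | f x ≤ r} :=
    (isClosed_le f.continuous_of_finiteDimensional continuous_const).measurableSet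
  have hne : ∀ᵐ x ∂μ, f x ≠ r := by simpa [ae_iff] using addHaar_setOf_linearMap_eq hf r
  rw [← measureReal_inter_add_sdiff₀ (s := S) hm.nullMeasurableSet hS]
  congr 1
  refine measureReal_congr ?_
  filter_upwards [hne] with x hx
  refine propext (and_congr_right fun _ => ?_)
  change r ≤ f x ↔ ¬ f x ≤ r
  exact ⟨fun h => not_le.2 (h.lt_of_ne' hx), fun h => (not_le.1 h).le⟩

lemma measureReal_image_linearMap (f : E →ₗ[ℝ] E) (S : Set E) :
    μ.real (f '' S) = |LinearMap.det f| * μ.real S := by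
  simp [Measure.real, Measure.addHaar_image_linearMap]

lemma measureReal_vadd_smul (s : E) (r : ℝ) (S : Set E) :
    μ.real (s +ᵥ r • S) = |r ^ Module.finrank ℝ E| * μ.real S := by
  simp [Measure.real, measure_vadd, Measure.addHaar_smul]

end Haar

/-! ### Areas in the plane -/

/-- The determinant of two vectors of the plane, as a bilinear form. -/
def cross : Plane →ₗ[ℝ] Plane →ₗ[ℝ] ℝ :=
  LinearMap.mk₂ ℝ (fun u v => u 0 * v 1 - u 1 * v 0)
    (fun u u' v => by simp only [PiLp.add_apply]; ring)
    (fun r u v => by simp only [PiLp.smul_apply, smul_eq_mul]; ring)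
    (fun u v v' => by simp only [PiLp.add_apply]; ring)
    (fun r u v => by simp only [PiLp.smul_apply, smul_eq_mul]; ring)

lemma cross_apply (u v : Plane) : cross u v = u 0 * v 1 - u 1 * v 0 := rfl

lemma cross_self (u : Plane) : cross u u = 0 := by rw [cross_apply]; ring

lemma cross_ne_zero {u : Plane} (hu : u ≠ 0) : cross u ≠ 0 := by
  intro h
  have h0 := LinearMap.congr_fun h !₂[1, 0]
  have h1 := LinearMap.congr_fun h !₂[0, 1]
  simp only [cross_apply, Matrix.cons_val_zero, Matrix.cons_val_one, mul_zero,
    mul_one, zero_sub, sub_zero, LinearMap.zero_apply, neg_eq_zero] at h0 h1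
  exact hu (by ext i; fin_cases i <;> assumption)

/-- The linear map sending the standard basis to `u, v`. -/
def basisMap (u v : Plane) : Plane →ₗ[ℝ] Plane where
  toFun x := x 0 • u + x 1 • v
  map_add' x y := by simp only [PiLp.add_apply]; module
  map_smul' r x := by simp only [PiLp.smul_apply, smul_eq_mul, RingHom.id_apply]; module

lemma basisMap_apply (u v x : Plane) : basisMap u v x = x 0 • u + x 1 • v := rfl

lemma det_basisMap (u v : Plane) : LinearMap.det (basisMap u v) = cross u v := by
  rw [← LinearMap.det_toMatrix (EuclideanSpace.basisFun (Fin 2) ℝ).toBasis, Matrix.det_fin_two]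
  simp only [LinearMap.toMatrix_apply, OrthonormalBasis.coe_toBasis,
    OrthonormalBasis.coe_toBasis_repr_apply, EuclideanSpace.basisFun_apply,
    EuclideanSpace.basisFun_repr, basisMap_apply, cross_apply, PiLp.add_apply, PiLp.smul_apply,
    PiLp.single_apply, smul_eq_mul]
  norm_num
  ring

lemma volume_unitSquare : volume unitSquare = 1 := by
  have hsq : unitSquare =
      (MeasurableEquiv.toLp 2 (Fin 2 → ℝ)).symm ⁻¹' Icc (0 : Fin 2 → ℝ) 1 := by
    ext x
    simp only [unitSquare, mem_ofPred_eq, mem_Icc, mem_preimage, Pi.le_def, Fin.forall_fin_two]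
    exact and_and_and_comm
  rw [hsq, (EuclideanSpace.volume_preserving_symm_measurableEquiv_toLp
    (Fin 2)).measure_preimage_equiv, Real.volume_Icc_pi]
  simp

lemma volume_real_unitSquare : volume.real unitSquare = 1 := by
  simp [Measure.real, volume_unitSquare]

lemma volume_real_vadd_smul (s : Plane) (r : ℝ) (S : Set Plane) :
    volume.real (s +ᵥ r • S) = r ^ 2 * volume.real S := by
  rw [measureReal_vadd_smul, finrank_euclideanSpace_fin, abs_of_nonneg (sq_nonneg r)]

lemma volume_real_vadd_image (s : Plane) (f : Plane →ₗ[ℝ] Plane) (S : Set Plane) :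
    volume.real (s +ᵥ f '' S) = |LinearMap.det f| * volume.real S := by
  rw [Measure.real, measure_vadd, ← Measure.real, measureReal_image_linearMap]

/-- The triangle with vertices `(0, 0)`, `(1, 0)` and `(0, 1)`, which tiles the unit square together
with its reflection. -/
def stdTriangle : Set Plane := {x | 0 ≤ x 0 ∧ 0 ≤ x 1 ∧ x 0 + x 1 ≤ 1}

lemma volume_real_stdTriangle : volume.real stdTriangle = 1 / 2 := by
  have hcross : ∀ x, cross !₂[1, -1] x = x 0 + x 1 := fun x => by
    simp [cross_apply, add_comm]
  have hsplit := measureReal_inter_halfSpace_add (μ := volume) (S := unitSquare)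
    (f := cross !₂[1, -1]) (cross_ne_zero fun h => by simpa using congrArg (· 0) h)
    (by simp [volume_unitSquare]) 1
  have hlow : unitSquare ∩ {x | cross !₂[1, -1] x ≤ 1} = stdTriangle := by
    ext x
    simp only [unitSquare, stdTriangle, hcross, mem_inter_iff, mem_ofPred_eq, mem_Icc]
    grind
  have hhigh : unitSquare ∩ {x | 1 ≤ cross !₂[1, -1] x} =
      !₂[(1 : ℝ), 1] +ᵥ (-1 : ℝ) • stdTriangle := by
    ext x
    rw [mem_vadd_set_iff_neg_vadd_mem, mem_smul_set_iff_inv_smul_mem₀ (by norm_num)]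
    simp only [unitSquare, stdTriangle, hcross, mem_inter_iff, mem_ofPred_eq, mem_Icc, vadd_eq_add,
      PiLp.smul_apply, PiLp.add_apply, PiLp.neg_apply, Matrix.cons_val_zero,
      Matrix.cons_val_one, smul_eq_mul]
    grind
  rw [hlow, hhigh, volume_real_vadd_smul, volume_real_unitSquare] at hsplit
  linarith

lemma mem_convexHull_triple {E : Type*} [AddCommGroup E] [Module ℝ E] {a b c x : E} :
    x ∈ convexHull ℝ {a, b, c} ↔
      ∃ s t : ℝ, 0 ≤ s ∧ 0 ≤ t ∧ s + t ≤ 1 ∧ x = a + (s • (b - a) + t • (c - a)) := by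
  constructor
  · rw [convexHull_insert (by simp), convexHull_pair]
    simp only [convexJoin_singleton_left, mem_iUnion, segment_eq_image', mem_image]
    rintro ⟨_, ⟨θ, hθ, rfl⟩, η, hη, rfl⟩
    exact ⟨η * (1 - θ), η * θ, mul_nonneg hη.1 (by linarith [hθ.2]), mul_nonneg hη.1 hθ.1,
      by linarith [hη.2], by module⟩
  · rintro ⟨s, t, hs, ht, hst, rfl⟩
    have hmem := (convex_convexHull ℝ {a, b, c}).sum_mem (t := Finset.univ)
      (w := ![1 - s - t, s, t]) (z := ![a, b, c])
      (by simp only [Fin.forall_fin_succ]; simp [hs, ht]; linarith)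
      (by simp [Fin.sum_univ_three]; ring)
      (by intro i _; apply subset_convexHull; fin_cases i <;> simp)
    convert hmem using 1
    simp only [Fin.sum_univ_three, Matrix.cons_val_zero, Matrix.cons_val_one, Matrix.cons_val]
    module

lemma volume_real_triangle (a b c : Plane) :
    volume.real (convexHull ℝ {a, b, c}) = |cross (b - a) (c - a)| / 2 := by
  have himage : convexHull ℝ {a, b, c} = a +ᵥ (basisMap (b - a) (c - a) '' stdTriangle) := by
    ext x
    rw [mem_convexHull_triple, mem_vadd_set]
    constructor
    · rintro ⟨s, t, hs, ht, hst, rfl⟩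
      exact ⟨_, ⟨!₂[s, t], ⟨by simpa using hs, by simpa using ht, by simpa using hst⟩, rfl⟩,
        by simp [basisMap_apply]⟩
    · rintro ⟨_, ⟨y, hy, rfl⟩, rfl⟩
      exact ⟨y 0, y 1, hy.1, hy.2.1, hy.2.2, rfl⟩
  rw [himage, volume_real_vadd_image, det_basisMap, volume_real_stdTriangle]
  ring

/-- The closed half-plane to the left of the directed line from `a` to `b`; it is the whole plane
if `a = b`. -/
def halfPlane (a b : Plane) : Set Plane := {x | 0 ≤ cross (b - a) (x - a)}

lemma mem_halfPlane {a b x : Plane} : x ∈ halfPlane a b ↔ 0 ≤ cross (b - a) (x - a) := Iff.rfl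

lemma halfPlane_eq (a b : Plane) :
    halfPlane a b = {x | cross (b - a) a ≤ cross (b - a) x} := by
  ext x
  rw [mem_halfPlane, map_sub, sub_nonneg, mem_ofPred_eq]

lemma convex_halfPlane (a b : Plane) : Convex ℝ (halfPlane a b) := by
  rw [halfPlane_eq]
  exact convex_halfSpace_ge (cross (b - a)).isLinear _

lemma left_mem_halfPlane (a b : Plane) : a ∈ halfPlane a b := by
  simp [mem_halfPlane]

lemma right_mem_halfPlane (a b : Plane) : b ∈ halfPlane a b := by
  rw [mem_halfPlane, cross_self]

section ConvexArea

variable {H : Set Plane} {a b c d : Plane}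

lemma volume_inter_ne_top (hH : volume H ≠ ⊤) (S : Set Plane) : volume (H ∩ S) ≠ ⊤ :=
  measure_ne_top_of_subset inter_subset_left hH

lemma abs_cross_div_two_le_volume (hc : Convex ℝ H) (hH : volume H ≠ ⊤) (ha : a ∈ H) (hb : b ∈ H)
    (hc' : c ∈ H) : |cross (b - a) (c - a)| / 2 ≤ volume.real H := by
  rw [← volume_real_triangle]
  refine measureReal_mono (convexHull_min ?_ hc) hH
  rintro x (rfl | rfl | rfl) <;> assumption

lemma volume_inter_halfPlane_sub_cross_le (hc : Convex ℝ H) (hH : volume H ≠ ⊤) (ha : a ∈ H)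
    (hb : b ∈ H) (hc' : c ∈ H) :
    volume.real (H ∩ halfPlane a b) - cross (b - a) (c - a) / 2 ≤ volume.real H := by
  rcases le_or_gt 0 (cross (b - a) (c - a)) with h | h
  · linarith [measureReal_mono (μ := volume) (inter_subset_left (s := H) (t := halfPlane a b)) hH]
  · have hu : b - a ≠ 0 := by rintro h0; simp [h0] at h
    have hba : cross (b - a) b = cross (b - a) a := by
      rw [← sub_eq_zero, ← map_sub, cross_self]
    have htri := abs_cross_div_two_le_volume
      (H := H ∩ {x | cross (b - a) x ≤ cross (b - a) a})
      (hc.inter (convex_halfSpace_le (cross (b - a)).isLinear _)) (volume_inter_ne_top hH _)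
      ⟨ha, le_refl (cross (b - a) a)⟩ ⟨hb, hba.le⟩
      ⟨hc', by rw [map_sub] at h; exact (sub_neg.1 h).le⟩
    rw [abs_of_neg h] at htri
    rw [← measureReal_inter_halfSpace_add (cross_ne_zero hu) hH (cross (b - a) a), halfPlane_eq]
    linarith

lemma cross_sub_cross_div_two_le_volume (hc : Convex ℝ H) (hH : volume H ≠ ⊤) (ha : a ∈ H)
    (hb : b ∈ H) (hc' : c ∈ H) (hd : d ∈ H) :
    (cross (b - a) (c - a) - cross (b - a) (d - a)) / 2 ≤ volume.real H := by
  rcases le_or_gt (cross (b - a) (c - a)) 0 with h | h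
  · have := abs_cross_div_two_le_volume hc hH ha hb hd
    linarith [neg_le_abs (cross (b - a) (d - a))]
  · have hcut := volume_inter_halfPlane_sub_cross_le hc hH ha hb hd
    have htri := abs_cross_div_two_le_volume (hc.inter (convex_halfPlane a b))
      (volume_inter_ne_top hH _) ⟨ha, left_mem_halfPlane a b⟩ ⟨hb, right_mem_halfPlane a b⟩
      ⟨hc', h.le⟩
    rw [abs_of_pos h] at htri
    linarith

lemma abs_cross_chords_div_two_le_volume (hc : Convex ℝ H) (hH : volume H ≠ ⊤) (ha : a ∈ H)
    (hb : b ∈ H) (hc' : c ∈ H) (hd : d ∈ H) :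
    |cross (b - a) (d - c)| / 2 ≤ volume.real H := by
  have hcd := cross_sub_cross_div_two_le_volume hc hH ha hb hc' hd
  have hdc := cross_sub_cross_div_two_le_volume hc hH ha hb hd hc'
  rw [← map_sub, sub_sub_sub_cancel_right] at hcd hdc
  rcases abs_choice (cross (b - a) (d - c)) with h | h
  · rwa [h]
  · rwa [h, ← map_neg, neg_sub]

end ConvexArea

/-! ### Piecewise linear closed characteristics -/

/-- The functional `dot n` as a continuous linear map. -/
def dotL (n : Phase) : Phase →L[ℝ] ℝ := (innerSL ℝ n.1).coprod (innerSL ℝ n.2)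

lemma dot_add_right (n x y : Phase) : dot n (x + y) = dot n x + dot n y := map_add (dotL n) x y

lemma dot_sub_right (n x y : Phase) : dot n (x - y) = dot n x - dot n y := map_sub (dotL n) x y

lemma dot_smul_right (n : Phase) (r : ℝ) (x : Phase) : dot n (r • x) = r * dot n x :=
  map_smul (dotL n) r x

lemma dot_zero_right (n : Phase) : dot n 0 = 0 := map_zero (dotL n)

lemma dot_smul_left (r : ℝ) (n x : Phase) : dot (r • n) x = r * dot n x := by
  simp only [dot, Prod.smul_fst, Prod.smul_snd, inner_smul_left, conj_trivial]
  ring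

lemma dotL_ne_zero {n : Phase} (hn : n ≠ 0) : dotL n ≠ 0 := by
  intro h
  have hsq : ‖n.1‖ ^ 2 + ‖n.2‖ ^ 2 = 0 := by
    rw [← real_inner_self_eq_norm_sq, ← real_inner_self_eq_norm_sq]
    exact DFunLike.congr_fun h n
  refine hn (Prod.ext (norm_eq_zero.1 ?_) (norm_eq_zero.1 ?_)) <;>
    exact pow_eq_zero_iff two_ne_zero |>.1 (by nlinarith [sq_nonneg ‖n.1‖, sq_nonneg ‖n.2‖])

lemma J4_smul (r : ℝ) (n : Phase) : J4 (r • n) = r • J4 n := by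
  simp [J4]

lemma dot_J4_self (n : Phase) : dot n (J4 n) = 0 := by
  simp [dot, J4, real_inner_comm]

lemma dot_J4_J4 (n x : Phase) : dot (J4 (J4 n)) x = -dot n x := by
  simp only [dot, J4, inner_neg_left]
  ring

lemma lt_of_mem_interior_of_forall_le {E : Type*} [AddCommGroup E] [TopologicalSpace E]
    [ContinuousAdd E] [Module ℝ E] [ContinuousSMul ℝ E] {f : E →L[ℝ] ℝ} (hf : f ≠ 0) {S : Set E}
    {M : ℝ} (hM : ∀ y ∈ S, f y ≤ M) {x : E} (hx : x ∈ interior S) : f x < M := by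
  have himage : f '' interior S ⊆ interior (Iic M) :=
    interior_maximal (image_subset_iff.2 fun y hy => hM y (interior_subset hy))
      (f.isOpenMap_of_ne_zero hf _ isOpen_interior)
  rw [interior_Iic] at himage
  exact himage (mem_image_of_mem f hx)

section Gauge

variable {C : Set Phase} {n x : Phase}

lemma dot_le_gauge (hC : C ∈ nhds 0) (hn : ∀ c ∈ C, dot n c ≤ 1) (w : Phase) :
    dot n w ≤ gauge C w := by
  refine le_of_forall_gt_imp_ge_of_dense fun s hs => ?_
  obtain ⟨b, hb, hbs, y, hy, rfl⟩ := exists_lt_of_gauge_lt (absorbent_nhds_zero hC) hs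
  calc dot n (b • y) = b * dot n y := dot_smul_right n b y
    _ ≤ b := mul_le_of_le_one_right hb.le (hn y hy)
    _ ≤ s := hbs.le

lemma gauge_eq_one_of_normal (hC : C ∈ nhds 0) (hn : ∀ c ∈ C, dot n c ≤ 1) (hx : x ∈ C)
    (hnx : dot n x = 1) : gauge C x = 1 :=
  le_antisymm (gauge_le_one_of_mem hx) (hnx ▸ dot_le_gauge hC hn x)

lemma mem_subdifferential_of_normal (hC : C ∈ nhds 0) (hn : ∀ c ∈ C, dot n c ≤ 1) (hx : x ∈ C)
    (hnx : dot n x = 1) : n ∈ subdifferential (gauge C) x := by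
  intro w
  rw [gauge_eq_one_of_normal hC hn hx hnx, dot_sub_right, hnx]
  linarith [dot_le_gauge hC hn w]

lemma normal_of_mem_subdifferential (hx : gauge C x = 1) (hn : n ∈ subdifferential (gauge C) x) :
    (∀ c ∈ C, dot n c ≤ 1) ∧ dot n x = 1 := by
  have h0 := hn 0
  have h2 := hn ((2 : ℝ) • x)
  rw [gauge_smul_of_nonneg (by norm_num), dot_sub_right, dot_smul_right, hx, smul_eq_mul] at h2
  rw [gauge_zero, dot_sub_right, dot_zero_right, hx] at h0
  refine ⟨fun c hc => ?_, by linarith⟩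
  have hc' := hn c
  rw [dot_sub_right, hx] at hc'
  linarith [gauge_le_one_of_mem hc]

end Gauge

lemma lipschitzWith_ite_le {E : Type*} [SeminormedAddCommGroup E] {f g : ℝ → E} {k l : NNReal}
    {a : ℝ} (hf : LipschitzWith k f) (hg : LipschitzWith l g) (hfg : f a = g a) :
    LipschitzWith (k + l) fun t => if t ≤ a then f t else g t := by
  have hsum : (fun t => if t ≤ a then f t else g t) =
      fun t => f (min t a) + (g (max t a) - f a) := by
    ext t
    split_ifs with h
    · rw [min_eq_left h, max_eq_right h, hfg, sub_self, add_zero]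
    · rw [min_eq_right (not_le.1 h).le, max_eq_left (not_le.1 h).le, add_sub_cancel]
  rw [hsum]
  simpa using (hf.comp (LipschitzWith.id.min_const a)).add
    ((hg.comp (LipschitzWith.id.max_const a)).sub (LipschitzWith.const (f a)))

lemma fin_ofNat_add_one (m : ℕ) [NeZero m] (i : ℕ) :
    Fin.ofNat m (i + 1) = Fin.ofNat m i + 1 :=
  Fin.ext (by simp [Fin.val_add])

lemma action_eq_of_hasDerivAt {R : ℝ} {γ : ℝ → Phase} (hγ : ∀ᵐ t : ℝ, t ∈ Ioo (0 : ℝ) 1 →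
      ∃ n, dot n (γ t) = 1 ∧ HasDerivAt γ (R • J4 n) t) : action γ = R / 2 := by
  have hint : ∫ t in (0 : ℝ)..1, dot (J4 (deriv γ t)) (γ t) = ∫ _ in (0 : ℝ)..1, -R := by
    refine intervalIntegral.integral_congr_ae ?_
    have hne : ∀ᵐ t : ℝ, t ≠ 1 := by simp [ae_iff]
    filter_upwards [hγ, hne] with t ht ht1 htI
    rw [uIoc_of_le zero_le_one] at htI
    obtain ⟨n, hn, hd⟩ := ht ⟨htI.1, htI.2.lt_of_ne ht1⟩
    rw [hd.deriv, J4_smul, dot_smul_left, dot_J4_J4, hn, mul_neg, mul_one]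
  rw [action, hint, intervalIntegral.integral_const, sub_zero, one_smul]
  ring

/-- An arc from `x` to `y` on the boundary of `C` which follows the characteristic direction field,
parametrized so that `⟨n, γ⟩ = 1` for the normal `n = -J γ'`, in time `R`. The end point is allowed
to lie off the boundary, so that constant arcs with `R = 0` exist everywhere. -/
def IsArc (C : Set Phase) (R : ℝ) (x y : Phase) : Prop :=
  ∃ (f : ℝ → Phase) (k : NNReal) (F : Set ℝ), LipschitzWith k f ∧ f 0 = x ∧ f R = y ∧
    (∀ t ∈ Ico 0 R, gauge C (f t) = 1) ∧ F.Countable ∧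
    ∀ t ∈ Ioo 0 R, t ∉ F → ∃ n ∈ subdifferential (gauge C) (f t), HasDerivAt f (J4 n) t

namespace IsArc

variable {C : Set Phase} {R R₁ R₂ : ℝ} {n x y w : Phase}

lemma refl (C : Set Phase) (x : Phase) : IsArc C 0 x x :=
  ⟨fun _ => x, 0, ∅, LipschitzWith.const x, rfl, rfl, by simp, countable_empty, by simp⟩

lemma trans (h₁ : 0 ≤ R₁) (h₂ : 0 ≤ R₂) (hxy : IsArc C R₁ x y) (hyw : IsArc C R₂ y w) :
    IsArc C (R₁ + R₂) x w := by
  obtain ⟨f, k, F, hf, hf₀, hf₁, hfC, hF, hf'⟩ := hxy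
  obtain ⟨g, l, G, hg, hg₀, hg₁, hgC, hG, hg'⟩ := hyw
  have hfg : f R₁ = g (R₁ - R₁) := by rw [hf₁, sub_self, hg₀]
  let γ : ℝ → Phase := fun t => if t ≤ R₁ then f t else g (t - R₁)
  have hleft : ∀ t ≤ R₁, γ t = f t := fun t ht => if_pos ht
  have hright : ∀ t ≥ R₁, γ t = g (t - R₁) := by
    intro t ht
    rcases eq_or_lt_of_le ht with rfl | h
    · exact (if_pos le_rfl).trans hfg
    · exact if_neg h.not_ge
  refine ⟨γ, k + l * 1,
    F ∪ (fun t => t + R₁) '' G ∪ {R₁},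
    lipschitzWith_ite_le hf (hg.comp (by simpa using LipschitzWith.id.sub (.const R₁))) hfg,
    (hleft 0 h₁).trans hf₀, (hright _ (by linarith)).trans (by rwa [add_sub_cancel_left]),
    fun t ht => ?_, (hF.union (hG.image _)).union (countable_singleton _), fun t ht htF => ?_⟩
  · rcases lt_or_ge t R₁ with h | h
    · rw [hleft t h.le]
      exact hfC t ⟨ht.1, h⟩
    · rw [hright t h]
      exact hgC _ ⟨by linarith, by linarith [ht.2]⟩
  · simp only [mem_union, mem_image, mem_singleton_iff, not_or, not_exists, not_and] at htF
    rcases lt_or_gt_of_ne htF.2 with h | h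
    · obtain ⟨n, hn, hd⟩ := hf' t ⟨ht.1, h⟩ htF.1.1
      refine ⟨n, by rwa [hleft t h.le], hd.congr_of_eventuallyEq ?_⟩
      filter_upwards [eventually_lt_nhds h] with s hs using hleft s hs.le
    · obtain ⟨n, hn, hd⟩ := hg' (t - R₁) ⟨by linarith, by linarith [ht.2]⟩
        (fun hm => htF.1.2 _ hm (by ring))
      refine ⟨n, by rwa [hright t h.le], (hd.comp_sub_const t R₁).congr_of_eventuallyEq ?_⟩
      filter_upwards [eventually_gt_nhds h] with s hs using hright s hs.le

lemma of_normal (hC : C ∈ nhds 0) (hc : Convex ℝ C) (hR : 0 < R) (hn : ∀ c ∈ C, dot n c ≤ 1)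
    (hx : x ∈ C) (hnx : dot n x = 1) (hy : x + R • J4 n ∈ C) : IsArc C R x (x + R • J4 n) := by
  have hmem : ∀ t ∈ Icc 0 R, x + t • J4 n ∈ C := by
    intro t ht
    have h := hc.add_smul_sub_mem hx hy ⟨div_nonneg ht.1 hR.le, (div_le_one hR).2 ht.2⟩
    rwa [add_sub_cancel_left, smul_smul, div_mul_cancel₀ _ hR.ne'] at h
  have hdot : ∀ t : ℝ, dot n (x + t • J4 n) = 1 := fun t => by
    rw [dot_add_right, dot_smul_right, dot_J4_self, hnx, mul_zero, add_zero]
  refine ⟨fun t => x + t • J4 n, ‖J4 n‖₊, ∅, ?_, by simp, rfl, fun t ht => ?_, countable_empty,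
    fun t ht _ => ⟨n, ?_, ?_⟩⟩
  · refine LipschitzWith.of_dist_le_mul fun s t => ?_
    rw [dist_add_left, dist_eq_norm, ← sub_smul, norm_smul, Real.dist_eq, mul_comm]
    rfl
  · exact gauge_eq_one_of_normal hC hn (hmem t ⟨ht.1, ht.2.le⟩) (hdot t)
  · exact mem_subdifferential_of_normal hC hn (hmem t ⟨ht.1.le, ht.2.le⟩) (hdot t)
  · simpa using ((hasDerivAt_id t).smul_const (J4 n)).const_add x

lemma of_support (hC : C ∈ nhds 0) (hc : Convex ℝ C) (hx : x ∈ C)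
    (hn : ∀ c ∈ C, dot n c ≤ dot n x) (hy : x + J4 n ∈ C) :
    0 ≤ dot n x ∧ IsArc C (dot n x) x (x + J4 n) := by
  rcases eq_or_ne n 0 with rfl | hn0
  · have hzero : x + J4 0 = x := by simp [J4]
    simpa [hzero, dot] using refl C x
  have hpos : 0 < dot n x := by
    simpa using lt_of_mem_interior_of_forall_le (dotL_ne_zero hn0) hn
      (mem_interior_iff_mem_nhds.2 hC)
  have hJ : J4 n = dot n x • J4 ((dot n x)⁻¹ • n) := by rw [J4_smul, smul_inv_smul₀ hpos.ne']
  refine ⟨hpos.le, ?_⟩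
  rw [hJ] at hy ⊢
  refine of_normal hC hc hpos (fun c hcC => ?_) hx ?_ hy
  · rw [dot_smul_left, inv_mul_le_iff₀ hpos, mul_one]
    exact hn c hcC
  · rw [dot_smul_left, inv_mul_cancel₀ hpos.ne']

lemma iterate {P : ℕ → Phase} {R : ℕ → ℝ} (hR : ∀ i, 0 ≤ R i)
    (hP : ∀ i, IsArc C (R i) (P i) (P (i + 1))) (m : ℕ) :
    IsArc C (∑ i ∈ Finset.range m, R i) (P 0) (P m) := by
  induction m with
  | zero => simpa using refl C (P 0)
  | succ m ih =>
    rw [Finset.sum_range_succ]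
    exact ih.trans (Finset.sum_nonneg fun i _ => hR i) (hR m) (hP m)

lemma cycle {m : ℕ} [NeZero m] {P : Fin m → Phase} {R : Fin m → ℝ} (hR : ∀ i, 0 ≤ R i)
    (hP : ∀ i, IsArc C (R i) (P i) (P (i + 1))) : IsArc C (∑ i, R i) (P 0) (P 0) := by
  have h := iterate (C := C) (P := fun i => P (Fin.ofNat m i)) (R := fun i => R (Fin.ofNat m i))
    (fun i => hR _) (fun i => by simpa only [fin_ofNat_add_one] using hP (Fin.ofNat m i)) m
  simpa [Finset.sum_range] using h

lemma exists_closedCharacteristic (hR : 0 < R) (h : IsArc C R x x) :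
    ∃ γ, IsClosedCharacteristic C γ ∧ action γ = R / 2 := by
  obtain ⟨f, k, F, hf, hf₀, hf₁, hfC, hF, hf'⟩ := h
  have hscale : Function.Injective fun t => R * t := mul_right_injective₀ hR.ne'
  have hcharacteristic : ∀ᵐ t : ℝ, t ∈ Ioo (0 : ℝ) 1 →
      ∃ n ∈ subdifferential (gauge C) (f (R * t)),
        HasDerivAt (fun t => f (R * t)) (R • J4 n) t := by
    filter_upwards [(hF.preimage hscale).ae_notMem volume] with t htF ht
    obtain ⟨n, hn, hd⟩ := hf' (R * t) ⟨mul_pos hR ht.1, mul_lt_of_lt_one_right hR ht.2⟩ htF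
    exact ⟨n, hn, hd.scomp t (by simpa using (hasDerivAt_id t).const_mul R)⟩
  have hboundary : ∀ t ∈ Icc (0 : ℝ) 1, gauge C (f (R * t)) = 1 := by
    intro t ht
    rcases eq_or_lt_of_le ht.2 with rfl | h
    · rw [mul_one, hf₁, ← hf₀]
      exact hfC 0 ⟨le_rfl, hR⟩
    · exact hfC _ ⟨mul_nonneg hR.le ht.1, mul_lt_of_lt_one_right hR h⟩
  refine ⟨fun t => f (R * t), ⟨?_, by simp [hf₀, hf₁], ?_, hboundary⟩,
    action_eq_of_hasDerivAt ?_⟩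
  · have hlip := hf.comp (lipschitzWith_smul R)
    exact (hlip.lipschitzOnWith (s := uIcc 0 1)).absolutelyContinuousOnInterval
  · filter_upwards [hcharacteristic] with t ht htI
    exact ⟨R, hR, ht htI⟩
  · filter_upwards [hcharacteristic] with t ht htI
    obtain ⟨n, hn, hd⟩ := ht htI
    exact ⟨n, (normal_of_mem_subdifferential (hboundary t (Ioo_subset_Icc_self htI)) hn).2, hd⟩

end IsArc

lemma mem_neg_vadd_set_iff {G : Type*} [AddCommGroup G] {C : Set G} {z x : G} :
    x ∈ -z +ᵥ C ↔ x + z ∈ C := by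
  rw [mem_vadd_set_iff_neg_vadd_mem, neg_neg, vadd_eq_add, add_comm]

lemma neg_vadd_mem_nhds_zero {G : Type*} [AddCommGroup G] [TopologicalSpace G] [ContinuousAdd G]
    {C : Set G} {z : G} (hz : z ∈ interior C) : -z +ᵥ C ∈ nhds (0 : G) := by
  simpa using vadd_mem_nhds_vadd (-z) (mem_interior_iff_mem_nhds.1 hz)

lemma sum_fin_add_one {M : Type*} [AddCommMonoid M] {m : ℕ} [NeZero m] (f : Fin m → M) :
    ∑ i, f (i + 1) = ∑ i, f i :=
  Equiv.sum_comp (Equiv.addRight 1) f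

section ClosedPolygon

variable {E : Type*} [NormedAddCommGroup E] [InnerProductSpace ℝ E] {m : ℕ} [NeZero m]

lemma sum_inner_edges_const (W : Fin m → E) (a : E) : ∑ i, inner ℝ (W i - W (i + 1)) a = 0 := by
  rw [← sum_inner, Finset.sum_sub_distrib, sum_fin_add_one W, sub_self, inner_zero_left]

lemma sum_inner_edges (k W : Fin m → E) :
    ∑ i, inner ℝ (k (i + 1) - k i) (W i) = ∑ i, inner ℝ (W i - W (i + 1)) (k (i + 1)) := by
  have hshift := sum_fin_add_one fun i => inner ℝ (k i) (W i)
  simp only [inner_sub_left, Finset.sum_sub_distrib, real_inner_comm (k _) (W _), hshift]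

lemma sum_inner_edges_sub_const (k W : Fin m → E) (a b : E) :
    ∑ i, (inner ℝ (k (i + 1) - k i) (W i - b) + inner ℝ (W i - W (i + 1)) (k (i + 1) - a)) =
      2 * ∑ i, inner ℝ (W i - W (i + 1)) (k (i + 1)) := by
  have hb : ∑ i, inner ℝ (k (i + 1) - k i) b = 0 := by
    simpa only [← neg_sub (k _) (k (_ + 1)), inner_neg_left, Finset.sum_neg_distrib, neg_eq_zero]
      using sum_inner_edges_const k b
  simp only [inner_sub_right _ _ a, inner_sub_right _ _ b, Finset.sum_add_distrib,
    Finset.sum_sub_distrib, sum_inner_edges_const, hb, sum_inner_edges]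
  ring

end ClosedPolygon

section Polygon

variable {K T : Set Plane} {z : Phase}

lemma IsArc.fst (hK : Convex ℝ K) (hT : Convex ℝ T) (hz : z ∈ interior (K ×ˢ T)) {q q' p : Plane}
    (hq : q ∈ K) (hq' : q' ∈ K) (hp : p ∈ T)
    (hN : ∀ y ∈ T, inner ℝ (q' - q) y ≤ inner ℝ (q' - q) p) :
    0 ≤ inner ℝ (q' - q) (p - z.2) ∧
    IsArc (-z +ᵥ (K ×ˢ T)) (inner ℝ (q' - q) (p - z.2)) ((q, p) - z) ((q', p) - z) := by
  have hend : ((q', p) - z : Phase) = (q, p) - z + J4 (0, q' - q) := by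
    ext1 <;> simp [J4]
  have hdot : ∀ c, dot (0, q' - q) c = inner ℝ (q' - q) c.2 := fun c => by simp [dot]
  have h := IsArc.of_support (n := (0, q' - q)) (x := (q, p) - z) (neg_vadd_mem_nhds_zero hz)
    ((hK.prod hT).vadd (-z)) (mem_neg_vadd_set_iff.2 (by simpa using ⟨hq, hp⟩)) (fun c hc => ?_)
    (hend ▸ mem_neg_vadd_set_iff.2 (by simpa using ⟨hq', hp⟩))
  · rwa [hdot, ← hend] at h
  · have := hN _ (mem_neg_vadd_set_iff.1 hc).2
    rw [Prod.snd_add, inner_add_right] at this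
    rw [hdot, hdot, Prod.snd_sub, inner_sub_right]
    linarith

lemma IsArc.snd (hK : Convex ℝ K) (hT : Convex ℝ T) (hz : z ∈ interior (K ×ˢ T)) {q p p' : Plane}
    (hq : q ∈ K) (hp : p ∈ T) (hp' : p' ∈ T)
    (hN : ∀ y ∈ K, inner ℝ (p - p') y ≤ inner ℝ (p - p') q) :
    0 ≤ inner ℝ (p - p') (q - z.1) ∧
    IsArc (-z +ᵥ (K ×ˢ T)) (inner ℝ (p - p') (q - z.1)) ((q, p) - z) ((q, p') - z) := by
  have hend : ((q, p') - z : Phase) = (q, p) - z + J4 (p - p', 0) := by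
    ext1 <;> simp [J4]
  have hdot : ∀ c, dot (p - p', 0) c = inner ℝ (p - p') c.1 := fun c => by simp [dot]
  have h := IsArc.of_support (n := (p - p', 0)) (x := (q, p) - z) (neg_vadd_mem_nhds_zero hz)
    ((hK.prod hT).vadd (-z)) (mem_neg_vadd_set_iff.2 (by simpa using ⟨hq, hp⟩)) (fun c hc => ?_)
    (hend ▸ mem_neg_vadd_set_iff.2 (by simpa using ⟨hq, hp'⟩))
  · rwa [hdot, ← hend] at h
  · have := hN _ (mem_neg_vadd_set_iff.1 hc).1
    rw [Prod.fst_add, inner_add_right] at this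
    rw [hdot, hdot, Prod.fst_sub, inner_sub_right]
    linarith

lemma exists_closedCharacteristic_of_polygon (hK : Convex ℝ K) (hT : Convex ℝ T)
    (hz : z ∈ interior (K ×ˢ T)) {m : ℕ} [NeZero m] {k w : Fin m → Plane} (hk : ∀ i, k i ∈ K)
    (hw : ∀ i, w i ∈ T)
    (hkw : ∀ i, ∀ y ∈ T, inner ℝ (k (i + 1) - k i) y ≤ inner ℝ (k (i + 1) - k i) (w i))
    (hwk : ∀ i, ∀ y ∈ K, inner ℝ (w i - w (i + 1)) y ≤ inner ℝ (w i - w (i + 1)) (k (i + 1)))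
    (hpos : 0 < ∑ i, inner ℝ (w i - w (i + 1)) (k (i + 1))) :
    ∃ γ, IsClosedCharacteristic (-z +ᵥ (K ×ˢ T)) γ ∧
      action γ = ∑ i, inner ℝ (w i - w (i + 1)) (k (i + 1)) := by
  have hfst := fun i => IsArc.fst hK hT hz (hk i) (hk (i + 1)) (hw i) (hkw i)
  have hsnd := fun i => IsArc.snd hK hT hz (hk (i + 1)) (hw i) (hw (i + 1)) (hwk i)
  have hcycle := IsArc.cycle (P := fun i => (k i, w i) - z)
    (fun i => add_nonneg (hfst i).1 (hsnd i).1)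
    (fun i => (hfst i).2.trans (hfst i).1 (hsnd i).1 (hsnd i).2)
  rw [sum_inner_edges_sub_const] at hcycle
  obtain ⟨γ, hγ, hA⟩ := hcycle.exists_closedCharacteristic (by linarith)
  exact ⟨γ, hγ, by rw [hA]; ring⟩

end Polygon

/-! ### Polygons that cannot be translated into the interior of a convex body -/

section Fitting

variable {E : Type*} [NormedAddCommGroup E] {S T : Set E}

/-- Some translate of the family of points `W` lies in `S`. -/
def Fits {ι : Type*} (S : Set E) (W : ι → E) : Prop := ∃ s : E, ∀ i, W i + s ∈ S

namespace Fits

variable {ι : Type*} {W : ι → E}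

lemma mono (hST : S ⊆ T) : Fits S W → Fits T W := fun ⟨s, hs⟩ => ⟨s, fun i => hST (hs i)⟩

lemma add_const_iff {s : E} : Fits S (fun i => W i + s) ↔ Fits S W := by
  constructor
  · rintro ⟨t, h⟩
    exact ⟨s + t, fun i => by rw [← add_assoc]; exact h i⟩
  · rintro ⟨t, h⟩
    exact ⟨t - s, fun i => by simpa [add_assoc] using h i⟩

lemma comp_equiv_iff {κ : Type*} (e : κ ≃ ι) : Fits S (fun i => W (e i)) ↔ Fits S W :=
  exists_congr fun _ => e.forall_congr fun _ => Iff.rfl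

end Fits

lemma isOpen_setOf_fits {ι : Type*} [Finite ι] (hS : IsOpen S) :
    IsOpen {W : ι → E | Fits S W} := by
  have hUnion : {W : ι → E | Fits S W} = ⋃ s : E, ⋂ i, (fun W : ι → E => W i + s) ⁻¹' S := by
    ext W
    simp [Fits]
  rw [hUnion]
  exact isOpen_iUnion fun s => isOpen_iInter_of_finite fun i => hS.preimage (by fun_prop)

lemma fits_of_forall_smul_fits [NormedSpace ℝ E] {ι : Type*} [Nonempty ι] (hT : IsCompact T)
    {W : ι → E} (h : ∀ θ ∈ Ioo (0 : ℝ) 1, Fits T (θ • W)) : Fits T W := by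
  obtain ⟨i₀⟩ := ‹Nonempty ι›
  let A : Set (ℝ × E) := (Icc (0 : ℝ) 1 ×ˢ T) ∩
    ⋂ i, (fun x : ℝ × E => x.2 + x.1 • (W i - W i₀)) ⁻¹' T
  have hA : IsCompact A := (isCompact_Icc.prod hT).inter_right
    (isClosed_iInter fun i => hT.isClosed.preimage (by fun_prop))
  have hsub : Ioo (0 : ℝ) 1 ⊆ Prod.fst '' A := by
    intro θ hθ
    obtain ⟨s, hs⟩ := h θ hθ
    refine ⟨(θ, θ • W i₀ + s), ⟨⟨Ioo_subset_Icc_self hθ, hs i₀⟩, mem_iInter.2 fun i => ?_⟩, rfl⟩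
    have hshift : θ • W i₀ + s + θ • (W i - W i₀) = (θ • W) i + s := by
      rw [Pi.smul_apply]
      module
    simpa only [mem_preimage, hshift] using hs i
  have hone : (1 : ℝ) ∈ Prod.fst '' A := by
    refine (hA.image continuous_fst).isClosed.closure_subset_iff.2 hsub ?_
    rw [closure_Ioo zero_ne_one]
    exact right_mem_Icc.2 zero_le_one
  obtain ⟨⟨_, y⟩, ⟨-, hy⟩, rfl⟩ := hone
  refine ⟨y - W i₀, fun i => ?_⟩
  have hshift : W i + (y - W i₀) = y + (1 : ℝ) • (W i - W i₀) := by module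
  exact hshift ▸ mem_iInter.1 hy i

lemma norm_sub_le_sum_norm_edges {m : ℕ} [NeZero m] (W : Fin m → E) (i : Fin m) :
    ‖W i - W 0‖ ≤ ∑ j, ‖W j - W (j + 1)‖ := by
  have hpath := dist_le_range_sum_dist (fun j => W (Fin.ofNat m j)) i
  have hmono : ∑ j ∈ Finset.range i, ‖W (Fin.ofNat m j) - W (Fin.ofNat m j + 1)‖ ≤
      ∑ j ∈ Finset.range m, ‖W (Fin.ofNat m j) - W (Fin.ofNat m j + 1)‖ :=
    Finset.sum_le_sum_of_subset_of_nonneg (Finset.range_mono i.2.le) fun _ _ _ => norm_nonneg _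
  simp only [fin_ofNat_add_one, dist_eq_norm] at hpath
  rw [norm_sub_rev]
  simpa [Finset.sum_range] using hpath.trans hmono

end Fitting

section Polygons

variable {E : Type*} [NormedAddCommGroup E] [InnerProductSpace ℝ E] {K S T : Set E}

/-- The support function `d ↦ sup {⟨d, x⟩ | x ∈ K}` of a set. -/
def supportFn (K : Set E) (d : E) : ℝ := sSup ((fun x => inner ℝ d x) '' K)

lemma inner_le_supportFn (hK : IsCompact K) (d : E) {x : E} (hx : x ∈ K) :
    inner ℝ d x ≤ supportFn K d :=
  le_csSup (hK.bddAbove_image (by fun_prop)) (mem_image_of_mem _ hx)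

lemma exists_inner_eq_supportFn (hK : IsCompact K) (hne : K.Nonempty) (d : E) :
    ∃ x ∈ K, inner ℝ d x = supportFn K d := by
  obtain ⟨x, hx, h⟩ := hK.exists_sSup_image_eq hne (f := fun x => inner ℝ d x) (by fun_prop)
  exact ⟨x, hx, h.symm⟩

lemma continuous_supportFn (hK : IsCompact K) : Continuous (supportFn K) :=
  hK.continuous_sSup (f := fun d x => inner ℝ d x) (by fun_prop)

lemma supportFn_le (hne : K.Nonempty) {d : E} {M : ℝ} (h : ∀ x ∈ K, inner ℝ d x ≤ M) :
    supportFn K d ≤ M :=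
  csSup_le (hne.image _) (forall_mem_image.2 h)

lemma supportFn_smul (K : Set E) {r : ℝ} (hr : 0 ≤ r) (d : E) :
    supportFn K (r • d) = r * supportFn K d := by
  rw [supportFn, supportFn, ← smul_eq_mul, ← Real.sSup_smul_of_nonneg hr, ← image_smul,
    image_image]
  simp only [inner_smul_left, conj_trivial, smul_eq_mul]

lemma inner_add_mul_norm_le_supportFn (hK : IsCompact K) {z : E} {ε : ℝ} (hε : 0 ≤ ε)
    (hb : Metric.closedBall z ε ⊆ K) (d : E) : inner ℝ d z + ε * ‖d‖ ≤ supportFn K d := by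
  rcases eq_or_ne d 0 with rfl | hd
  · simpa using inner_le_supportFn hK 0 (hb (Metric.mem_closedBall_self hε))
  have hd' : ‖d‖ ≠ 0 := norm_ne_zero_iff.2 hd
  have hmem : z + (ε / ‖d‖) • d ∈ K := hb <| by
    rw [Metric.mem_closedBall, dist_eq_norm, add_sub_cancel_left, norm_smul, norm_div, norm_norm,
      div_mul_cancel₀ _ hd', Real.norm_of_nonneg hε]
  calc inner ℝ d z + ε * ‖d‖ = inner ℝ d (z + (ε / ‖d‖) • d) := by
        rw [inner_add_right, inner_smul_right, real_inner_self_eq_norm_sq]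
        field_simp
    _ ≤ supportFn K d := inner_le_supportFn hK d hmem

section Length

variable {m : ℕ} [NeZero m] {W : Fin m → E}

/-- The length of the closed polygon with consecutive vertices `W i`, where an edge from `a` to `b`
has length `supportFn K (a - b)`. -/
def polygonLength (K : Set E) (W : Fin m → E) : ℝ := ∑ i, supportFn K (W i - W (i + 1))

lemma continuous_polygonLength (hK : IsCompact K) :
    Continuous (polygonLength K : (Fin m → E) → ℝ) := by
  have hsupp := continuous_supportFn hK
  unfold polygonLength
  fun_prop

lemma polygonLength_smul (K : Set E) {r : ℝ} (hr : 0 ≤ r) (W : Fin m → E) :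
    polygonLength K (r • W) = r * polygonLength K W := by
  simp only [polygonLength, Finset.mul_sum, Pi.smul_apply, ← smul_sub, supportFn_smul K hr]

lemma polygonLength_add_const (K : Set E) (W : Fin m → E) (s : E) :
    polygonLength K (fun i => W i + s) = polygonLength K W := by
  simp [polygonLength]

lemma polygonLength_le_sum (hne : K.Nonempty) (z : E) {B : Fin m → ℝ}
    (h : ∀ i, ∀ k ∈ K, inner ℝ (W i - W (i + 1)) (k - z) ≤ B i) :
    polygonLength K W ≤ ∑ i, B i := by
  have hsupport (i : Fin m) : supportFn K (W i - W (i + 1)) ≤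
      B i + (inner ℝ (W i) z - inner ℝ (W (i + 1)) z) :=
    supportFn_le hne fun k hk => by
      rw [← inner_sub_left, ← sub_le_iff_le_add, ← inner_sub_right]
      exact h i k hk
  have hcyclic : ∑ i, inner ℝ (W (i + 1)) z = ∑ i, inner ℝ (W i) z :=
    Equiv.sum_comp (Equiv.addRight (1 : Fin m)) fun i => inner ℝ (W i) z
  calc polygonLength K W
      ≤ ∑ i, (B i + (inner ℝ (W i) z - inner ℝ (W (i + 1)) z)) :=
        Finset.sum_le_sum fun i _ => hsupport i
    _ = ∑ i, B i := by
        rw [Finset.sum_add_distrib, Finset.sum_sub_distrib, hcyclic, sub_self, add_zero]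

lemma polygonLength_nonneg (hK : IsCompact K) (hne : K.Nonempty) (W : Fin m → E) :
    0 ≤ polygonLength K W := by
  obtain ⟨z, hz⟩ := hne
  rw [← sum_inner_edges_const W z]
  exact Finset.sum_le_sum fun i _ => inner_le_supportFn hK _ hz

lemma exists_mul_norm_le_polygonLength (hK : IsCompact K) (hKi : (interior K).Nonempty) :
    ∃ ε > 0, ∀ (W : Fin m → E) (i : Fin m), ε * ‖W i - W 0‖ ≤ polygonLength K W := by
  obtain ⟨z, hz⟩ := hKi
  obtain ⟨ε, hε, hb⟩ := Metric.nhds_basis_closedBall.mem_iff.1 (mem_interior_iff_mem_nhds.1 hz)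
  refine ⟨ε, hε, fun W i => ?_⟩
  calc ε * ‖W i - W 0‖ ≤ ε * ∑ j, ‖W j - W (j + 1)‖ := by
        gcongr
        exact norm_sub_le_sum_norm_edges W i
    _ = ∑ j, (inner ℝ (W j - W (j + 1)) z + ε * ‖W j - W (j + 1)‖) := by
        rw [Finset.sum_add_distrib, sum_inner_edges_const, zero_add, Finset.mul_sum]
    _ ≤ polygonLength K W :=
        Finset.sum_le_sum fun j _ => inner_add_mul_norm_le_supportFn hK hε.le hb _

lemma fits_of_polygonLength_nonpos (hK : IsCompact K) (hKi : (interior K).Nonempty)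
    (hS : S.Nonempty) (hW : polygonLength K W ≤ 0) : Fits S W := by
  obtain ⟨ε, hε, hb⟩ := exists_mul_norm_le_polygonLength (m := m) hK hKi
  have hconst : ∀ i, W i = W 0 := fun i => by
    have hle : ‖W i - W 0‖ ≤ 0 := nonpos_of_mul_nonpos_right ((hb W i).trans hW) hε
    exact sub_eq_zero.1 (norm_le_zero_iff.1 hle)
  obtain ⟨x, hx⟩ := hS
  exact ⟨x - W 0, fun i => by rwa [hconst i, add_sub_cancel]⟩

lemma polygonLength_pos_of_not_fits (hK : IsCompact K) (hKi : (interior K).Nonempty)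
    (hS : S.Nonempty) (hW : ¬ Fits S W) : 0 < polygonLength K W :=
  not_le.1 fun hle => hW (fits_of_polygonLength_nonpos hK hKi hS hle)

end Length

section Minimal

variable [FiniteDimensional ℝ E] {m : ℕ} [NeZero m] {W₀ : Fin m → E}

lemma isCompact_setOf_polygonLength_le (hK : IsCompact K) (hKi : (interior K).Nonempty) (L : ℝ) :
    IsCompact {W : Fin m → E | polygonLength K W ≤ L ∧ W 0 = 0} := by
  obtain ⟨ε, hε, hb⟩ := exists_mul_norm_le_polygonLength (m := m) hK hKi
  have hclosed : IsClosed {W : Fin m → E | polygonLength K W ≤ L ∧ W 0 = 0} :=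
    (isClosed_le (continuous_polygonLength hK) continuous_const).inter
      (isClosed_eq (continuous_apply 0) continuous_const)
  refine (isCompact_univ_pi fun _ => isCompact_closedBall 0 (L / ε)).of_isClosed_subset hclosed ?_
  rintro W ⟨hL, h0⟩ i -
  rw [mem_closedBall_zero_iff, le_div_iff₀' hε]
  simpa [h0] using (hb W i).trans hL

lemma exists_polygonLength_le_of_not_fits (hK : IsCompact K) (hKi : (interior K).Nonempty)
    (hW₀ : ¬ Fits (interior T) W₀) :
    ∃ W : Fin m → E, ¬ Fits (interior T) W ∧ polygonLength K W ≤ polygonLength K W₀ ∧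
      ∀ W' : Fin m → E, ¬ Fits (interior T) W' → polygonLength K W ≤ polygonLength K W' := by
  let A : Set (Fin m → E) := {W | polygonLength K W ≤ polygonLength K W₀ ∧ W 0 = 0} ∩
    {W | Fits (interior T) W}ᶜ
  have hA : IsCompact A := (isCompact_setOf_polygonLength_le hK hKi _).inter_right
    (isOpen_setOf_fits isOpen_interior).isClosed_compl
  have hmem : ∀ W : Fin m → E, ¬ Fits (interior T) W → polygonLength K W ≤ polygonLength K W₀ →
      (fun i => W i + -W 0) ∈ A := fun W hW hle =>
    ⟨⟨by rwa [polygonLength_add_const], add_neg_cancel _⟩, by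
      rwa [mem_compl_iff, mem_ofPred_eq, Fits.add_const_iff]⟩
  obtain ⟨W, hWA, hmin⟩ := hA.exists_isMinOn ⟨_, hmem W₀ hW₀ le_rfl⟩
    (continuous_polygonLength hK).continuousOn
  refine ⟨W, hWA.2, hWA.1.1, fun W' hW' => ?_⟩
  rcases le_total (polygonLength K W') (polygonLength K W₀) with h | h
  · simpa only [polygonLength_add_const] using isMinOn_iff.1 hmin _ (hmem W' hW' h)
  · exact hWA.1.1.trans h

lemma exists_minimal_polygon (hK : IsCompact K) (hKi : (interior K).Nonempty) (hT : IsCompact T)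
    (hTi : (interior T).Nonempty) (hW₀ : ¬ Fits (interior T) W₀) :
    ∃ W : Fin m → E, (∀ i, W i ∈ T) ∧ ¬ Fits (interior T) W ∧
      polygonLength K W ≤ polygonLength K W₀ ∧
      ∀ W' : Fin m → E, ¬ Fits (interior T) W' → polygonLength K W ≤ polygonLength K W' := by
  obtain ⟨W, hW, hle, hmin⟩ := exists_polygonLength_le_of_not_fits hK hKi hW₀
  have hpos := polygonLength_pos_of_not_fits hK hKi hTi hW
  have hfits : Fits T W := by
    refine fits_of_forall_smul_fits hT fun θ hθ => ?_
    by_contra hn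
    have hθW := hmin _ fun hfits => hn (hfits.mono interior_subset)
    rw [polygonLength_smul K hθ.1.le] at hθW
    exact (mul_lt_of_lt_one_left hpos hθ.2).not_ge hθW
  obtain ⟨s, hs⟩ := hfits
  refine ⟨fun i => W i + s, hs, by rwa [Fits.add_const_iff], ?_, ?_⟩ <;>
    simpa only [polygonLength_add_const]

end Minimal

section Normals

variable {ι : Type*} [Fintype ι] {a W : ι → E}

lemma sum_inner_lt_of_mem_interior (ha : a ≠ 0) {M : ℝ}
    (h : ∀ X : ι → E, (∀ i, X i ∈ T) → ∑ i, inner ℝ (a i) (X i) ≤ M)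
    {V : ι → E} (hV : ∀ i, V i ∈ interior T) : ∑ i, inner ℝ (a i) (V i) < M := by
  let f : (ι → E) →L[ℝ] ℝ := ∑ i, (innerSL ℝ (a i)).comp (ContinuousLinearMap.proj i)
  have hf : ∀ X, f X = ∑ i, inner ℝ (a i) (X i) := fun X => by simp [f]
  have hf0 : f ≠ 0 := by
    intro h0
    have hsq : ∑ i, ‖a i‖ ^ 2 = 0 := by
      simpa only [hf, real_inner_self_eq_norm_sq, zero_apply] using DFunLike.congr_fun h0 a
    rw [Finset.sum_eq_zero_iff_of_nonneg fun i _ => sq_nonneg _] at hsq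
    exact ha (funext fun i => by simpa using hsq i (Finset.mem_univ i))
  have hV' : V ∈ interior (pi univ fun _ => T) := by
    rw [interior_pi_set finite_univ]
    exact fun i _ => hV i
  rw [← hf]
  exact lt_of_mem_interior_of_forall_le hf0 (fun X hX => hf X ▸ h X fun i => hX i trivial) hV'

lemma not_fits_of_normals (ha0 : a ≠ 0) (ha : ∑ i, a i = 0)
    (h : ∀ X : ι → E, (∀ i, X i ∈ T) → ∑ i, inner ℝ (a i) (X i) ≤ ∑ i, inner ℝ (a i) (W i)) :
    ¬ Fits (interior T) W := by
  rintro ⟨s, hs⟩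
  have hlt := sum_inner_lt_of_mem_interior ha0 h hs
  simp only [inner_add_right, Finset.sum_add_distrib, ← sum_inner, ha, inner_zero_left,
    add_zero] at hlt
  exact lt_irrefl _ hlt

lemma inner_le_of_sum_inner_le {V : ι → E} (hV : ∀ i, V i ∈ T)
    (h : ∀ X : ι → E, (∀ i, X i ∈ T) → ∑ i, inner ℝ (a i) (X i) ≤ ∑ i, inner ℝ (a i) (V i))
    (j : ι) {y : E} (hy : y ∈ T) : inner ℝ (a j) y ≤ inner ℝ (a j) (V j) := by
  classical
  have hupdate := h (Function.update V j y) fun i => by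
    rcases eq_or_ne i j with rfl | hij
    · rwa [Function.update_self]
    · rw [Function.update_of_ne hij]
      exact hV i
  have hdiff : ∀ i ≠ j, inner ℝ (a i) (Function.update V j y i) - inner ℝ (a i) (V i) = 0 :=
    fun i hij => by rw [Function.update_of_ne hij, sub_self]
  rw [← sub_nonpos, ← Finset.sum_sub_distrib, Fintype.sum_eq_single j hdiff,
    Function.update_self] at hupdate
  exact sub_nonpos.1 hupdate

lemma eq_zero_of_forall_le_add_inner {u c : ℝ} {v : E} (h : ∀ s, u ≤ c + inner ℝ v s) :
    v = 0 := by
  by_contra hv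
  have hsq : ‖v‖ ^ 2 ≠ 0 := pow_ne_zero 2 (norm_ne_zero_iff.2 hv)
  have hlow := h (((u - c - 1) / ‖v‖ ^ 2) • v)
  rw [inner_smul_right, real_inner_self_eq_norm_sq, div_mul_cancel₀ _ hsq] at hlow
  linarith

variable [CompleteSpace E]

lemma exists_sum_inner_eq (f : (ι → E) →L[ℝ] ℝ) :
    ∃ a : ι → E, ∀ X, f X = ∑ i, inner ℝ (a i) (X i) := by
  classical
  refine ⟨fun i => (InnerProductSpace.toDual ℝ E).symm
    (f.comp (ContinuousLinearMap.single ℝ (fun _ => E) i)), fun X => ?_⟩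
  simp only [InnerProductSpace.toDual_symm_apply, ContinuousLinearMap.comp_apply,
    ContinuousLinearMap.single_apply]
  rw [← map_sum, Finset.univ_sum_single]

lemma exists_separation_of_not_fits (hS : IsOpen S) (hSc : Convex ℝ S)
    (hW : ¬ Fits S W) :
    ∃ (a : ι → E) (u : ℝ), (∀ X : ι → E, (∀ i, X i ∈ S) → ∑ i, inner ℝ (a i) (X i) < u) ∧
      ∀ s, u ≤ ∑ i, inner ℝ (a i) (W i) + inner ℝ (∑ i, a i) s := by
  let translates : Set (ι → E) :=
    W +ᵥ (LinearMap.range (LinearMap.pi fun _ : ι => LinearMap.id (R := ℝ) (M := E)) : Set (ι → E))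
  have hdisj : Disjoint (pi univ fun _ => S) translates := by
    rw [disjoint_left]
    rintro _ hX ⟨_, ⟨s, rfl⟩, rfl⟩
    exact hW ⟨s, fun i => hX i trivial⟩
  obtain ⟨f, u, hfS, hfW⟩ := geometric_hahn_banach_open (convex_pi fun _ _ => hSc)
    (isOpen_set_pi finite_univ fun _ _ => hS) ((Submodule.convex _).vadd W) hdisj
  obtain ⟨a, ha⟩ := exists_sum_inner_eq f
  refine ⟨a, u, fun X hX => ha X ▸ hfS X fun i _ => hX i, fun s => ?_⟩
  have hs := hfW (fun i => W i + s) ⟨fun _ => s, ⟨s, rfl⟩, rfl⟩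
  rwa [ha, Fintype.sum_congr _ _ fun i => inner_add_right (a i) (W i) s, Finset.sum_add_distrib,
    ← sum_inner] at hs

lemma exists_normals_of_not_fits (hT : Convex ℝ T) (hTi : (interior T).Nonempty)
    (hW : ¬ Fits (interior T) W) :
    ∃ a : ι → E, a ≠ 0 ∧ ∑ i, a i = 0 ∧
      ∀ X : ι → E, (∀ i, X i ∈ T) → ∑ i, inner ℝ (a i) (X i) ≤ ∑ i, inner ℝ (a i) (W i) := by
  obtain ⟨a, u, hlt, hle⟩ := exists_separation_of_not_fits isOpen_interior hT.interior hW
  have hsum : ∑ i, a i = 0 := eq_zero_of_forall_le_add_inner hle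
  have hu : u ≤ ∑ i, inner ℝ (a i) (W i) := by simpa [hsum] using hle 0
  refine ⟨a, ?_, hsum, fun X hX => le_trans ?_ hu⟩
  · rintro rfl
    obtain ⟨x, hx⟩ := hTi
    have hx' := hlt (fun _ => x) fun _ => hx
    simp only [Pi.zero_apply, inner_zero_left, Finset.sum_const_zero] at hx' hu
    exact hx'.not_ge hu
  · have hclosure : X ∈ closure (pi univ fun _ => interior T) := by
      rw [closure_pi_set]
      intro i _
      rw [hT.closure_interior_eq_closure_of_nonempty_interior hTi]
      exact subset_closure (hX i)
    have hclosed : IsClosed {Y : ι → E | ∑ i, inner ℝ (a i) (Y i) ≤ u} :=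
      isClosed_le (by fun_prop) continuous_const
    exact closure_minimal (fun Y hY => (hlt Y fun i => mem_univ_pi.1 hY i).le) hclosed hclosure

end Normals

section DualPolygons

variable {m : ℕ} [NeZero m]

/-- The linear map sending a closed polygon to its edges. -/
def edges : (Fin m → E) →ₗ[ℝ] (Fin m → E) where
  toFun k i := k (i + 1) - k i
  map_add' k l := by ext1 i; simp only [Pi.add_apply]; abel
  map_smul' r k := by ext1 i; simp only [Pi.smul_apply, smul_sub, RingHom.id_apply]

lemma edges_apply (k : Fin m → E) (i : Fin m) : edges k i = k (i + 1) - k i := rfl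

-- `polygonLength K` is the support function of the set of edges of polygons with vertices in `K`.
lemma exists_edges_eq [CompleteSpace E] (hK : IsCompact K) (hKc : Convex ℝ K) (hne : K.Nonempty)
    {b : Fin m → E} (h : ∀ W, ∑ i, inner ℝ (b i) (W i) ≤ polygonLength K W) :
    ∃ k : Fin m → E, (∀ i, k i ∈ K) ∧ edges k = b := by
  suffices hb : b ∈ edges '' pi univ fun _ => K by
    obtain ⟨k, hk, rfl⟩ := hb
    exact ⟨k, fun i => hk i trivial, rfl⟩
  have hcompact : IsCompact (edges '' pi univ fun _ : Fin m => K) :=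
    (isCompact_univ_pi fun _ => hK).image (by unfold edges; dsimp; fun_prop)
  by_contra hb
  obtain ⟨f, u, hfK, hfb⟩ := geometric_hahn_banach_closed_point
    ((convex_pi fun _ _ => hKc).linear_image edges) hcompact.isClosed hb
  obtain ⟨W, hW⟩ := exists_sum_inner_eq f
  choose k hkK hk using fun i : Fin m => exists_inner_eq_supportFn hK hne (W i - W (i + 1))
  have hlt := hfK _ ⟨fun i => k (i - 1), fun i _ => hkK _, rfl⟩
  rw [hW] at hlt hfb
  simp only [real_inner_comm _ (W _), edges_apply] at hlt hfb
  rw [sum_inner_edges (fun i => k (i - 1)) W] at hlt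
  simp only [add_sub_cancel_right, hk] at hlt
  exact ((h W).trans_lt hlt).not_gt hfb

variable {a W : Fin m → E}

lemma smul_normals_le_polygonLength (hK : IsCompact K) (hne : K.Nonempty) (ha0 : a ≠ 0)
    (hsum : ∑ i, a i = 0)
    (ha : ∀ X : Fin m → E, (∀ i, X i ∈ T) → ∑ i, inner ℝ (a i) (X i) ≤ ∑ i, inner ℝ (a i) (W i))
    (hpos : 0 < ∑ i, inner ℝ (a i) (W i))
    (hmin : ∀ W' : Fin m → E, ¬ Fits (interior T) W' → polygonLength K W ≤ polygonLength K W')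
    (X : Fin m → E) :
    polygonLength K W / (∑ i, inner ℝ (a i) (W i)) * ∑ i, inner ℝ (a i) (X i) ≤
      polygonLength K X := by
  have hL := polygonLength_nonneg hK hne W
  rcases le_or_gt (∑ i, inner ℝ (a i) (X i)) 0 with hX | hX
  · exact (mul_nonpos_of_nonneg_of_nonpos (by positivity) hX).trans (polygonLength_nonneg hK hne X)
  have hnotfits : ¬ Fits (interior T)
      (((∑ i, inner ℝ (a i) (W i)) / ∑ i, inner ℝ (a i) (X i)) • X) := by
    refine not_fits_of_normals ha0 hsum fun Y hY => (ha Y hY).trans_eq ?_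
    simp only [Pi.smul_apply, inner_smul_right, ← Finset.mul_sum]
    rw [div_mul_cancel₀ _ hX.ne']
  have hle := hmin _ hnotfits
  rw [polygonLength_smul K (by positivity), div_mul_eq_mul_div, le_div_iff₀ hX] at hle
  rw [div_mul_eq_mul_div, div_le_iff₀ hpos]
  linarith

variable [FiniteDimensional ℝ E]

lemma exists_dual_polygons_of_not_fits (hK : IsCompact K) (hKc : Convex ℝ K)
    (hKi : (interior K).Nonempty) (hT : IsCompact T) (hTc : Convex ℝ T)
    (hTi : (interior T).Nonempty) {W₀ : Fin m → E} (hW₀ : ¬ Fits (interior T) W₀) :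
    ∃ k w : Fin m → E, (∀ i, k i ∈ K) ∧ (∀ i, w i ∈ T) ∧
      (∀ i, ∀ y ∈ T, inner ℝ (k (i + 1) - k i) y ≤ inner ℝ (k (i + 1) - k i) (w i)) ∧
      (∀ i, ∀ y ∈ K, inner ℝ (w i - w (i + 1)) y ≤ inner ℝ (w i - w (i + 1)) (k (i + 1))) ∧
      0 < ∑ i, inner ℝ (w i - w (i + 1)) (k (i + 1)) ∧
      ∑ i, inner ℝ (w i - w (i + 1)) (k (i + 1)) ≤ polygonLength K W₀ := by
  have hKne : K.Nonempty := hKi.mono interior_subset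
  obtain ⟨w, hwT, hw, hle, hmin⟩ := exists_minimal_polygon hK hKi hT hTi hW₀
  have hL := polygonLength_pos_of_not_fits hK hKi hTi hw
  obtain ⟨a, ha0, hsum, ha⟩ := exists_normals_of_not_fits hTc hTi hw
  have hM : 0 < ∑ i, inner ℝ (a i) (w i) := by
    obtain ⟨x, hx⟩ := hTi
    simpa [← sum_inner, hsum] using sum_inner_lt_of_mem_interior ha0 ha fun _ => hx
  have hr := div_pos hL hM
  obtain ⟨k, hkK, hk⟩ := exists_edges_eq hK hKc hKne
    (b := (polygonLength K w / ∑ i, inner ℝ (a i) (w i)) • a) fun X => by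
      simpa only [Pi.smul_apply, inner_smul_left, conj_trivial, ← Finset.mul_sum]
        using smul_normals_le_polygonLength hK hKne ha0 hsum ha hM hmin X
  have hedge : ∀ i, k (i + 1) - k i = (polygonLength K w / ∑ i, inner ℝ (a i) (w i)) • a i :=
    fun i => congrFun hk i
  have hlength : ∑ i, inner ℝ (w i - w (i + 1)) (k (i + 1)) = polygonLength K w := by
    rw [← sum_inner_edges]
    simp only [hedge, inner_smul_left, conj_trivial, ← Finset.mul_sum]
    rw [div_mul_cancel₀ _ hM.ne']
  have hsupport := (Finset.sum_eq_sum_iff_of_le fun i _ =>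
    inner_le_supportFn hK (w i - w (i + 1)) (hkK (i + 1))).1 hlength
  refine ⟨k, w, hkK, hwT, fun i y hy => ?_, fun i y hy => ?_, hlength ▸ hL, hlength ▸ hle⟩
  · rw [hedge, inner_smul_left, inner_smul_left]
    exact mul_le_mul_of_nonneg_left (inner_le_of_sum_inner_le hwT ha i hy) hr.le
  · rw [hsupport i (Finset.mem_univ i)]
    exact inner_le_supportFn hK _ hy

end DualPolygons

end Polygons

section Capacity

variable {K T : Set Plane} {m : ℕ} [NeZero m] {W : Fin m → Plane} {c : ℝ}

lemma exists_closedCharacteristic_action_le (hK : IsConvexBody K) (hT : IsConvexBody T) {z : Phase}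
    (hz : z ∈ interior (K ×ˢ T)) (hW : ¬ Fits (interior T) W) :
    ∃ γ, IsClosedCharacteristic (-z +ᵥ (K ×ˢ T)) γ ∧ action γ ≤ polygonLength K W := by
  obtain ⟨k, w, hk, hw, hkw, hwk, hpos, hle⟩ :=
    exists_dual_polygons_of_not_fits hK.1 hK.2.1 hK.2.2 hT.1 hT.2.1 hT.2.2 hW
  obtain ⟨γ, hγ, hA⟩ :=
    exists_closedCharacteristic_of_polygon hK.2.1 hT.2.1 hz hk hw hkw hwk hpos
  exact ⟨γ, hγ, hA.trans_le hle⟩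

lemma IsConvexBody.interior_prod_nonempty (hK : IsConvexBody K) (hT : IsConvexBody T) :
    (interior (K ×ˢ T)).Nonempty := by
  rw [interior_prod_eq]
  exact hK.2.2.prod hT.2.2

lemma IsEHZCapacity.fits (hK : IsConvexBody K) (hT : IsConvexBody T)
    (hc : IsEHZCapacity (K ×ˢ T) c) (hW : polygonLength K W ≤ c) : Fits T W := by
  obtain ⟨z, hz⟩ := hK.interior_prod_nonempty hT
  have hlt : ∀ X : Fin m → Plane, polygonLength K X < c → Fits T X := by
    intro X hX
    by_contra hn
    obtain ⟨γ, hγ, hA⟩ :=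
      exists_closedCharacteristic_action_le hK hT hz fun hfits => hn (hfits.mono interior_subset)
    exact (hA.trans_lt hX).not_ge (hc.2 ⟨_, hz, γ, hγ, rfl⟩)
  by_contra hn
  have hpos := polygonLength_pos_of_not_fits hK.1 hK.2.2 (hT.2.2.mono interior_subset) hn
  refine hn (fits_of_forall_smul_fits hT.1 fun θ hθ => hlt _ ?_)
  rw [polygonLength_smul K hθ.1.le]
  exact (mul_lt_of_lt_one_left hpos hθ.2).trans_le hW

lemma isEHZCapacity_of_not_fits (hK : IsConvexBody K) (hT : IsConvexBody T)
    (hW : ¬ Fits (interior T) W) (hle : polygonLength K W ≤ c)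
    (hlow : ∀ z ∈ interior (K ×ˢ T), ∀ γ, IsClosedCharacteristic (-z +ᵥ (K ×ˢ T)) γ →
      c ≤ action γ) : IsEHZCapacity (K ×ˢ T) c := by
  obtain ⟨z, hz⟩ := hK.interior_prod_nonempty hT
  obtain ⟨γ, hγ, hA⟩ := exists_closedCharacteristic_action_le hK hT hz hW
  refine ⟨⟨_, hz, γ, hγ, le_antisymm (hA.trans hle) (hlow _ hz γ hγ)⟩, ?_⟩
  rintro _ ⟨z, hz, γ, hγ, rfl⟩
  exact hlow z hz γ hγ

end Capacity

/-! ### Lower bounds for the action -/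

lemma inner_lt_of_mem_interior {E : Type*} [NormedAddCommGroup E] [InnerProductSpace ℝ E]
    {S : Set E} {d x : E} {M : ℝ} (hd : d ≠ 0) (hM : ∀ y ∈ S, inner ℝ d y ≤ M)
    (hx : x ∈ interior S) : inner ℝ d x < M :=
  lt_of_mem_interior_of_forall_le (f := innerSL ℝ d)
    (fun h0 => hd (inner_self_eq_zero.1 (DFunLike.congr_fun h0 d))) hM hx

lemma absolutelyContinuousOnInterval_lipschitz_comp {X Y : Type*} [PseudoMetricSpace X]
    [PseudoMetricSpace Y] {g : X → Y} {C : NNReal} (hg : LipschitzWith C g) {f : ℝ → X} {a b : ℝ}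
    (hf : AbsolutelyContinuousOnInterval f a b) :
    AbsolutelyContinuousOnInterval (fun t => g (f t)) a b := by
  unfold AbsolutelyContinuousOnInterval at hf ⊢
  refine squeeze_zero (fun E => Finset.sum_nonneg fun _ _ => dist_nonneg)
    (g := fun E => C * ∑ i ∈ Finset.range E.1, dist (f (E.2 i).1) (f (E.2 i).2)) (fun E => ?_) ?_
  · rw [Finset.mul_sum]
    exact Finset.sum_le_sum fun i _ => hg.dist_le_mul _ _
  · simpa using hf.const_mul (C : ℝ)

lemma ae_mem_Icc_of_ae_mem_Ioo {P : ℝ → Prop} {a b : ℝ} (h : ∀ᵐ t : ℝ, t ∈ Ioo a b → P t) :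
    ∀ᵐ t : ℝ, t ∈ Icc a b → P t := by
  rwa [← ae_restrict_iff' measurableSet_Icc, ← restrict_Ioo_eq_restrict_Icc,
    ae_restrict_iff' measurableSet_Ioo]

lemma ae_deriv_eq_zero_of_nonneg {f : ℝ → ℝ} {a b : ℝ} (hab : a ≤ b)
    (hf : AbsolutelyContinuousOnInterval f a b) (hclosed : f a = f b)
    (h : ∀ᵐ t : ℝ, t ∈ Icc a b → 0 ≤ deriv f t) : ∀ᵐ t : ℝ, t ∈ Icc a b → deriv f t = 0 := by
  have hint := hf.intervalIntegrable_deriv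
  have hzero := hf.integral_deriv_eq_sub
  rw [intervalIntegrable_iff_integrableOn_Icc_of_le hab] at hint
  rw [hclosed, sub_self, intervalIntegral.integral_of_le hab, ← integral_Icc_eq_integral_Ioc]
    at hzero
  have hnonneg : 0 ≤ᵐ[volume.restrict (Icc a b)] deriv f := (ae_restrict_iff' measurableSet_Icc).2 h
  exact (ae_restrict_iff' measurableSet_Icc).1
    ((integral_eq_zero_iff_of_nonneg_ae hnonneg hint).1 hzero)

lemma ae_inner_deriv_eq_zero_of_nonneg {E : Type*} [NormedAddCommGroup E] [InnerProductSpace ℝ E]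
    {r : ℝ → E} {a b : ℝ} (hab : a ≤ b) (hr : AbsolutelyContinuousOnInterval r a b)
    (hclosed : r a = r b) (v : E)
    (h : ∀ᵐ t : ℝ, t ∈ Icc a b → DifferentiableAt ℝ r t ∧ 0 ≤ inner ℝ v (deriv r t)) :
    ∀ᵐ t : ℝ, t ∈ Icc a b → inner ℝ v (deriv r t) = 0 := by
  have hderiv : ∀ t, DifferentiableAt ℝ r t →
      deriv (fun s => inner ℝ v (r s)) t = inner ℝ v (deriv r t) := fun t ht =>
    ((innerSL ℝ v).hasFDerivAt.comp_hasDerivAt t ht.hasDerivAt).deriv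
  have hzero := ae_deriv_eq_zero_of_nonneg hab
    (absolutelyContinuousOnInterval_lipschitz_comp (innerSL ℝ v).lipschitz hr)
    (congrArg _ hclosed) (by
      filter_upwards [h] with t ht htI
      exact (ht htI).2.trans_eq (hderiv t (ht htI).1).symm)
  filter_upwards [h, hzero] with t ht hzero htI
  exact (hderiv t (ht htI).1).symm.trans (hzero htI)

section Pairing

variable {ι : Type*} [Fintype ι] {q p : ℝ → EuclideanSpace ℝ ι} {a b : ℝ}

/-- The integral of the one-form `⟨p, dq⟩` along the curve `(q, p)`. -/
def pairing (q p : ℝ → EuclideanSpace ℝ ι) (a b : ℝ) : ℝ :=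
  ∫ t in a..b, inner ℝ (deriv q t) (p t)

lemma absolutelyContinuousOnInterval_coord (hq : AbsolutelyContinuousOnInterval q a b) (i : ι) :
    AbsolutelyContinuousOnInterval (fun t => q t i) a b :=
  absolutelyContinuousOnInterval_lipschitz_comp (EuclideanSpace.proj (𝕜 := ℝ) i).lipschitz hq

lemma ae_inner_deriv_eq_sum (hq : AbsolutelyContinuousOnInterval q a b) :
    ∀ᵐ t : ℝ, t ∈ uIcc a b →
      inner ℝ (deriv q t) (p t) = ∑ i, deriv (fun s => q s i) t * p t i := by
  filter_upwards [ae_all_iff.2 fun i =>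
    (absolutelyContinuousOnInterval_coord hq i).ae_differentiableAt] with t ht htI
  have hdiff : DifferentiableAt ℝ q t := differentiableAt_euclidean.2 fun i => ht i htI
  rw [PiLp.inner_apply]
  refine Finset.sum_congr rfl fun i _ => ?_
  have hcoord : HasDerivAt (fun s => q s i) (deriv q t i) t :=
    (EuclideanSpace.proj (𝕜 := ℝ) i).hasFDerivAt.comp_hasDerivAt t hdiff.hasDerivAt
  rw [hcoord.deriv]
  simp [mul_comm]

lemma intervalIntegrable_deriv_mul_coord (hq : AbsolutelyContinuousOnInterval q a b)
    (hp : ContinuousOn p (uIcc a b)) (i : ι) :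
    IntervalIntegrable (fun t => deriv (fun s => q s i) t * p t i) volume a b :=
  (absolutelyContinuousOnInterval_coord hq i).intervalIntegrable_deriv.mul_continuousOn
    ((EuclideanSpace.proj (𝕜 := ℝ) i).continuous.comp_continuousOn hp)

lemma intervalIntegrable_inner_deriv (hq : AbsolutelyContinuousOnInterval q a b)
    (hp : ContinuousOn p (uIcc a b)) :
    IntervalIntegrable (fun t => inner ℝ (deriv q t) (p t)) volume a b := by
  refine (IntervalIntegrable.sum Finset.univ
    fun i _ => intervalIntegrable_deriv_mul_coord hq hp i).congr_ae ?_
  rw [Filter.EventuallyEq, ae_restrict_iff' measurableSet_uIoc]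
  filter_upwards [ae_inner_deriv_eq_sum hq] with t ht htI
  rw [ht (uIoc_subset_uIcc htI), Finset.sum_apply]

lemma pairing_eq_sum (hq : AbsolutelyContinuousOnInterval q a b)
    (hp : ContinuousOn p (uIcc a b)) :
    pairing q p a b = ∑ i, ∫ t in a..b, deriv (fun s => q s i) t * p t i := by
  rw [← intervalIntegral.integral_finsetSum
    fun i _ => intervalIntegrable_deriv_mul_coord hq hp i]
  refine intervalIntegral.integral_congr_ae ?_
  filter_upwards [ae_inner_deriv_eq_sum hq] with t ht htI using ht (uIoc_subset_uIcc htI)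

lemma pairing_const (hq : AbsolutelyContinuousOnInterval q a b) (w : EuclideanSpace ℝ ι) :
    pairing q (fun _ => w) a b = inner ℝ (q b - q a) w := by
  rw [pairing_eq_sum hq continuousOn_const, PiLp.inner_apply]
  refine Finset.sum_congr rfl fun i _ => ?_
  rw [intervalIntegral.integral_mul_const,
    (absolutelyContinuousOnInterval_coord hq i).integral_deriv_eq_sub]
  simp [mul_comm]

lemma pairing_add_pairing_swap (hq : AbsolutelyContinuousOnInterval q a b)
    (hp : AbsolutelyContinuousOnInterval p a b) :
    pairing q p a b + pairing p q a b = inner ℝ (q b) (p b) - inner ℝ (q a) (p a) := by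
  rw [pairing_eq_sum hq hp.continuousOn, pairing_eq_sum hp hq.continuousOn,
    ← Finset.sum_add_distrib, PiLp.inner_apply, PiLp.inner_apply, ← Finset.sum_sub_distrib]
  refine Finset.sum_congr rfl fun i _ => ?_
  have hparts := (absolutelyContinuousOnInterval_coord hq i).integral_mul_deriv_eq_deriv_mul
    (absolutelyContinuousOnInterval_coord hp i)
  simp only [mul_comm (deriv (fun s => p s i) _), hparts, RCLike.inner_apply, conj_trivial]
  ring

lemma pairing_add_const (hq : AbsolutelyContinuousOnInterval q a b)
    (hp : AbsolutelyContinuousOnInterval p a b) (u v : EuclideanSpace ℝ ι) :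
    pairing (fun t => q t + u) (fun t => p t + v) a b =
      pairing q p a b + inner ℝ (q b - q a) v := by
  rw [← pairing_const hq v, pairing, pairing, pairing,
    ← intervalIntegral.integral_add (intervalIntegrable_inner_deriv hq hp.continuousOn)
      (intervalIntegrable_inner_deriv hq continuousOn_const)]
  simp only [deriv_add_const, inner_add_right]

lemma pairing_add_adjacent (hq : AbsolutelyContinuousOnInterval q a b)
    (hp : AbsolutelyContinuousOnInterval p a b) {r s t : ℝ} (hr : r ∈ uIcc a b)
    (hs : s ∈ uIcc a b) (ht : t ∈ uIcc a b) :
    pairing q p r s + pairing q p s t = pairing q p r t := by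
  have hint : ∀ x ∈ uIcc a b, ∀ y ∈ uIcc a b,
      IntervalIntegrable (fun t => inner ℝ (deriv q t) (p t)) volume x y := fun x hx y hy =>
    have hsub := uIcc_subset_uIcc hx hy
    intervalIntegrable_inner_deriv (hq.mono hsub) (hp.mono hsub).continuousOn
  exact intervalIntegral.integral_add_adjacent_intervals (hint r hr s hs) (hint s hs t ht)

end Pairing

/-- The two components of a closed characteristic on the boundary of `K × T`. For `ε = 1` this is
the Hamiltonian flow direction, and `ε = -1` is the reversed direction, which is what makes the
notion symmetric in the two factors. -/
structure IsCharPair {ι : Type*} [Fintype ι] (ε : ℝ) (K T : Set (EuclideanSpace ℝ ι))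
    (q p : ℝ → EuclideanSpace ℝ ι) : Prop where
  sign : ε * ε = 1
  absCont_fst : AbsolutelyContinuousOnInterval q 0 1
  absCont_snd : AbsolutelyContinuousOnInterval p 0 1
  closed_fst : q 0 = q 1
  closed_snd : p 0 = p 1
  mem_fst : ∀ t ∈ Icc (0 : ℝ) 1, q t ∈ K
  mem_snd : ∀ t ∈ Icc (0 : ℝ) 1, p t ∈ T
  velocity : ∀ᵐ t : ℝ, t ∈ Icc (0 : ℝ) 1 → ∃ A B : EuclideanSpace ℝ ι, (A ≠ 0 ∨ B ≠ 0) ∧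
    HasDerivAt q (ε • B) t ∧ HasDerivAt p (-ε • A) t ∧
    (∀ y ∈ K, inner ℝ A y ≤ inner ℝ A (q t)) ∧ ∀ y ∈ T, inner ℝ B y ≤ inner ℝ B (p t)

namespace IsCharPair

variable {ι : Type*} [Fintype ι] {ε : ℝ} {K T : Set (EuclideanSpace ℝ ι)}
  {q p : ℝ → EuclideanSpace ℝ ι}

lemma swap (h : IsCharPair ε K T q p) : IsCharPair (-ε) T K p q where
  sign := by rw [neg_mul_neg, h.sign]
  absCont_fst := h.absCont_snd
  absCont_snd := h.absCont_fst
  closed_fst := h.closed_snd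
  closed_snd := h.closed_fst
  mem_fst := h.mem_snd
  mem_snd := h.mem_fst
  velocity := by
    filter_upwards [h.velocity] with t ht htI
    obtain ⟨A, B, hne, hq, hp, hA, hB⟩ := ht htI
    exact ⟨B, A, hne.symm, hp, by rwa [neg_neg], hB, hA⟩

lemma pairing_swap (h : IsCharPair ε K T q p) : pairing p q 0 1 = -pairing q p 0 1 := by
  have hparts := pairing_add_pairing_swap h.absCont_fst h.absCont_snd
  rw [h.closed_fst, h.closed_snd, sub_self] at hparts
  linarith

lemma inner_chord_le_pairing (h : IsCharPair ε K T q p) {s t : ℝ} (hs : 0 ≤ s) (hst : s ≤ t)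
    (ht : t ≤ 1) {w : EuclideanSpace ℝ ι} (hw : w ∈ T) :
    ε * inner ℝ (q t - q s) w ≤ ε * pairing q p s t := by
  have hsub : uIcc s t ⊆ uIcc 0 1 := by
    rw [uIcc_of_le hst, uIcc_of_le zero_le_one]
    exact Icc_subset_Icc hs ht
  have hq := h.absCont_fst.mono hsub
  have hp := h.absCont_snd.mono hsub
  rw [← pairing_const hq w, pairing, pairing, ← intervalIntegral.integral_const_mul,
    ← intervalIntegral.integral_const_mul]
  refine intervalIntegral.integral_mono_ae_restrict hst
    ((intervalIntegrable_inner_deriv hq continuousOn_const).const_mul _)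
    ((intervalIntegrable_inner_deriv hq hp.continuousOn).const_mul _) ?_
  rw [Filter.EventuallyLE, ae_restrict_iff' measurableSet_Icc]
  filter_upwards [h.velocity] with x hx hxI
  obtain ⟨A, B, -, hqd, -, -, hB⟩ := hx (Icc_subset_Icc hs ht hxI)
  rw [hqd.deriv, real_inner_smul_left, real_inner_smul_left, ← mul_assoc, ← mul_assoc, h.sign,
    one_mul, one_mul]
  exact hB w hw

lemma inner_triangle_le_pairing_of_le (h : IsCharPair ε K T q p) {s₁ s₂ s₃ : ℝ} (h₁ : 0 ≤ s₁)
    (h₁₂ : s₁ ≤ s₂) (h₂₃ : s₂ ≤ s₃) (h₃ : s₃ ≤ 1) {w₁ w₂ w₃ : EuclideanSpace ℝ ι} (hw₁ : w₁ ∈ T)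
    (hw₂ : w₂ ∈ T) (hw₃ : w₃ ∈ T) :
    ε * (inner ℝ (q s₂ - q s₁) w₁ + inner ℝ (q s₃ - q s₂) w₂ + inner ℝ (q s₁ - q s₃) w₃) ≤
      ε * pairing q p 0 1 := by
  have hI : ∀ {x : ℝ}, 0 ≤ x → x ≤ 1 → x ∈ uIcc (0 : ℝ) 1 := fun h0 h1 =>
    Icc_subset_uIcc ⟨h0, h1⟩
  have hmem₁ := hI h₁ (by linarith)
  have hmem₂ := hI (x := s₂) (by linarith) (by linarith)
  have hmem₃ := hI (x := s₃) (by linarith) h₃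
  have hone := hI zero_le_one le_rfl
  rw [← pairing_add_adjacent h.absCont_fst h.absCont_snd left_mem_uIcc hmem₁ hone,
    ← pairing_add_adjacent h.absCont_fst h.absCont_snd hmem₁ hmem₂ hone,
    ← pairing_add_adjacent h.absCont_fst h.absCont_snd hmem₂ hmem₃ hone]
  have hinitial := h.inner_chord_le_pairing le_rfl h₁ (by linarith) hw₃
  have hfirst := h.inner_chord_le_pairing h₁ h₁₂ (by linarith) hw₁
  have hsecond := h.inner_chord_le_pairing (by linarith) h₂₃ h₃ hw₂
  have hfinal := h.inner_chord_le_pairing (by linarith) h₃ le_rfl hw₃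
  rw [h.closed_fst] at hinitial
  simp only [inner_sub_left] at *
  linarith

lemma inner_triangle_le_pairing (h : IsCharPair ε K T q p) {s : Fin 3 → ℝ}
    (hs : ∀ i, s i ∈ Icc (0 : ℝ) 1)
    (hord : (s 0 ≤ s 1 ∧ s 1 ≤ s 2) ∨ (s 1 ≤ s 2 ∧ s 2 ≤ s 0) ∨ (s 2 ≤ s 0 ∧ s 0 ≤ s 1))
    {w : Fin 3 → EuclideanSpace ℝ ι} (hw : ∀ i, w i ∈ T) :
    ε * (inner ℝ (q (s 1) - q (s 0)) (w 0) + inner ℝ (q (s 2) - q (s 1)) (w 1) +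
      inner ℝ (q (s 0) - q (s 2)) (w 2)) ≤ ε * pairing q p 0 1 := by
  rcases hord with ⟨h₁, h₂⟩ | ⟨h₁, h₂⟩ | ⟨h₁, h₂⟩
  · exact h.inner_triangle_le_pairing_of_le (hs 0).1 h₁ h₂ (hs 2).2 (hw 0) (hw 1) (hw 2)
  · linarith [h.inner_triangle_le_pairing_of_le (hs 1).1 h₁ h₂ (hs 0).2 (hw 1) (hw 2) (hw 0)]
  · linarith [h.inner_triangle_le_pairing_of_le (hs 2).1 h₁ h₂ (hs 1).2 (hw 2) (hw 0) (hw 1)]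

lemma inner_segment_le_pairing (h : IsCharPair ε K T q p) {s t : ℝ} (hs : s ∈ Icc (0 : ℝ) 1)
    (ht : t ∈ Icc (0 : ℝ) 1) {w₁ w₂ : EuclideanSpace ℝ ι} (hw₁ : w₁ ∈ T) (hw₂ : w₂ ∈ T) :
    ε * inner ℝ (q t - q s) (w₁ - w₂) ≤ ε * pairing q p 0 1 := by
  rcases le_total s t with hst | hst
  · have hle := h.inner_triangle_le_pairing_of_le hs.1 hst le_rfl ht.2 hw₁ hw₁ hw₂
    simp only [inner_sub_left, inner_sub_right] at *
    linarith
  · have hle := h.inner_triangle_le_pairing_of_le ht.1 hst le_rfl hs.2 hw₂ hw₁ hw₁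
    simp only [inner_sub_left, inner_sub_right] at *
    linarith

lemma ae_hasDerivAt_snd_zero_of_translate_mem_interior (h : IsCharPair ε K T q p)
    {s : EuclideanSpace ℝ ι} (hs : ∀ t ∈ Icc (0 : ℝ) 1, q t + s ∈ interior K) :
    ∀ᵐ t : ℝ, t ∈ Icc (0 : ℝ) 1 → HasDerivAt p 0 t := by
  have hneg : ∀ t ∈ Icc (0 : ℝ) 1, ∀ A, (∀ y ∈ K, inner ℝ A y ≤ inner ℝ A (q t)) →
      A = 0 ∨ inner ℝ A s < 0 := by
    intro t ht A hA
    refine or_iff_not_imp_left.2 fun hA0 => ?_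
    have hlt := inner_lt_of_mem_interior hA0 hA (hs t ht)
    rw [inner_add_right] at hlt
    linarith
  have hinner : ∀ A : EuclideanSpace ℝ ι, inner ℝ (ε • s) (-ε • A) = -inner ℝ A s := fun A => by
    rw [real_inner_smul_left, real_inner_smul_right, real_inner_comm]
    linear_combination -inner ℝ A s * h.sign
  have hzero := ae_inner_deriv_eq_zero_of_nonneg zero_le_one h.absCont_snd h.closed_snd (ε • s) (by
    filter_upwards [h.velocity] with t ht htI
    obtain ⟨A, -, -, -, hp, hA, -⟩ := ht htI
    refine ⟨hp.differentiableAt, ?_⟩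
    rw [hp.deriv, hinner, neg_nonneg]
    rcases hneg t htI A hA with rfl | hlt
    · rw [inner_zero_left]
    · exact hlt.le)
  filter_upwards [hzero, h.velocity] with t hzero ht htI
  obtain ⟨A, -, -, -, hp, hA, -⟩ := ht htI
  have hAs := hzero htI
  rw [hp.deriv, hinner, neg_eq_zero] at hAs
  obtain rfl := (hneg t htI A hA).resolve_right hAs.not_lt
  simpa using hp

lemma not_translate_mem_interior (h : IsCharPair ε K T q p) (hTi : (interior T).Nonempty)
    (s : EuclideanSpace ℝ ι) : ¬ ∀ t ∈ Icc (0 : ℝ) 1, q t + s ∈ interior K := by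
  intro hs
  have hp0 := h.ae_hasDerivAt_snd_zero_of_translate_mem_interior hs
  obtain ⟨c, hc⟩ := h.absCont_snd.const_of_ae_hasDerivAt_zero (by rwa [uIcc_of_le zero_le_one])
  rw [uIcc_of_le zero_le_one] at hc
  obtain ⟨x, hx⟩ := hTi
  -- `q` moves away from `x` relative to `c` at a positive rate, so it cannot close up.
  have hpos : ∀ᵐ t : ℝ, t ∈ Icc (0 : ℝ) 1 →
      DifferentiableAt ℝ q t ∧ 0 < inner ℝ (ε • (c - x)) (deriv q t) := by
    filter_upwards [hp0, h.velocity] with t hp0 ht htI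
    obtain ⟨A, B, hne, hq, hp, -, hB⟩ := ht htI
    refine ⟨hq.differentiableAt, ?_⟩
    have hε : ε ≠ 0 := left_ne_zero_of_mul_eq_one h.sign
    have hA : A = 0 :=
      (smul_eq_zero.1 (hp.unique (hp0 htI))).resolve_left (neg_ne_zero.2 hε)
    have hlt := inner_lt_of_mem_interior (hne.resolve_left (not_not.2 hA)) hB hx
    rw [hc t htI] at hlt
    rw [hq.deriv, real_inner_smul_left, real_inner_smul_right, ← mul_assoc, h.sign, one_mul,
      real_inner_comm, inner_sub_right]
    exact sub_pos.2 hlt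
  have hzero := ae_inner_deriv_eq_zero_of_nonneg zero_le_one h.absCont_fst h.closed_fst _
    (hpos.mono fun t ht htI => ⟨(ht htI).1, (ht htI).2.le⟩)
  have hnull : ∀ᵐ t : ℝ, t ∉ Icc (0 : ℝ) 1 := by
    filter_upwards [hpos, hzero] with t hpos hzero htI using (hpos htI).2.ne' (hzero htI)
  rw [← measure_eq_zero_iff_ae_notMem, Real.volume_Icc] at hnull
  norm_num at hnull

end IsCharPair

section Prod

variable {E F : Type*} [NormedAddCommGroup E] [NormedSpace ℝ E] [NormedAddCommGroup F]
  [NormedSpace ℝ F] {γ : ℝ → E × F} {v : E × F} {t : ℝ}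

lemma hasDerivAt_fst (h : HasDerivAt γ v t) : HasDerivAt (fun s => (γ s).1) v.1 t :=
  (ContinuousLinearMap.fst ℝ E F).hasFDerivAt.comp_hasDerivAt t h

lemma hasDerivAt_snd (h : HasDerivAt γ v t) : HasDerivAt (fun s => (γ s).2) v.2 t :=
  (ContinuousLinearMap.snd ℝ E F).hasFDerivAt.comp_hasDerivAt t h

end Prod

namespace IsClosedCharacteristic

variable {K T : Set Plane} {z : Phase} {γ : ℝ → Phase}

lemma absCont_fst {C : Set Phase} (h : IsClosedCharacteristic C γ) :
    AbsolutelyContinuousOnInterval (fun t => (γ t).1) 0 1 :=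
  absolutelyContinuousOnInterval_lipschitz_comp LipschitzWith.prod_fst h.absCont

lemma absCont_snd {C : Set Phase} (h : IsClosedCharacteristic C γ) :
    AbsolutelyContinuousOnInterval (fun t => (γ t).2) 0 1 :=
  absolutelyContinuousOnInterval_lipschitz_comp LipschitzWith.prod_snd h.absCont

lemma action_eq_pairing {C : Set Phase} (h : IsClosedCharacteristic C γ) :
    action γ = pairing (fun t => (γ t).1) (fun t => (γ t).2) 0 1 := by
  have hparts := pairing_add_pairing_swap h.absCont_fst h.absCont_snd
  rw [h.closed, sub_self] at hparts
  have hintegral : ∫ t in (0 : ℝ)..1, dot (J4 (deriv γ t)) (γ t) =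
      pairing (fun t => (γ t).2) (fun t => (γ t).1) 0 1 -
        pairing (fun t => (γ t).1) (fun t => (γ t).2) 0 1 := by
    rw [pairing, pairing, ← intervalIntegral.integral_sub
      (intervalIntegrable_inner_deriv h.absCont_snd h.absCont_fst.continuousOn)
      (intervalIntegrable_inner_deriv h.absCont_fst h.absCont_snd.continuousOn)]
    refine intervalIntegral.integral_congr_ae ?_
    filter_upwards [ae_mem_Icc_of_ae_mem_Ioo h.velocity] with t ht htI
    rw [uIoc_of_le zero_le_one] at htI
    obtain ⟨_, _, _, _, hd⟩ := ht (Ioc_subset_Icc_self htI)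
    rw [hd.deriv, (hasDerivAt_fst hd).deriv, (hasDerivAt_snd hd).deriv]
    simp [dot, J4, sub_eq_add_neg]
  rw [action, hintegral]
  linarith

lemma add_mem_prod (hK : IsConvexBody K) (hT : IsConvexBody T) (hz : z ∈ interior (K ×ˢ T))
    (h : IsClosedCharacteristic (-z +ᵥ (K ×ˢ T)) γ) {t : ℝ} (ht : t ∈ Icc (0 : ℝ) 1) :
    γ t + z ∈ K ×ˢ T := by
  have hclosed : IsClosed (-z +ᵥ (K ×ˢ T)) := (hK.1.isClosed.prod hT.1.isClosed).vadd _
  have hmem := (gauge_le_one_iff_mem_closure ((hK.2.1.prod hT.2.1).vadd (-z))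
    (neg_vadd_mem_nhds_zero hz)).1 (h.boundary t ht).le
  rwa [hclosed.closure_eq, mem_neg_vadd_set_iff] at hmem

lemma isCharPair (hK : IsConvexBody K) (hT : IsConvexBody T) (hz : z ∈ interior (K ×ˢ T))
    (h : IsClosedCharacteristic (-z +ᵥ (K ×ˢ T)) γ) :
    IsCharPair 1 K T (fun t => (γ t).1 + z.1) (fun t => (γ t).2 + z.2) where
  sign := one_mul 1
  absCont_fst := absolutelyContinuousOnInterval_lipschitz_comp
    (isometry_add_right z.1).lipschitz h.absCont_fst
  absCont_snd := absolutelyContinuousOnInterval_lipschitz_comp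
    (isometry_add_right z.2).lipschitz h.absCont_snd
  closed_fst := by simp only [h.closed]
  closed_snd := by simp only [h.closed]
  mem_fst t ht := (h.add_mem_prod hK hT hz ht).1
  mem_snd t ht := (h.add_mem_prod hK hT hz ht).2
  velocity := by
    refine ae_mem_Icc_of_ae_mem_Ioo ?_
    filter_upwards [h.velocity] with t ht htI
    obtain ⟨r, hr, n, hn, hd⟩ := ht htI
    have htI' := Ioo_subset_Icc_self htI
    obtain ⟨hle, heq⟩ := normal_of_mem_subdifferential (h.boundary t htI') hn
    have hmax : ∀ y ∈ K ×ˢ T, dot n y ≤ dot n (γ t + z) := fun y hy => by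
      have hy' := hle (y - z) (mem_neg_vadd_set_iff.2 (by rwa [sub_add_cancel]))
      rw [dot_sub_right] at hy'
      rw [dot_add_right, heq]
      linarith
    obtain ⟨hq, hp⟩ := h.add_mem_prod hK hT hz htI'
    refine ⟨r • n.1, r • n.2, ?_, ?_, ?_, fun y hy => ?_, fun y hy => ?_⟩
    · by_contra! hn0
      simp only [smul_eq_zero_iff_right hr.ne'] at hn0
      simp [dot, hn0] at heq
    · simpa [J4] using (hasDerivAt_fst hd).add_const z.1
    · simpa [J4] using (hasDerivAt_snd hd).add_const z.2
    · rw [real_inner_smul_left, real_inner_smul_left]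
      exact mul_le_mul_of_nonneg_left
        (by simpa [dot] using hmax (y, (γ t).2 + z.2) ⟨hy, hp⟩) hr.le
    · rw [real_inner_smul_left, real_inner_smul_left]
      exact mul_le_mul_of_nonneg_left
        (by simpa [dot] using hmax ((γ t).1 + z.1, y) ⟨hq, hy⟩) hr.le

lemma exists_isCharPair (hK : IsConvexBody K) (hT : IsConvexBody T) (hz : z ∈ interior (K ×ˢ T))
    (h : IsClosedCharacteristic (-z +ᵥ (K ×ˢ T)) γ) :
    ∃ q p, IsCharPair 1 K T q p ∧ action γ = pairing q p 0 1 := by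
  refine ⟨_, _, h.isCharPair hK hT hz, ?_⟩
  rw [pairing_add_const h.absCont_fst h.absCont_snd, h.closed, sub_self, inner_zero_left, add_zero,
    h.action_eq_pairing]

end IsClosedCharacteristic

/-! ### Convex bodies and equality cases -/

namespace IsConvexBody

variable {S : Set Plane}

lemma of_volume_pos (hS : IsCompact S) (hc : Convex ℝ S) (hv : 0 < volume.real S) :
    IsConvexBody S := by
  refine ⟨hS, hc, nonempty_iff_ne_empty.2 fun hempty => ?_⟩
  have hnull := hc.addHaar_frontier volume
  rw [frontier, hempty, sdiff_empty, hS.isClosed.closure_eq] at hnull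
  simp [Measure.real, hnull] at hv

lemma volume_pos (hS : IsConvexBody S) : 0 < volume.real S :=
  ENNReal.toReal_pos (Measure.measure_pos_of_nonempty_interior volume hS.2.2).ne'
    hS.1.measure_ne_top

lemma vadd_smul (hS : IsConvexBody S) {r : ℝ} (hr : 0 < r) (s : Plane) :
    IsConvexBody (s +ᵥ r • S) := by
  refine of_volume_pos ((hS.1.smul r).vadd s) ((hS.2.1.smul r).vadd s) ?_
  rw [volume_real_vadd_smul]
  exact mul_pos (by positivity) hS.volume_pos

lemma eq_of_subset_of_volume_le {A : Set Plane} (hS : IsConvexBody S) (hA : IsClosed A)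
    (hAS : A ⊆ S) (hv : volume.real S ≤ volume.real A) : A = S :=
  eq_of_subset_of_convex_of_measure_le hS.2.1 hS.2.2 hS.1.measure_ne_top hA hAS
    ((ENNReal.toReal_le_toReal hS.1.measure_ne_top
      (measure_ne_top_of_subset hAS hS.1.measure_ne_top)).1 hv)

end IsConvexBody

lemma IsEHZCapacity.nonneg {K T : Set Plane} (hK : IsConvexBody K) (hT : IsConvexBody T) {c : ℝ}
    (hc : IsEHZCapacity (K ×ˢ T) c) : 0 ≤ c := by
  obtain ⟨z, hz, γ, hγ, rfl⟩ := hc.1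
  obtain ⟨q, p, h, hA⟩ := hγ.exists_isCharPair hK hT hz
  obtain ⟨w, hw⟩ := hT.2.2
  have hwT := interior_subset hw
  rw [hA]
  simpa using h.inner_segment_le_pairing (left_mem_Icc.2 zero_le_one) (left_mem_Icc.2 zero_le_one)
    hwT hwT

lemma volume_real_prod (K T : Set Plane) :
    volume.real (K ×ˢ T) = volume.real K * volume.real T := by
  rw [Measure.volume_eq_prod, measureReal_prod_prod]

lemma IsEqualityCase.exists_pos {K T : Set Plane} (h : IsEqualityCase K T) :
    ∃ c : ℝ, 0 < c ∧ IsEHZCapacity (K ×ˢ T) c ∧ volume.real K * volume.real T = c ^ 2 / 2 := by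
  obtain ⟨hK, hT, c, hc, hv⟩ := h
  rw [volume_real_prod] at hv
  refine ⟨c, (hc.nonneg hK hT).lt_of_ne' ?_, hc, hv⟩
  rintro rfl
  exact (mul_pos hK.volume_pos hT.volume_pos).ne' (by rw [hv]; norm_num)

lemma inner_le_of_mem_convexHull {E : Type*} [NormedAddCommGroup E] [InnerProductSpace ℝ E]
    {A : Set E} {d : E} {M : ℝ} (h : ∀ x ∈ A, inner ℝ d x ≤ M) :
    ∀ x ∈ convexHull ℝ A, inner ℝ d x ≤ M :=
  convexHull_min h (convex_halfSpace_le (innerₛₗ ℝ d).isLinear M)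

lemma vadd_smul_convexHull_subset {E : Type*} [AddCommGroup E] [Module ℝ E] {A T : Set E}
    (hT : Convex ℝ T) {s : E} {r : ℝ} (h : ∀ x ∈ A, s + r • x ∈ T) :
    s +ᵥ r • convexHull ℝ A ⊆ T := by
  rw [← convexHull_smul, ← convexHull_vadd]
  refine convexHull_min ?_ hT
  rintro _ ⟨_, ⟨x, hx, rfl⟩, rfl⟩
  exact h x hx

/-! ### Triangles -/

/-- Twice the signed area of the triangle with vertices `v 0`, `v 1`, `v 2`. -/
def doubleArea (v : Fin 3 → Plane) : ℝ := cross (v 1 - v 0) (v 2 - v 0)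

/-- The barycentric coordinate of `x` opposite to the side `v (i + 1)`, `v (i + 2)` of a triangle,
scaled by `doubleArea v`; indices are taken modulo `3`. -/
def sideCoord (v : Fin 3 → Plane) (i : Fin 3) (x : Plane) : ℝ :=
  cross (v (i + 2) - v (i + 1)) (x - v (i + 1))

section Triangle

variable {v : Fin 3 → Plane}

lemma sideCoord_vertex (v : Fin 3 → Plane) (i j : Fin 3) :
    sideCoord v i (v j) = if i = j then doubleArea v else 0 := by
  fin_cases i <;> fin_cases j <;>
    simp [sideCoord, doubleArea, cross_apply] <;> ring

lemma sideCoord_add_smul_sub (v : Fin 3 → Plane) (i : Fin 3) (x y z : Plane) (r : ℝ) :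
    sideCoord v i (x + r • (y - z)) =
      sideCoord v i x + r * (sideCoord v i y - sideCoord v i z) := by
  simp only [sideCoord, map_sub, map_add, map_smul, smul_eq_mul]
  ring

lemma sum_sideCoord (v : Fin 3 → Plane) (x : Plane) : ∑ i, sideCoord v i x = doubleArea v := by
  simp [Fin.sum_univ_three, sideCoord, doubleArea, cross_apply]
  ring

lemma sum_sideCoord_smul (v : Fin 3 → Plane) (x : Plane) :
    ∑ i, sideCoord v i x • v i = doubleArea v • x := by
  ext j
  fin_cases j <;> simp [Fin.sum_univ_three, sideCoord, doubleArea, cross_apply] <;> ring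

lemma vertex_mem_halfPlane (hv : 0 ≤ doubleArea v) (i j : Fin 3) :
    v j ∈ halfPlane (v (i + 1)) (v (i + 2)) := by
  change 0 ≤ sideCoord v i (v j)
  rw [sideCoord_vertex]
  split_ifs
  exacts [hv, le_rfl]

lemma doubleArea_neg_index (v : Fin 3 → Plane) : doubleArea (fun i => v (-i)) = -doubleArea v := by
  simp only [doubleArea, neg_zero, show (-1 : Fin 3) = 2 from rfl, show (-2 : Fin 3) = 1 from rfl,
    cross_apply]
  ring

lemma doubleArea_ne_zero (hv : AffineIndependent ℝ v) : doubleArea v ≠ 0 := by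
  intro h
  have hzero : ∀ x, cross (v 2 - v 1) (x - v 1) = 0 := fun x =>
    affineIndependent_iff.1 hv Finset.univ (fun i => sideCoord v i x)
      (by rw [sum_sideCoord, h]) (by rw [sum_sideCoord_smul, h, zero_smul]) 0 (Finset.mem_univ _)
  refine cross_ne_zero (sub_ne_zero.2 (hv.injective.ne (by decide : (2 : Fin 3) ≠ 1))) ?_
  ext x
  simpa using hzero (x + v 1)

lemma mem_triangle_iff (hv : 0 < doubleArea v) {x : Plane} :
    x ∈ convexHull ℝ (range v) ↔ ∀ i, 0 ≤ sideCoord v i x := by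
  constructor
  · intro hx i
    exact convexHull_min (range_subset_iff.2 (vertex_mem_halfPlane hv.le i))
      (convex_halfPlane _ _) hx
  · intro h
    have hx : x = ∑ i, (sideCoord v i x / doubleArea v) • v i := by
      simp only [div_eq_inv_mul, mul_smul, ← Finset.smul_sum, sum_sideCoord_smul]
      rw [inv_smul_smul₀ hv.ne']
    rw [hx]
    refine (convex_convexHull ℝ _).sum_mem (fun i _ => div_nonneg (h i) hv.le) ?_
      fun i _ => subset_convexHull ℝ _ (mem_range_self i)
    rw [← Finset.sum_div, sum_sideCoord, div_self hv.ne']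

lemma mem_interior_triangle (hv : 0 < doubleArea v) {x : Plane} (hx : ∀ i, 0 < sideCoord v i x) :
    x ∈ interior (convexHull ℝ (range v)) := by
  have hopen : IsOpen {y | ∀ i, 0 < sideCoord v i y} := by
    simp only [ofPred_forall]
    refine isOpen_iInter_of_finite fun i => isOpen_lt continuous_const ?_
    exact (LinearMap.continuous_of_finiteDimensional _).comp (continuous_id.sub continuous_const)
  exact interior_maximal (fun y hy => (mem_triangle_iff hv).2 fun i => (hy i).le) hopen hx

lemma volume_real_convexHull_range (v : Fin 3 → Plane) :
    volume.real (convexHull ℝ (range v)) = |doubleArea v| / 2 := by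
  have hrange : range v = {v 0, v 1, v 2} := by
    ext x
    simp [Fin.exists_fin_succ, eq_comm]
  rw [hrange, volume_real_triangle, doubleArea]

lemma isConvexBody_triangle (hv : 0 < doubleArea v) : IsConvexBody (convexHull ℝ (range v)) := by
  refine .of_volume_pos ((finite_range v).isCompact_convexHull ℝ) (convex_convexHull ℝ _) ?_
  rw [volume_real_convexHull_range]
  positivity

lemma IsTriangle.exists_vertices {D : Set Plane} (h : IsTriangle D) :
    ∃ v, 0 < doubleArea v ∧ D = convexHull ℝ (range v) := by
  obtain ⟨v, hv, rfl⟩ := h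
  rcases (doubleArea_ne_zero hv).lt_or_gt with hneg | hpos
  · refine ⟨fun i => v (-i), by rw [doubleArea_neg_index]; linarith, ?_⟩
    exact congrArg _ ((Equiv.neg (Fin 3)).surjective.range_comp v).symm
  · exact ⟨v, hpos, rfl⟩

end Triangle

/-! ### A triangle and its reflection in a convex set -/

section TriangleArea

variable {H : Set Plane} {v w : Fin 3 → Plane}

lemma volume_inter_halfPlanes_sub_sum_le (hc : Convex ℝ H) (hH : volume H ≠ ⊤)
    (hX : 0 ≤ doubleArea v) (hv : ∀ i, v i ∈ H) (hw : ∀ i, w i ∈ H)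
    (hvw : ∀ i j, i ≠ j → 0 ≤ sideCoord v j (w i)) (s : Finset (Fin 3)) :
    volume.real (H ∩ ⋂ i ∈ s, halfPlane (v (i + 1)) (v (i + 2))) -
      (∑ i ∈ s, sideCoord v i (w i)) / 2 ≤ volume.real H := by
  induction s using Finset.induction_on with
  | empty => simp
  | insert j s hj ih =>
    have hvertex : ∀ k, v k ∈ H ∩ ⋂ i ∈ s, halfPlane (v (i + 1)) (v (i + 2)) := fun k =>
      ⟨hv k, mem_iInter₂.2 fun i _ => vertex_mem_halfPlane hX i k⟩
    have hcut := volume_inter_halfPlane_sub_cross_le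
      (hc.inter (convex_iInter₂ fun i _ => convex_halfPlane _ _))
      (volume_inter_ne_top hH _) (hvertex (j + 1)) (hvertex (j + 2)) (c := w j)
      ⟨hw j, mem_iInter₂.2 fun i hi => hvw j i (ne_of_mem_of_not_mem hi hj).symm⟩
    rw [Finset.set_biInter_insert, inter_comm (halfPlane _ _), ← inter_assoc,
      Finset.sum_insert hj]
    change _ - sideCoord v j (w j) / 2 ≤ _ at hcut
    linarith

-- The three triangles cut off by the sides of `v` and the triangle `v` itself do not overlap.
lemma doubleArea_sub_sum_sideCoord_le_volume (hc : Convex ℝ H) (hH : volume H ≠ ⊤)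
    (hX : 0 ≤ doubleArea v) (hv : ∀ i, v i ∈ H) (hw : ∀ i, w i ∈ H)
    (hvw : ∀ i j, i ≠ j → 0 ≤ sideCoord v j (w i)) :
    (doubleArea v - ∑ i, sideCoord v i (w i)) / 2 ≤ volume.real H := by
  have hcut := volume_inter_halfPlanes_sub_sum_le hc hH hX hv hw hvw Finset.univ
  have hvertex : ∀ k, v k ∈ H ∩ ⋂ i ∈ Finset.univ, halfPlane (v (i + 1)) (v (i + 2)) := fun k =>
    ⟨hv k, mem_iInter₂.2 fun i _ => vertex_mem_halfPlane hX i k⟩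
  have htri := abs_cross_div_two_le_volume
    (hc.inter (convex_iInter₂ fun i _ => convex_halfPlane _ _))
    (volume_inter_ne_top hH _) (hvertex 0) (hvertex 1) (hvertex 2)
  have hle := le_abs_self (doubleArea v)
  rw [← doubleArea] at htri
  linarith

lemma doubleArea_le_volume_of_reflection_mem (hc : Convex ℝ H) (hH : volume H ≠ ⊤)
    (hX : 0 ≤ doubleArea v) (hv : ∀ i, v i ∈ H) {t : Plane} (ht : ∀ i, t - v i ∈ H) :
    doubleArea v ≤ volume.real H := by
  have hsum : ∑ i, sideCoord v i (t - v i) = -doubleArea v := by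
    simp [Fin.sum_univ_three, sideCoord, doubleArea, cross_apply]
    ring
  have hshift : ∀ i j, i ≠ j →
      sideCoord v j (t - v i) = sideCoord v j (t - v j) + doubleArea v := by
    intro i j hij
    have h := sideCoord_add_smul_sub v j (t - v j) (v j) (v i) 1
    rw [one_smul, sub_add_sub_cancel, sideCoord_vertex, sideCoord_vertex, if_pos rfl,
      if_neg hij.symm] at h
    rw [h]
    ring
  by_cases hfar : ∃ j, sideCoord v j (t - v j) ≤ -doubleArea v
  · obtain ⟨j, hj⟩ := hfar
    have h := cross_sub_cross_div_two_le_volume hc hH (hv (j + 1)) (hv (j + 2)) (hv j) (ht j)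
    change (sideCoord v j (v j) - sideCoord v j (t - v j)) / 2 ≤ _ at h
    rw [sideCoord_vertex, if_pos rfl] at h
    linarith
  · push Not at hfar
    have h := doubleArea_sub_sum_sideCoord_le_volume hc hH hX hv ht fun i j hij => by
      rw [hshift i j hij]
      linarith [hfar j]
    rw [hsum] at h
    linarith

end TriangleArea

/-! ### Lagrangian products with a triangle -/

lemma inner_plane (x y : Plane) : inner ℝ x y = x 0 * y 0 + x 1 * y 1 := by
  simp [PiLp.inner_apply, mul_comm]

/-- The rotation `J2` as a linear map. -/
def J2Lin : Plane →ₗ[ℝ] Plane where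
  toFun := J2
  map_add' x y := by ext i; fin_cases i <;> simp [J2, add_comm]
  map_smul' r x := by ext i; fin_cases i <;> simp [J2]

lemma J2_sub (a b : Plane) : J2 (a - b) = J2 a - J2 b := map_sub J2Lin a b

lemma inner_J2 (a b : Plane) : inner ℝ (J2 a) b = cross b a := by
  simp only [inner_plane, J2, cross_apply, Matrix.cons_val_zero, Matrix.cons_val_one]
  ring

lemma cross_J2 (a b : Plane) : cross (J2 a) (J2 b) = cross a b := by
  simp only [J2, cross_apply, Matrix.cons_val_zero, Matrix.cons_val_one]
  ring

section TriangleProduct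

variable {v : Fin 3 → Plane} {T : Set Plane} {r : ℝ}

lemma doubleArea_J2_comp (v : Fin 3 → Plane) : doubleArea (J2 ∘ v) = doubleArea v := by
  simp only [doubleArea, Function.comp_apply, ← J2_sub, cross_J2]

lemma doubleArea_smul_add_const (v : Fin 3 → Plane) (r : ℝ) (s : Plane) :
    doubleArea (fun i => (r • v) i + s) = r ^ 2 * doubleArea v := by
  simp only [doubleArea, Pi.smul_apply, add_sub_add_right_eq_sub, ← smul_sub, map_smul,
    LinearMap.smul_apply, smul_eq_mul]
  ring

lemma sq_mul_doubleArea_le_volume_of_fits (hv : 0 ≤ doubleArea v) (hT : Convex ℝ T)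
    (hfin : volume T ≠ ⊤) (h : Fits T (r • (J2 ∘ v))) (h' : Fits T (-(r • (J2 ∘ v)))) :
    r ^ 2 * doubleArea v ≤ volume.real T := by
  obtain ⟨s, hs⟩ := h
  obtain ⟨s', hs'⟩ := h'
  have hX := doubleArea_smul_add_const (J2 ∘ v) r s
  rw [doubleArea_J2_comp] at hX
  rw [← hX]
  refine doubleArea_le_volume_of_reflection_mem hT hfin (by rw [hX]; positivity) hs
    (t := s + s') fun i => ?_
  convert hs' i using 1
  simp only [Pi.neg_apply]
  abel

-- A curve `q` missing a side of the triangle could be translated into its interior.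
lemma IsCharPair.exists_sideCoord_eq_zero {ε : ℝ} {q p : ℝ → Plane} (hv : 0 < doubleArea v)
    (h : IsCharPair ε (convexHull ℝ (range v)) T q p) (hTi : (interior T).Nonempty) (i : Fin 3) :
    ∃ t ∈ Icc (0 : ℝ) 1, sideCoord v i (q t) = 0 := by
  have hq : ContinuousOn q (Icc 0 1) := by
    simpa only [uIcc_of_le zero_le_one] using h.absCont_fst.continuousOn
  have hcont : ContinuousOn (fun t => sideCoord v i (q t)) (Icc 0 1) :=
    (LinearMap.continuous_of_finiteDimensional _).comp_continuousOn (hq.sub continuousOn_const)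
  obtain ⟨t₀, ht₀, hmin⟩ := isCompact_Icc.exists_isMinOn (nonempty_Icc.2 (zero_le_one' ℝ)) hcont
  refine ⟨t₀, ht₀, le_antisymm ?_ ((mem_triangle_iff hv).1 (h.mem_fst t₀ ht₀) i)⟩
  by_contra! hpos
  set δ := sideCoord v i (q t₀) / (4 * doubleArea v) with hδ
  have hδ0 : 0 < δ := by positivity
  have hδX : 4 * (δ * doubleArea v) = sideCoord v i (q t₀) := by rw [hδ]; field_simp
  refine h.not_translate_mem_interior hTi
    (δ • (v (i + 1) - v i) + δ • (v (i + 2) - v i)) fun t ht => mem_interior_triangle hv fun j => ?_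
  have hj := (mem_triangle_iff hv).1 (h.mem_fst t ht) j
  have hδv := mul_pos hδ0 hv
  rw [← add_assoc, sideCoord_add_smul_sub, sideCoord_add_smul_sub]
  simp only [sideCoord_vertex]
  obtain rfl | rfl | rfl : j = i ∨ j = i + 1 ∨ j = i + 2 := by grind
  · have : sideCoord v j (q t₀) ≤ sideCoord v j (q t) := hmin ht
    simp
    linarith
  · simp
    linarith
  · simp
    linarith

lemma cyclic_or_anticyclic {α : Type*} [LinearOrder α] (t : Fin 3 → α) :
    ((t 0 ≤ t 1 ∧ t 1 ≤ t 2) ∨ (t 1 ≤ t 2 ∧ t 2 ≤ t 0) ∨ (t 2 ≤ t 0 ∧ t 0 ≤ t 1)) ∨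
      ((t 0 ≤ t 2 ∧ t 2 ≤ t 1) ∨ (t 2 ≤ t 1 ∧ t 1 ≤ t 0) ∨ (t 1 ≤ t 0 ∧ t 0 ≤ t 2)) := by
  grind

lemma IsCharPair.mul_doubleArea_le_pairing {q p : ℝ → Plane} (hv : 0 < doubleArea v)
    (h : IsCharPair 1 (convexHull ℝ (range v)) T q p) (hTi : (interior T).Nonempty)
    (hfit : Fits T (r • (J2 ∘ v))) (hfit' : Fits T (-(r • (J2 ∘ v)))) :
    r * doubleArea v ≤ pairing q p 0 1 := by
  choose t ht hside using h.exists_sideCoord_eq_zero hv hTi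
  obtain ⟨s, hs⟩ := hfit
  obtain ⟨s', hs'⟩ := hfit'
  have h0 := hside 0
  have h1 := hside 1
  have h2 := hside 2
  rcases cyclic_or_anticyclic t with hcyc | hanti
  · have hle := h.inner_triangle_le_pairing ht hcyc fun i => hs' (i + 2)
    rw [one_mul, one_mul] at hle
    refine le_trans (le_of_eq ?_) hle
    simp [inner_plane, J2, sideCoord, doubleArea, cross_apply] at h0 h1 h2 ⊢
    linear_combination r * (h0 + h1 + h2)
  · have hle := h.inner_triangle_le_pairing (s := fun i => t (-i)) (fun i => ht (-i)) hanti
      fun i => hs (1 - i)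
    rw [one_mul, one_mul, show (-1 : Fin 3) = 2 from rfl, show (-2 : Fin 3) = 1 from rfl] at hle
    refine le_trans (le_of_eq ?_) hle
    simp [inner_plane, J2, sideCoord, doubleArea, cross_apply] at h0 h1 h2 ⊢
    linear_combination r * (h0 + h1 + h2)

lemma supportFn_J2_side_le (hv : 0 < doubleArea v) (i : Fin 3) :
    supportFn (convexHull ℝ (range v)) (J2 (v (i + 2) - v (i + 1))) ≤
      cross (v (i + 1)) (v (i + 2)) := by
  refine supportFn_le ((range_nonempty v).convexHull (𝕜 := ℝ)) fun x hx => ?_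
  have hside := (mem_triangle_iff hv).1 hx i
  rw [inner_J2]
  simp only [sideCoord, cross_apply, PiLp.sub_apply] at hside ⊢
  linarith

lemma sum_supportFn_J2_sides_le (hv : 0 < doubleArea v) :
    ∑ i, supportFn (convexHull ℝ (range v)) (J2 (v (i + 1)) - J2 (v i)) ≤ doubleArea v := by
  have hsum : ∑ i, cross (v (i + 1)) (v (i + 2)) = doubleArea v := by
    simp [Fin.sum_univ_three, doubleArea, cross_apply]
    ring
  rw [← hsum, ← Equiv.sum_comp (Equiv.addRight (1 : Fin 3))]
  refine Finset.sum_le_sum fun i _ => ?_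
  rw [Equiv.coe_addRight, ← J2_sub, add_assoc]
  exact supportFn_J2_side_le hv i

lemma polygonLength_neg_smul_J2_le (hv : 0 < doubleArea v) (hr : 0 ≤ r) :
    polygonLength (convexHull ℝ (range v)) (-(r • (J2 ∘ v))) ≤ r * doubleArea v := by
  rw [← smul_neg, polygonLength_smul _ hr]
  refine mul_le_mul_of_nonneg_left ?_ hr
  simpa [polygonLength, neg_add_eq_sub] using sum_supportFn_J2_sides_le hv

lemma polygonLength_smul_J2_le (hv : 0 < doubleArea v) (hr : 0 ≤ r) :
    polygonLength (convexHull ℝ (range v)) (fun i => (r • (J2 ∘ v)) (-i)) ≤ r * doubleArea v := by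
  have hW : (fun i => (r • (J2 ∘ v)) (-i)) = r • fun i => J2 (v (-i)) := rfl
  rw [hW, polygonLength_smul _ hr]
  refine mul_le_mul_of_nonneg_left (le_trans (le_of_eq ?_) (sum_supportFn_J2_sides_le hv)) hr
  rw [polygonLength, ← Equiv.sum_comp (Equiv.subLeft (-1 : Fin 3))]
  simp

lemma isEHZCapacity_triangle (hv : 0 < doubleArea v) (hT : IsConvexBody T) (hr : 0 < r)
    (hfit : Fits T (r • (J2 ∘ v))) (hfit' : Fits T (-(r • (J2 ∘ v))))
    (hvol : volume.real T ≤ r ^ 2 * doubleArea v) :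
    IsEHZCapacity (convexHull ℝ (range v) ×ˢ T) (r * doubleArea v) := by
  have hD := isConvexBody_triangle hv
  have hlow : ∀ z ∈ interior (convexHull ℝ (range v) ×ˢ T), ∀ γ,
      IsClosedCharacteristic (-z +ᵥ (convexHull ℝ (range v) ×ˢ T)) γ →
        r * doubleArea v ≤ action γ := by
    intro z hz γ hγ
    obtain ⟨q, p, h, hA⟩ := hγ.exists_isCharPair hD hT hz
    rw [hA]
    exact h.mul_doubleArea_le_pairing hv hT.2.2 hfit hfit'
  by_cases hint : Fits (interior T) (r • (J2 ∘ v))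
  swap
  · exact isEHZCapacity_of_not_fits hD hT
      (mt (Fits.comp_equiv_iff (Equiv.neg (Fin 3))).1 hint) (polygonLength_smul_J2_le hv hr.le) hlow
  refine isEHZCapacity_of_not_fits hD hT (fun hint' => ?_)
    (polygonLength_neg_smul_J2_le hv hr.le) hlow
  -- If both triangles fit into the interior, then so do slightly larger ones, and `T` is too small.
  have hopen : IsOpen {ρ : ℝ | Fits (interior T) (ρ • (J2 ∘ v)) ∧
      Fits (interior T) (-(ρ • (J2 ∘ v)))} :=
    ((isOpen_setOf_fits isOpen_interior).preimage (by fun_prop)).inter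
      ((isOpen_setOf_fits isOpen_interior).preimage (by fun_prop))
  obtain ⟨ρ, hrρ, hρ, hρ'⟩ := (hopen.eventually_mem ⟨hint, hint'⟩).exists_gt
  have hle := (sq_mul_doubleArea_le_volume_of_fits hv.le hT.2.1 hT.1.measure_ne_top
    (hρ.mono interior_subset) (hρ'.mono interior_subset)).trans hvol
  exact (pow_lt_pow_left₀ hrρ hr.le two_ne_zero).not_ge (le_of_mul_le_mul_right hle hv)

lemma isEqualityCase_triangle_iff_fits (hv : 0 < doubleArea v) :
    IsEqualityCase (convexHull ℝ (range v)) T ↔ IsConvexBody T ∧ ∃ r > 0,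
      Fits T (r • (J2 ∘ v)) ∧ Fits T (-(r • (J2 ∘ v))) ∧
        volume.real T = r ^ 2 * doubleArea v := by
  have hD := isConvexBody_triangle hv
  have hvD : volume.real (convexHull ℝ (range v)) = doubleArea v / 2 := by
    rw [volume_real_convexHull_range, abs_of_pos hv]
  constructor
  · intro h
    obtain ⟨c, hc0, hc, hvol⟩ := h.exists_pos
    obtain ⟨r, rfl⟩ : ∃ r, c = r * doubleArea v := ⟨c / doubleArea v, by field_simp⟩
    have hr : 0 < r := pos_of_mul_pos_left hc0 hv.le
    refine ⟨h.2.1, r, hr, ?_, hc.fits hD h.2.1 (polygonLength_neg_smul_J2_le hv hr.le), ?_⟩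
    · exact (Fits.comp_equiv_iff (Equiv.neg (Fin 3))).1
        (hc.fits hD h.2.1 (polygonLength_smul_J2_le hv hr.le))
    · rw [hvD] at hvol
      refine mul_left_cancel₀ (half_pos hv).ne' (hvol.trans ?_)
      ring
  · rintro ⟨hT, r, hr, hfit, hfit', hvol⟩
    refine ⟨hD, hT, _, isEHZCapacity_triangle hv hT hr hfit hfit' hvol.le, ?_⟩
    rw [volume_real_prod, hvD, hvol]
    ring

end TriangleProduct

/-! ### Hulls of a triangle and its reflection -/

section DoubleHull

variable {v : Fin 3 → Plane} {T : Set Plane} {r : ℝ}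

lemma doubleHull_triangle (v : Fin 3 → Plane) (t : Plane) :
    doubleHull (convexHull ℝ (range v)) t =
      convexHull ℝ (range (J2 ∘ v) ∪ range fun i => t - J2 (v i)) := by
  have hJ : J2 '' convexHull ℝ (range v) = convexHull ℝ (range (J2 ∘ v)) := by
    rw [range_comp]
    exact J2Lin.image_convexHull _
  have hneg : t +ᵥ -range (J2 ∘ v) = range fun i => t - J2 (v i) := by
    rw [← Set.image_neg_eq_neg, ← image_vadd, ← range_comp, ← range_comp]
    simp only [Function.comp_def, vadd_eq_add, sub_eq_add_neg]
  rw [doubleHull, hJ, ← convexHull_neg, ← convexHull_vadd, hneg, convexHull_convexHull_union_left,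
    convexHull_convexHull_union_right]

lemma isCompact_doubleHull (v : Fin 3 → Plane) (t : Plane) :
    IsCompact (doubleHull (convexHull ℝ (range v)) t) := by
  rw [doubleHull_triangle]
  exact (toFinite _).isCompact_convexHull ℝ

lemma fits_vadd_smul_doubleHull (v : Fin 3 → Plane) (r : ℝ) (s t : Plane) :
    Fits (s +ᵥ r • doubleHull (convexHull ℝ (range v)) t) (r • (J2 ∘ v)) := by
  refine ⟨s, fun i => ⟨r • J2 (v i), smul_mem_smul_set ?_, add_comm _ _⟩⟩
  rw [doubleHull_triangle]
  exact subset_convexHull ℝ _ (.inl ⟨i, rfl⟩)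

lemma fits_neg_vadd_smul_doubleHull (v : Fin 3 → Plane) (r : ℝ) (s t : Plane) :
    Fits (s +ᵥ r • doubleHull (convexHull ℝ (range v)) t) (-(r • (J2 ∘ v))) := by
  refine ⟨s + r • t, fun i => ⟨r • (t - J2 (v i)), smul_mem_smul_set ?_, ?_⟩⟩
  · rw [doubleHull_triangle]
    exact subset_convexHull ℝ _ (.inr ⟨i, rfl⟩)
  · simp only [vadd_eq_add, Pi.neg_apply, Pi.smul_apply, Function.comp_apply]
    module

lemma exists_vadd_smul_doubleHull_subset (hT : Convex ℝ T) (hr : r ≠ 0)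
    (hfit : Fits T (r • (J2 ∘ v))) (hfit' : Fits T (-(r • (J2 ∘ v)))) :
    ∃ s t : Plane, s +ᵥ r • doubleHull (convexHull ℝ (range v)) t ⊆ T := by
  obtain ⟨s, hs⟩ := hfit
  obtain ⟨s', hs'⟩ := hfit'
  refine ⟨s, r⁻¹ • (s' - s), ?_⟩
  rw [doubleHull_triangle]
  refine vadd_smul_convexHull_subset hT ?_
  rintro _ (⟨i, rfl⟩ | ⟨i, rfl⟩)
  · rw [add_comm]
    exact hs i
  · convert hs' i using 1
    rw [smul_sub, smul_inv_smul₀ hr]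
    simp only [Pi.neg_apply, Pi.smul_apply, Function.comp_apply]
    abel

lemma doubleArea_le_volume_doubleHull (hv : 0 ≤ doubleArea v) (t : Plane) :
    doubleArea v ≤ volume.real (doubleHull (convexHull ℝ (range v)) t) := by
  have h := sq_mul_doubleArea_le_volume_of_fits (r := 1) hv
    (T := (0 : Plane) +ᵥ (1 : ℝ) • doubleHull (convexHull ℝ (range v)) t)
    (((convex_convexHull ℝ _).smul _).vadd _)
    (((isCompact_doubleHull v t).smul _).vadd _).measure_ne_top
    (fits_vadd_smul_doubleHull v 1 0 t) (fits_neg_vadd_smul_doubleHull v 1 0 t)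
  simpa using h

lemma convex_unitSquare : Convex ℝ unitSquare := by
  rintro x ⟨hx0, hx1⟩ y ⟨hy0, hy1⟩ a b ha hb hab
  exact ⟨by simpa using convex_Icc (0 : ℝ) 1 hx0 hy0 ha hb hab,
    by simpa using convex_Icc (0 : ℝ) 1 hx1 hy1 ha hb hab⟩

-- The minimum is attained when the two triangles form a parallelogram.
lemma exists_volume_doubleHull_le (hv : 0 ≤ doubleArea v) :
    ∃ t, volume.real (doubleHull (convexHull ℝ (range v)) t) ≤ doubleArea v := by
  set u := J2 ∘ v with hu
  have hsub : doubleHull (convexHull ℝ (range v)) (u 1 + u 2) ⊆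
      u 0 +ᵥ basisMap (u 1 - u 0) (u 2 - u 0) '' unitSquare := by
    rw [doubleHull_triangle]
    refine convexHull_min ?_ ((convex_unitSquare.linear_image _).vadd _)
    have hmem : ∀ {x : Plane} {a b : ℝ}, a ∈ Icc (0 : ℝ) 1 → b ∈ Icc (0 : ℝ) 1 →
        x = u 0 + (a • (u 1 - u 0) + b • (u 2 - u 0)) →
          x ∈ u 0 +ᵥ basisMap (u 1 - u 0) (u 2 - u 0) '' unitSquare := by
      rintro _ a b ha hb rfl
      exact vadd_mem_vadd_set ⟨!₂[a, b], ⟨ha, hb⟩, by simp [basisMap_apply]⟩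
    have h0 : (0 : ℝ) ∈ Icc (0 : ℝ) 1 := left_mem_Icc.2 zero_le_one
    have h1 : (1 : ℝ) ∈ Icc (0 : ℝ) 1 := right_mem_Icc.2 zero_le_one
    rintro _ (⟨i, rfl⟩ | ⟨i, rfl⟩) <;> fin_cases i
    · exact hmem (x := u 0) h0 h0 (by module)
    · exact hmem (x := u 1) h1 h0 (by module)
    · exact hmem (x := u 2) h0 h1 (by module)
    · exact hmem (x := u 1 + u 2 - u 0) h1 h1 (by module)
    · exact hmem (x := u 1 + u 2 - u 1) h0 h1 (by module)
    · exact hmem (x := u 1 + u 2 - u 2) h1 h0 (by module)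
  have hvol : volume.real (u 0 +ᵥ basisMap (u 1 - u 0) (u 2 - u 0) '' unitSquare) =
      doubleArea v := by
    rw [volume_real_vadd_image, det_basisMap, volume_real_unitSquare, mul_one, ← doubleArea, hu,
      doubleArea_J2_comp, abs_of_nonneg hv]
  refine ⟨u 1 + u 2, hvol ▸ measureReal_mono hsub ?_⟩
  rw [measure_vadd, Measure.addHaar_image_linearMap, volume_unitSquare, mul_one]
  exact ENNReal.ofReal_ne_top

lemma mem_minimalHulls_iff (hv : 0 ≤ doubleArea v) {S : Set Plane} :
    S ∈ minimalHulls (convexHull ℝ (range v)) ↔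
      ∃ t, S = doubleHull (convexHull ℝ (range v)) t ∧ volume.real S = doubleArea v := by
  have hfin := fun t => (isCompact_doubleHull v t).measure_ne_top (μ := volume)
  constructor
  · rintro ⟨t, hmin, rfl⟩
    obtain ⟨t', ht'⟩ := exists_volume_doubleHull_le hv
    exact ⟨t, rfl, ((ENNReal.toReal_mono (hfin t') (hmin t')).trans ht').antisymm
      (doubleArea_le_volume_doubleHull hv t)⟩
  · rintro ⟨t, rfl, hvol⟩
    refine ⟨t, fun t' => (ENNReal.toReal_le_toReal (hfin t) (hfin t')).1 ?_, rfl⟩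
    exact hvol.le.trans (doubleArea_le_volume_doubleHull hv t')

theorem isEqualityCase_triangle_iff (hv : 0 < doubleArea v) :
    IsEqualityCase (convexHull ℝ (range v)) T ↔
      ∃ S ∈ minimalHulls (convexHull ℝ (range v)), IsScaledTranslate S T := by
  rw [isEqualityCase_triangle_iff_fits hv]
  constructor
  · rintro ⟨hT, r, hr, hfit, hfit', hvol⟩
    obtain ⟨s, t, hsub⟩ := exists_vadd_smul_doubleHull_subset hT.2.1 hr.ne' hfit hfit'
    have hlow := doubleArea_le_volume_doubleHull hv.le t
    have heq := hT.eq_of_subset_of_volume_le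
      (((isCompact_doubleHull v t).smul r).vadd s).isClosed hsub (by
        rw [volume_real_vadd_smul, hvol]
        exact mul_le_mul_of_nonneg_left hlow (sq_nonneg r))
    refine ⟨_, (mem_minimalHulls_iff hv.le).2 ⟨t, rfl, ?_⟩, r, hr, s, heq.symm⟩
    rw [← heq, volume_real_vadd_smul] at hvol
    exact mul_left_cancel₀ (by positivity) hvol
  · rintro ⟨S, hS, r, hr, s, rfl⟩
    obtain ⟨t, rfl, hvol⟩ := (mem_minimalHulls_iff hv.le).1 hS
    have hbody : IsConvexBody (doubleHull (convexHull ℝ (range v)) t) :=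
      .of_volume_pos (isCompact_doubleHull v t) (convex_convexHull ℝ _) (hvol ▸ hv)
    exact ⟨hbody.vadd_smul hr s, r, hr, fits_vadd_smul_doubleHull v r s t,
      fits_neg_vadd_smul_doubleHull v r s t, by rw [volume_real_vadd_smul, hvol]⟩

end DoubleHull

/-! ### Diamonds -/

section Diamond

lemma mem_segment_of_snd_eq {a b y : ℝ} {p : Plane} (h₀ : p 0 ∈ Icc a b) (h₁ : p 1 = y) :
    p ∈ segment ℝ !₂[a, y] !₂[b, y] := by
  obtain ⟨s, t, hs, ht, hst, hp⟩ := Icc_subset_segment (𝕜 := ℝ) h₀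
  refine ⟨s, t, hs, ht, hst, ?_⟩
  ext i
  fin_cases i
  · simpa using hp
  · simp [h₁, ← add_mul, hst]

lemma mem_segment_of_fst_eq {a b x : ℝ} {p : Plane} (h₀ : p 0 = x) (h₁ : p 1 ∈ Icc a b) :
    p ∈ segment ℝ !₂[x, a] !₂[x, b] := by
  obtain ⟨s, t, hs, ht, hst, hp⟩ := Icc_subset_segment (𝕜 := ℝ) h₁
  refine ⟨s, t, hs, ht, hst, ?_⟩
  ext i
  fin_cases i
  · simp [h₀, ← add_mul, hst]
  · simpa using hp

lemma diamond_eq_convexHull (a₁ a₂ : ℝ) :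
    diamond a₁ a₂ = convexHull ℝ {!₂[a₁, 0], !₂[a₁, 1], !₂[0, a₂], !₂[1, a₂]} := by
  refine Subset.antisymm (convexHull_min ?_ (convex_convexHull ℝ _)) (convexHull_mono ?_)
  · rintro p (⟨h₀, h₁⟩ | ⟨h₀, h₁⟩)
    · exact segment_subset_convexHull (by simp) (by simp) (mem_segment_of_fst_eq h₀ h₁)
    · exact segment_subset_convexHull (by simp) (by simp) (mem_segment_of_snd_eq h₀ h₁)
  · rintro p (rfl | rfl | rfl | rfl) <;> simp

lemma vertices_subset_diamond (a₁ a₂ : ℝ) :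
    {!₂[a₁, 0], !₂[a₁, 1], !₂[0, a₂], !₂[1, a₂]} ⊆ diamond a₁ a₂ := by
  rw [diamond_eq_convexHull]
  exact subset_convexHull ℝ _

lemma convex_diamond (a₁ a₂ : ℝ) : Convex ℝ (diamond a₁ a₂) := convex_convexHull ℝ _

lemma isCompact_diamond (a₁ a₂ : ℝ) : IsCompact (diamond a₁ a₂) := by
  rw [diamond_eq_convexHull]
  exact (Set.toFinite _).isCompact_convexHull ℝ

variable {a₁ a₂ : ℝ}

lemma diamond_subset_unitSquare (h₁ : a₁ ∈ Icc (0 : ℝ) 1) (h₂ : a₂ ∈ Icc (0 : ℝ) 1) :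
    diamond a₁ a₂ ⊆ unitSquare := by
  refine convexHull_min ?_ convex_unitSquare
  rintro p (⟨rfl, hp⟩ | ⟨hp, rfl⟩)
  exacts [⟨h₁, hp⟩, ⟨hp, h₂⟩]

lemma diamond_subset_union_triangles (h₂ : a₂ ∈ Icc (0 : ℝ) 1) :
    diamond a₁ a₂ ⊆ convexHull ℝ {!₂[a₁, 0], !₂[a₁, 1], !₂[0, a₂]} ∪
      convexHull ℝ {!₂[a₁, 0], !₂[a₁, 1], !₂[1, a₂]} := by
  have hsegment (c : Plane) :
      segment ℝ !₂[a₁, 0] !₂[a₁, 1] ⊆ convexHull ℝ {!₂[a₁, 0], !₂[a₁, 1], c} :=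
    segment_subset_convexHull (by simp) (by simp)
  have hcenter (c : Plane) : !₂[a₁, a₂] ∈ convexHull ℝ {!₂[a₁, 0], !₂[a₁, 1], c} :=
    hsegment c (mem_segment_of_fst_eq (by simp) (by simpa using h₂))
  have hcvx (c : Plane) := convex_convexHull ℝ {!₂[a₁, 0], !₂[a₁, 1], c}
  have hvertex (c : Plane) : c ∈ convexHull ℝ {!₂[a₁, 0], !₂[a₁, 1], c} :=
    subset_convexHull ℝ _ (by simp)
  intro x hx
  rw [diamond_eq_convexHull, ← convexJoin_segments, mem_convexJoin] at hx
  obtain ⟨u, hu, w, hw, hx⟩ := hx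
  have hw₁ : w 1 = a₂ := by
    obtain ⟨s, t, -, -, hst, rfl⟩ := hw
    simp [← add_mul, hst]
  have hw₀ : w 0 ∈ Icc (0 : ℝ) 1 := by
    obtain ⟨s, t, hs, ht, hst, rfl⟩ := hw
    simpa [ht] using (by linarith : t ≤ 1)
  rcases le_total (w 0) a₁ with h | h
  · exact .inl ((hcvx _).segment_subset (hsegment _ hu) ((hcvx _).segment_subset (hvertex _)
      (hcenter _) (mem_segment_of_snd_eq ⟨hw₀.1, h⟩ hw₁)) hx)
  · exact .inr ((hcvx _).segment_subset (hsegment _ hu) ((hcvx _).segment_subset (hcenter _)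
      (hvertex _) (mem_segment_of_snd_eq ⟨h, hw₀.2⟩ hw₁)) hx)

lemma volume_real_diamond (h₁ : a₁ ∈ Icc (0 : ℝ) 1) (h₂ : a₂ ∈ Icc (0 : ℝ) 1) :
    volume.real (diamond a₁ a₂) = 1 / 2 := by
  refine le_antisymm ?_ ?_
  · calc volume.real (diamond a₁ a₂)
        ≤ volume.real (convexHull ℝ {!₂[a₁, 0], !₂[a₁, 1], !₂[0, a₂]} ∪
            convexHull ℝ {!₂[a₁, 0], !₂[a₁, 1], !₂[1, a₂]}) :=
          measureReal_mono (diamond_subset_union_triangles h₂) <|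
            (((Set.toFinite _).isCompact_convexHull ℝ).union
              ((Set.toFinite _).isCompact_convexHull ℝ)).measure_ne_top
      _ ≤ |a₁| / 2 + |1 - a₁| / 2 := by
          refine (measureReal_union_le _ _).trans_eq ?_
          simp [volume_real_triangle, cross_apply, abs_sub_comm a₁ 1]
      _ = 1 / 2 := by
          rw [abs_of_nonneg h₁.1, abs_of_nonneg (sub_nonneg.2 h₁.2)]
          ring
  · have h := abs_cross_chords_div_two_le_volume (convex_diamond a₁ a₂)
      (isCompact_diamond a₁ a₂).measure_ne_top
      (vertices_subset_diamond a₁ a₂ (by simp : !₂[a₁, 0] ∈ _))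
      (vertices_subset_diamond a₁ a₂ (by simp : !₂[a₁, 1] ∈ _))
      (vertices_subset_diamond a₁ a₂ (by simp : !₂[0, a₂] ∈ _))
      (vertices_subset_diamond a₁ a₂ (by simp : !₂[1, a₂] ∈ _))
    simpa [cross_apply] using h

lemma isConvexBody_diamond (h₁ : a₁ ∈ Icc (0 : ℝ) 1) (h₂ : a₂ ∈ Icc (0 : ℝ) 1) :
    IsConvexBody (diamond a₁ a₂) :=
  .of_volume_pos (isCompact_diamond a₁ a₂) (convex_diamond a₁ a₂)
    (by rw [volume_real_diamond h₁ h₂]; norm_num)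

end Diamond

/-! ### Products with a square -/

section Strips

/-- The parallelogram cut out by two strips of width parameter `a`, with normals `f₁` and `f₂`. -/
def stripInter (f₁ f₂ : Plane) (x y a : ℝ) : Set Plane :=
  {v | inner ℝ f₁ v ∈ Icc x (x + a) ∧ inner ℝ f₂ v ∈ Icc y (y + a)}

variable {f₁ f₂ : Plane} {x y a r ε : ℝ} {K T : Set Plane} {q p : ℝ → Plane}

lemma exists_inner_eq (hf : cross f₁ f₂ ≠ 0) (c₁ c₂ : ℝ) :
    ∃ s : Plane, inner ℝ f₁ s = c₁ ∧ inner ℝ f₂ s = c₂ := by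
  refine ⟨(cross f₁ f₂)⁻¹ • !₂[c₁ * f₂ 1 - c₂ * f₁ 1, c₂ * f₁ 0 - c₁ * f₂ 0], ?_, ?_⟩
  all_goals
    rw [inner_smul_right, inner_plane, inv_mul_eq_iff_eq_mul₀ hf, cross_apply]
    simp
    ring

lemma mem_interior_stripInter {v : Plane} (h₁ : inner ℝ f₁ v ∈ Ioo x (x + a))
    (h₂ : inner ℝ f₂ v ∈ Ioo y (y + a)) : v ∈ interior (stripInter f₁ f₂ x y a) := by
  have hopen (f : Plane) (c : ℝ) : IsOpen {v : Plane | inner ℝ f v ∈ Ioo c (c + a)} :=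
    isOpen_Ioo.preimage (by fun_prop)
  refine interior_maximal ?_ ((hopen f₁ x).inter (hopen f₂ y)) ⟨h₁, h₂⟩
  exact fun w hw => ⟨Ioo_subset_Icc_self hw.1, Ioo_subset_Icc_self hw.2⟩

namespace IsCharPair

lemma mul_le_pairing_of_inner_eq (h : IsCharPair ε K T q p) {f : Plane}
    (hfit : Fits T ![0, r • f]) {s t : ℝ} (hs : s ∈ Icc (0 : ℝ) 1) (ht : t ∈ Icc (0 : ℝ) 1)
    (hst : inner ℝ f (q t) = inner ℝ f (q s) + a) : a * r ≤ ε * pairing q p 0 1 := by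
  obtain ⟨w, hw⟩ := hfit
  have hw₀ : w ∈ T := by simpa using hw 0
  have hw₁ : r • f + w ∈ T := hw 1
  have hinner : inner ℝ (q t - q s) f = a := by
    rw [real_inner_comm, inner_sub_right, hst, add_sub_cancel_left]
  have hpos := h.inner_segment_le_pairing hs ht hw₁ hw₀
  have hneg := h.inner_segment_le_pairing hs ht hw₀ hw₁
  rw [add_sub_cancel_right, inner_smul_right, hinner] at hpos
  rw [sub_add_cancel_right, inner_neg_right, inner_smul_right, hinner] at hneg
  rcases mul_self_eq_one_iff.1 h.sign with rfl | rfl <;> linarith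

-- Otherwise the projection of `q` is shorter than `a`, so it can be centred in the interval.
lemma mul_le_pairing_or_exists_shift (h : IsCharPair ε K T q p) {f : Plane}
    (hfit : Fits T ![0, r • f]) {c : ℝ}
    (hq : ∀ t ∈ Icc (0 : ℝ) 1, inner ℝ f (q t) ∈ Icc c (c + a)) :
    a * r ≤ ε * pairing q p 0 1 ∨
      ∃ d : ℝ, ∀ t ∈ Icc (0 : ℝ) 1, inner ℝ f (q t) + d ∈ Ioo c (c + a) := by
  have hcont : ContinuousOn (fun t => inner ℝ f (q t)) (Icc 0 1) := by
    have hq := h.absCont_fst.continuousOn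
    rw [uIcc_of_le zero_le_one] at hq
    exact continuousOn_const.inner hq
  have hne : (Icc (0 : ℝ) 1).Nonempty := nonempty_Icc.2 zero_le_one
  obtain ⟨s, hs, hmin⟩ := isCompact_Icc.exists_isMinOn hne hcont
  obtain ⟨t, ht, hmax⟩ := isCompact_Icc.exists_isMaxOn hne hcont
  have hwidth : inner ℝ f (q t) ≤ inner ℝ f (q s) + a := by linarith [(hq t ht).2, (hq s hs).1]
  rcases hwidth.eq_or_lt with heq | hlt
  · exact .inl (h.mul_le_pairing_of_inner_eq hfit hs ht heq)
  refine .inr ⟨c + a / 2 - (inner ℝ f (q s) + inner ℝ f (q t)) / 2, fun t' ht' => ?_⟩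
  have hle : inner ℝ f (q s) ≤ inner ℝ f (q t') := hmin ht'
  have hge : inner ℝ f (q t') ≤ inner ℝ f (q t) := hmax ht'
  constructor <;> linarith

lemma mul_le_pairing_of_stripInter (h : IsCharPair ε (stripInter f₁ f₂ x y a) T q p)
    (hf : cross f₁ f₂ ≠ 0) (hTi : (interior T).Nonempty) (hfit₁ : Fits T ![0, r • f₁])
    (hfit₂ : Fits T ![0, r • f₂]) : a * r ≤ ε * pairing q p 0 1 := by
  rcases h.mul_le_pairing_or_exists_shift hfit₁ fun t ht => (h.mem_fst t ht).1 with
    hle | ⟨d₁, hd₁⟩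
  · exact hle
  rcases h.mul_le_pairing_or_exists_shift hfit₂ fun t ht => (h.mem_fst t ht).2 with
    hle | ⟨d₂, hd₂⟩
  · exact hle
  obtain ⟨s, hs₁, hs₂⟩ := exists_inner_eq hf d₁ d₂
  refine absurd (fun t ht => mem_interior_stripInter ?_ ?_) (h.not_translate_mem_interior hTi s)
  · rw [inner_add_right, hs₁]
    exact hd₁ t ht
  · rw [inner_add_right, hs₂]
    exact hd₂ t ht

end IsCharPair

lemma fits_segment_iff {d : Plane} : Fits T ![0, d] ↔ ∃ s ∈ T, d + s ∈ T := by
  simp [Fits]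

lemma not_fits_interior_segment {f d : Plane} (hf : f ≠ 0)
    (hT : ∀ v ∈ T, inner ℝ f v ∈ Icc x (x + a)) (hd : inner ℝ f d = a) :
    ¬ Fits (interior T) ![0, d] := by
  rintro ⟨s, hs⟩
  have hlow := inner_lt_of_mem_interior (d := -f) (M := -x) (neg_ne_zero.2 hf)
    (fun v hv => by simpa using (hT v hv).1) (hs 0)
  have hhigh := inner_lt_of_mem_interior hf (fun v hv => (hT v hv).2) (hs 1)
  simp only [Matrix.cons_val_zero, Matrix.cons_val_one, zero_add, inner_neg_left, inner_add_right,
    hd] at hlow hhigh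
  linarith

lemma polygonLength_segment_le (hne : K.Nonempty) {d : Plane}
    (h : ∀ v ∈ K, inner ℝ d v ∈ Icc x (x + a)) : polygonLength K ![0, d] ≤ a := by
  have hlow : supportFn K (-d) ≤ -x := supportFn_le hne fun v hv => by simpa using (h v hv).1
  have hhigh : supportFn K d ≤ x + a := supportFn_le hne fun v hv => (h v hv).2
  have hlength : polygonLength K ![0, d] = supportFn K (-d) + supportFn K d := by
    simp [polygonLength]
  linarith

end Strips

section Square

variable {x y a a₁ a₂ r : ℝ} {s s' : Plane} {T : Set Plane}

lemma inner_one_zero (v : Plane) : inner ℝ (!₂[1, 0] : Plane) v = v 0 := by simp [inner_plane]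

lemma inner_zero_one (v : Plane) : inner ℝ (!₂[0, 1] : Plane) v = v 1 := by simp [inner_plane]

lemma mem_vadd_smul_unitSquare (hr : 0 < r) {v : Plane} : v ∈ s +ᵥ r • unitSquare ↔
    v 0 ∈ Icc (s 0) (s 0 + r) ∧ v 1 ∈ Icc (s 1) (s 1 + r) := by
  rw [mem_vadd_set_iff_neg_vadd_mem, mem_smul_set_iff_inv_smul_mem₀ hr.ne']
  simp only [unitSquare, mem_ofPred_eq, vadd_eq_add, PiLp.smul_apply, PiLp.add_apply,
    PiLp.neg_apply, smul_eq_mul, mem_Icc, inv_mul_le_iff₀ hr,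
    mul_nonneg_iff_of_pos_left (inv_pos.2 hr), mul_one, le_neg_add_iff_add_le,
    neg_add_le_iff_le_add, add_zero]

lemma setOf_square_eq_vadd_smul (x y : ℝ) (ha : 0 < a) :
    ({p | p 0 ∈ Icc x (x + a) ∧ p 1 ∈ Icc y (y + a)} : Set Plane) =
      !₂[x, y] +ᵥ a • unitSquare := by
  ext v
  simp [mem_vadd_smul_unitSquare ha]

lemma setOf_square_eq_stripInter (x y a : ℝ) :
    ({p | p 0 ∈ Icc x (x + a) ∧ p 1 ∈ Icc y (y + a)} : Set Plane) =
      stripInter !₂[1, 0] !₂[0, 1] x y a := by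
  simp only [stripInter, inner_one_zero, inner_zero_one]

lemma isCompact_unitSquare : IsCompact unitSquare := by
  have himage : unitSquare = WithLp.toLp 2 '' Icc (0 : Fin 2 → ℝ) 1 := by
    ext x
    rw [show (WithLp.toLp 2 : (Fin 2 → ℝ) → Plane) = (WithLp.equiv 2 (Fin 2 → ℝ)).symm from rfl,
      Equiv.image_symm_eq_preimage]
    simp only [unitSquare, mem_ofPred_eq, mem_Icc, mem_preimage, Pi.le_def, Fin.forall_fin_two]
    exact and_and_and_comm
  rw [himage]
  exact isCompact_Icc.image (PiLp.continuous_toLp 2 _)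

lemma isConvexBody_unitSquare : IsConvexBody unitSquare :=
  .of_volume_pos isCompact_unitSquare convex_unitSquare
    (by rw [volume_real_unitSquare]; norm_num)

lemma isConvexBody_square (x y : ℝ) (ha : 0 < a) :
    IsConvexBody {p | p 0 ∈ Icc x (x + a) ∧ p 1 ∈ Icc y (y + a)} := by
  rw [setOf_square_eq_vadd_smul x y ha]
  exact isConvexBody_unitSquare.vadd_smul ha _

lemma volume_real_square (x y : ℝ) (ha : 0 < a) :
    volume.real ({p | p 0 ∈ Icc x (x + a) ∧ p 1 ∈ Icc y (y + a)} : Set Plane) = a ^ 2 := by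
  rw [setOf_square_eq_vadd_smul x y ha, volume_real_vadd_smul, volume_real_unitSquare, mul_one]

lemma polygonLength_square_horizontal_le (ha : 0 < a) (hr : 0 ≤ r) :
    polygonLength {p : Plane | p 0 ∈ Icc x (x + a) ∧ p 1 ∈ Icc y (y + a)} ![0, r • !₂[1, 0]] ≤
      a * r := by
  refine polygonLength_segment_le (x := r * x)
    ((isConvexBody_square x y ha).2.2.mono interior_subset) fun v hv => ?_
  rw [real_inner_smul_left, inner_one_zero, mul_comm a, ← mul_add]
  exact ⟨mul_le_mul_of_nonneg_left hv.1.1 hr, mul_le_mul_of_nonneg_left hv.1.2 hr⟩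

lemma polygonLength_square_vertical_le (ha : 0 < a) (hr : 0 ≤ r) :
    polygonLength {p : Plane | p 0 ∈ Icc x (x + a) ∧ p 1 ∈ Icc y (y + a)} ![0, r • !₂[0, 1]] ≤
      a * r := by
  refine polygonLength_segment_le (x := r * y)
    ((isConvexBody_square x y ha).2.2.mono interior_subset) fun v hv => ?_
  rw [real_inner_smul_left, inner_zero_one, mul_comm a, ← mul_add]
  exact ⟨mul_le_mul_of_nonneg_left hv.2.1 hr, mul_le_mul_of_nonneg_left hv.2.2 hr⟩

lemma fits_vadd_smul_segment {S : Set Plane} {u d : Plane} (hu : u ∈ S) (hud : d + u ∈ S)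
    (r : ℝ) (s : Plane) : Fits (s +ᵥ r • S) ![0, r • d] := by
  refine fits_segment_iff.2 ⟨_, vadd_mem_vadd_set (smul_mem_smul_set hu), ?_⟩
  convert vadd_mem_vadd_set (smul_mem_smul_set hud) using 1
  simp only [vadd_eq_add]
  module

lemma fits_diamond_horizontal (a₁ a₂ r : ℝ) (s : Plane) :
    Fits (s +ᵥ r • diamond a₁ a₂) ![0, r • !₂[1, 0]] :=
  fits_vadd_smul_segment (vertices_subset_diamond a₁ a₂ (by simp : !₂[0, a₂] ∈ _))
    (vertices_subset_diamond a₁ a₂ (by simp [← WithLp.toLp_add])) r s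

lemma fits_diamond_vertical (a₁ a₂ r : ℝ) (s : Plane) :
    Fits (s +ᵥ r • diamond a₁ a₂) ![0, r • !₂[0, 1]] :=
  fits_vadd_smul_segment (vertices_subset_diamond a₁ a₂ (by simp : !₂[a₁, 0] ∈ _))
    (vertices_subset_diamond a₁ a₂ (by simp [← WithLp.toLp_add])) r s

lemma isEHZCapacity_square_diamond (x y : ℝ) (ha : 0 < a) (h₁ : a₁ ∈ Icc (0 : ℝ) 1)
    (h₂ : a₂ ∈ Icc (0 : ℝ) 1) (hr : 0 < r) (s : Plane) :
    IsEHZCapacity ({p | p 0 ∈ Icc x (x + a) ∧ p 1 ∈ Icc y (y + a)} ×ˢ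
      (s +ᵥ r • diamond a₁ a₂)) (a * r) := by
  have hS := isConvexBody_square x y ha
  have hT := (isConvexBody_diamond h₁ h₂).vadd_smul hr s
  refine isEHZCapacity_of_not_fits hS hT ?_ (polygonLength_square_horizontal_le ha hr.le) ?_
  · refine not_fits_interior_segment (f := !₂[1, 0]) (x := s 0) (a := r)
      (fun h => by simpa using congrArg (· 0) h) (fun v hv => ?_) (by simp [inner_one_zero])
    rw [inner_one_zero]
    exact ((mem_vadd_smul_unitSquare hr).1
      (vadd_set_mono (smul_set_mono (diamond_subset_unitSquare h₁ h₂)) hv)).1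
  · intro z hz γ hγ
    obtain ⟨q, p, h, hA⟩ := hγ.exists_isCharPair hS hT hz
    rw [setOf_square_eq_stripInter] at h
    rw [hA, ← one_mul (pairing q p 0 1)]
    exact h.mul_le_pairing_of_stripInter (by simp [cross_apply]) hT.2.2
      (fits_diamond_horizontal a₁ a₂ r s) (fits_diamond_vertical a₁ a₂ r s)

lemma isEqualityCase_square_diamond (x y : ℝ) (ha : 0 < a) (h₁ : a₁ ∈ Icc (0 : ℝ) 1)
    (h₂ : a₂ ∈ Icc (0 : ℝ) 1) (hr : 0 < r) (s : Plane) :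
    IsEqualityCase {p | p 0 ∈ Icc x (x + a) ∧ p 1 ∈ Icc y (y + a)}
      (s +ᵥ r • diamond a₁ a₂) := by
  refine ⟨isConvexBody_square x y ha, (isConvexBody_diamond h₁ h₂).vadd_smul hr s, a * r,
    isEHZCapacity_square_diamond x y ha h₁ h₂ hr s, ?_⟩
  rw [volume_real_prod, volume_real_square x y ha, volume_real_vadd_smul,
    volume_real_diamond h₁ h₂]
  ring

-- Each endpoint of one chord spans a triangle with the other chord, whose area is at most `r² / 2`.
lemma sub_mem_Icc_of_chords (hT : Convex ℝ T) (hT' : volume T ≠ ⊤) (hr : 0 < r)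
    (hv : volume.real T ≤ r ^ 2 / 2) (hs : s ∈ T) (hsr : r • !₂[1, 0] + s ∈ T) (hs' : s' ∈ T)
    (hsr' : r • !₂[0, 1] + s' ∈ T) : s' 0 - s 0 ∈ Icc 0 r ∧ s 1 - s' 1 ∈ Icc 0 r := by
  have hcross : ∀ {u v w : Plane}, u ∈ T → v ∈ T → w ∈ T → cross (v - u) (w - u) ≤ r * r :=
    fun {u v w} hu hv' hw => by
      linarith [abs_cross_div_two_le_volume hT hT' hu hv' hw, le_abs_self (cross (v - u) (w - u))]
  have h₀ := hcross hsr hsr' hs'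
  have h₁ := hcross hs hs' hsr'
  have h₂ := hcross hsr' hs hsr
  have h₃ := hcross hs' hsr hs
  simp only [cross_apply, PiLp.sub_apply, PiLp.add_apply, PiLp.smul_apply, smul_eq_mul,
    Matrix.cons_val_zero, Matrix.cons_val_one] at h₀ h₁ h₂ h₃
  refine ⟨⟨?_, ?_⟩, ?_, ?_⟩ <;> refine le_of_mul_le_mul_left ?_ hr <;> linarith

lemma vadd_smul_diamond_subset_of_chords (hT : Convex ℝ T) (hr : r ≠ 0) (hs : s ∈ T)
    (hsr : r • !₂[1, 0] + s ∈ T) (hs' : s' ∈ T) (hsr' : r • !₂[0, 1] + s' ∈ T) :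
    !₂[s 0, s' 1] +ᵥ r • diamond ((s' 0 - s 0) / r) ((s 1 - s' 1) / r) ⊆ T := by
  rw [diamond_eq_convexHull]
  refine vadd_smul_convexHull_subset hT ?_
  rintro v (rfl | rfl | rfl | rfl)
  · convert hs' using 1
    ext i; fin_cases i <;> simp [mul_div_cancel₀ _ hr]
  · convert hsr' using 1
    ext i; fin_cases i <;> simp [mul_div_cancel₀ _ hr, add_comm]
  · convert hs using 1
    ext i; fin_cases i <;> simp [mul_div_cancel₀ _ hr]
  · convert hsr using 1
    ext i; fin_cases i <;> simp [mul_div_cancel₀ _ hr, add_comm]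

lemma exists_isScaledTranslate_diamond (hT : IsConvexBody T) (hr : 0 < r)
    (hv : volume.real T ≤ r ^ 2 / 2) (hfit₁ : Fits T ![0, r • !₂[1, 0]])
    (hfit₂ : Fits T ![0, r • !₂[0, 1]]) :
    ∃ a₁ ∈ Icc (0 : ℝ) 1, ∃ a₂ ∈ Icc (0 : ℝ) 1, IsScaledTranslate (diamond a₁ a₂) T := by
  obtain ⟨s, hs, hsr⟩ := fits_segment_iff.1 hfit₁
  obtain ⟨s', hs', hsr'⟩ := fits_segment_iff.1 hfit₂
  obtain ⟨h₁, h₂⟩ := sub_mem_Icc_of_chords hT.2.1 hT.1.measure_ne_top hr hv hs hsr hs' hsr'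
  have hdiv : ∀ {t}, t ∈ Icc 0 r → t / r ∈ Icc (0 : ℝ) 1 := fun ht =>
    ⟨div_nonneg ht.1 hr.le, (div_le_one hr).2 ht.2⟩
  refine ⟨_, hdiv h₁, _, hdiv h₂, r, hr, !₂[s 0, s' 1], (hT.eq_of_subset_of_volume_le
    (((isCompact_diamond _ _).smul r).vadd _).isClosed
    (vadd_smul_diamond_subset_of_chords hT.2.1 hr.ne' hs hsr hs' hsr') ?_).symm⟩
  rw [volume_real_vadd_smul, volume_real_diamond (hdiv h₁) (hdiv h₂)]
  linarith

theorem isEqualityCase_square_iff (x y : ℝ) (ha : 0 < a) :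
    IsEqualityCase {p | p 0 ∈ Icc x (x + a) ∧ p 1 ∈ Icc y (y + a)} T ↔
      ∃ a₁ ∈ Icc (0 : ℝ) 1, ∃ a₂ ∈ Icc (0 : ℝ) 1, IsScaledTranslate (diamond a₁ a₂) T := by
  refine ⟨fun h => ?_, ?_⟩
  · obtain ⟨c, hc, hcap, hv⟩ := h.exists_pos
    obtain ⟨r, rfl⟩ : ∃ r, c = a * r := ⟨c / a, (mul_div_cancel₀ c ha.ne').symm⟩
    have hr : 0 < r := pos_of_mul_pos_right hc ha.le
    have hS := isConvexBody_square x y ha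
    refine exists_isScaledTranslate_diamond h.2.1 hr ?_
      (hcap.fits hS h.2.1 (polygonLength_square_horizontal_le ha hr.le))
      (hcap.fits hS h.2.1 (polygonLength_square_vertical_le ha hr.le))
    rw [volume_real_square x y ha, mul_pow, mul_div_assoc] at hv
    exact (mul_left_cancel₀ (pow_pos ha 2).ne' hv).le
  · rintro ⟨a₁, h₁, a₂, h₂, r, hr, s, rfl⟩
    exact isEqualityCase_square_diamond x y ha h₁ h₂ hr s

end Square

/-! ### Rigidity of the square -/

lemma unitSquare_eq_convexHull :
    unitSquare = convexHull ℝ {0, !₂[1, 0], !₂[1, 0] + !₂[0, 1], !₂[0, 1]} := by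
  refine Subset.antisymm ?_ (convexHull_min ?_ convex_unitSquare)
  · rintro w ⟨h₀, h₁⟩
    have hlow := segment_subset_convexHull (𝕜 := ℝ)
      (s := ({0, !₂[1, 0], !₂[1, 0] + !₂[0, 1], !₂[0, 1]} : Set Plane)) (x := 0)
      (y := !₂[1, 0]) (by simp) (by simp) ⟨1 - w 0, w 0, sub_nonneg.2 h₀.2, h₀.1, by ring, rfl⟩
    have hhigh := segment_subset_convexHull (𝕜 := ℝ)
      (s := ({0, !₂[1, 0], !₂[1, 0] + !₂[0, 1], !₂[0, 1]} : Set Plane)) (x := !₂[0, 1])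
      (y := !₂[1, 0] + !₂[0, 1]) (by simp) (by simp)
      ⟨1 - w 0, w 0, sub_nonneg.2 h₀.2, h₀.1, by ring, rfl⟩
    convert convex_convexHull ℝ _ hlow hhigh (sub_nonneg.2 h₁.2) h₁.1 (by ring) using 1
    ext i; fin_cases i <;> simp <;> ring
  · rintro v (rfl | rfl | rfl | rfl) <;> simp [unitSquare]

/-- The diagonal of the unit square. -/
def diag : Plane := !₂[1, 1]

/-- The linear functional that vanishes on `diag`; its level sets are the lines parallel to the
diagonal, and the area of a parallelogram spanned by `diag` and `v` is `|level v|`. -/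
def level : Plane →ₗ[ℝ] ℝ := cross (-diag)

lemma level_apply (v : Plane) : level v = v 0 - v 1 := by
  simp [level, cross_apply, diag, sub_eq_neg_add]

lemma level_diag : level diag = 0 := by simp [level_apply, diag]

lemma level_ne_zero : level ≠ 0 := fun h => by
  simpa [level_apply] using LinearMap.congr_fun h !₂[1, 0]

lemma eq_add_smul_diag_of_level_eq {v w : Plane} (h : level v = level w) :
    ∃ k : ℝ, v = w + k • diag := by
  rw [level_apply, level_apply] at h
  refine ⟨v 0 - w 0, ?_⟩
  ext i; fin_cases i
  · simp [diag]
  · simp [diag]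
    linarith

/-- The area of the part of `T` between the lines `level = u` and `level = w`. -/
def stripArea (T : Set Plane) (u w : ℝ) : ℝ :=
  volume.real (T ∩ ({v | u ≤ level v} ∩ {v | level v ≤ w}))

/-- `T` contains the endpoints of a translate of `l • diag` on the line `level = s`. -/
def HasChord (T : Set Plane) (s l : ℝ) : Prop := ∃ a, a ∈ T ∧ a + l • diag ∈ T ∧ level a = s

lemma hasChord_zero {T : Set Plane} {a : Plane} (ha : a ∈ T) : HasChord T (level a) 0 :=
  ⟨a, ha, by simpa using ha, rfl⟩

section Chords

variable {T : Set Plane} {s₁ s₂ s₃ s₄ s₅ l l₁ l₂ l₃ l₄ l₅ : ℝ}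

lemma stripArea_add (hT : IsConvexBody T) {u v w : ℝ} (huv : u ≤ v) (hvw : v ≤ w) :
    stripArea T u v + stripArea T v w = stripArea T u w := by
  have hsplit := measureReal_inter_halfSpace_add level_ne_zero
    (volume_inter_ne_top hT.1.measure_ne_top ({x | u ≤ level x} ∩ {x | level x ≤ w})) v
  unfold stripArea
  rw [← hsplit]
  congr 1 <;> refine congrArg (volume : Measure Plane).real (Set.ext fun x => ?_) <;>
    simp only [mem_inter_iff, mem_ofPred_eq] <;> grind

lemma stripArea_le_volume (hT : IsConvexBody T) (u w : ℝ) : stripArea T u w ≤ volume.real T :=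
  measureReal_mono inter_subset_left hT.1.measure_ne_top

lemma trapezoid_le_stripArea (hT : IsConvexBody T) (c₁ : HasChord T s₁ l₁)
    (c₂ : HasChord T s₂ l₂) (h : s₁ ≤ s₂) : (s₂ - s₁) * (l₁ + l₂) / 2 ≤ stripArea T s₁ s₂ := by
  obtain ⟨a, ha, ha', rfl⟩ := c₁
  obtain ⟨b, hb, hb', rfl⟩ := c₂
  have hlevel : ∀ (v : Plane) (k : ℝ), level (v + k • diag) = level v := fun v k => by
    rw [map_add, map_smul, level_diag, smul_zero, add_zero]
  have hstrip : Convex ℝ (T ∩ ({v | level a ≤ level v} ∩ {v | level v ≤ level b})) :=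
    hT.2.1.inter ((convex_halfSpace_ge level.isLinear _).inter
      (convex_halfSpace_le level.isLinear _))
  have hquad := abs_cross_chords_div_two_le_volume hstrip
    (volume_inter_ne_top hT.1.measure_ne_top _)
    ⟨ha, le_refl (level a), h⟩ ⟨hb', h.trans (hlevel b l₂).ge, (hlevel b l₂).le⟩
    ⟨ha', (hlevel a l₁).ge, (hlevel a l₁).le.trans h⟩ ⟨hb, h, le_refl (level b)⟩
  have hcross : cross (b + l₂ • diag - a) (b - (a + l₁ • diag)) =
      -((level b - level a) * (l₁ + l₂)) := by
    simp [cross_apply, level_apply, diag]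
    ring
  rw [hcross, abs_neg] at hquad
  exact (div_le_div_of_nonneg_right (le_abs_self _) zero_le_two).trans hquad

lemma trapezoid_le_volume (hT : IsConvexBody T) (c₁ : HasChord T s₁ l₁) (c₂ : HasChord T s₂ l₂)
    (h : s₁ ≤ s₂) : (s₂ - s₁) * (l₁ + l₂) / 2 ≤ volume.real T :=
  (trapezoid_le_stripArea hT c₁ c₂ h).trans (stripArea_le_volume hT _ _)

lemma two_trapezoids_le_stripArea (hT : IsConvexBody T) (c₁ : HasChord T s₁ l₁)
    (c₂ : HasChord T s₂ l₂) (c₃ : HasChord T s₃ l₃) (h₁ : s₁ ≤ s₂) (h₂ : s₂ ≤ s₃) :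
    (s₂ - s₁) * (l₁ + l₂) / 2 + (s₃ - s₂) * (l₂ + l₃) / 2 ≤ stripArea T s₁ s₃ := by
  rw [← stripArea_add hT h₁ h₂]
  exact add_le_add (trapezoid_le_stripArea hT c₁ c₂ h₁) (trapezoid_le_stripArea hT c₂ c₃ h₂)

lemma three_trapezoids_le_volume (hT : IsConvexBody T) (c₁ : HasChord T s₁ l₁)
    (c₂ : HasChord T s₂ l₂) (c₃ : HasChord T s₃ l₃) (c₄ : HasChord T s₄ l₄) (h₁ : s₁ ≤ s₂)
    (h₂ : s₂ ≤ s₃) (h₃ : s₃ ≤ s₄) :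
    (s₂ - s₁) * (l₁ + l₂) / 2 + (s₃ - s₂) * (l₂ + l₃) / 2 + (s₄ - s₃) * (l₃ + l₄) / 2 ≤
      volume.real T := by
  refine le_trans ?_ (stripArea_le_volume hT s₁ s₄)
  rw [← stripArea_add hT (h₁.trans h₂) h₃]
  exact add_le_add (two_trapezoids_le_stripArea hT c₁ c₂ c₃ h₁ h₂)
    (trapezoid_le_stripArea hT c₃ c₄ h₃)

lemma four_trapezoids_le_volume (hT : IsConvexBody T) (c₁ : HasChord T s₁ l₁)
    (c₂ : HasChord T s₂ l₂) (c₃ : HasChord T s₃ l₃) (c₄ : HasChord T s₄ l₄)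
    (c₅ : HasChord T s₅ l₅) (h₁ : s₁ ≤ s₂) (h₂ : s₂ ≤ s₃) (h₃ : s₃ ≤ s₄) (h₄ : s₄ ≤ s₅) :
    (s₂ - s₁) * (l₁ + l₂) / 2 + (s₃ - s₂) * (l₂ + l₃) / 2 +
      ((s₄ - s₃) * (l₃ + l₄) / 2 + (s₅ - s₄) * (l₄ + l₅) / 2) ≤ volume.real T := by
  refine le_trans ?_ (stripArea_le_volume hT s₁ s₅)
  rw [← stripArea_add hT (h₁.trans h₂) (h₃.trans h₄)]
  exact add_le_add (two_trapezoids_le_stripArea hT c₁ c₂ c₃ h₁ h₂)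
    (two_trapezoids_le_stripArea hT c₃ c₄ c₅ h₃ h₄)

-- The third chord may lie on either side of the other two.
lemma mul_le_volume_of_hasChord (hT : IsConvexBody T) (c₁ : HasChord T s₁ l)
    (c₂ : HasChord T s₂ l) (c₃ : HasChord T s₃ l₃) (h : s₁ ≤ s₂) (hl : 0 ≤ l + l₃) :
    (s₂ - s₁) * (l + l₃) / 2 ≤ volume.real T := by
  rcases le_total s₃ s₁ with h₁ | h₁
  · have := trapezoid_le_volume hT c₃ c₂ (h₁.trans h)
    nlinarith
  rcases le_total s₂ s₃ with h₂ | h₂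
  · have := trapezoid_le_volume hT c₁ c₃ h₁
    nlinarith
  · have := (two_trapezoids_le_stripArea hT c₁ c₃ c₂ h₁ h₂).trans (stripArea_le_volume hT s₁ s₂)
    linarith

lemma eq_zero_of_hasChord_le {a : Plane} {k : ℝ} (hmax : ∀ l', HasChord T (level a) l' → l' ≤ l)
    (ha : a ∈ T) (hal : a + l • diag ∈ T) (hak : a + k • diag ∈ T)
    (hakl : a + (l + k) • diag ∈ T) : k = 0 := by
  have hle := hmax (l + k) ⟨a, ha, hakl, rfl⟩
  have hge := hmax (l - k) ⟨a + k • diag, hak, by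
    rwa [add_assoc, ← add_smul, add_sub_cancel], by simp [level_diag]⟩
  linarith

variable {ζ t : ℝ}

lemma hasChord_le_of_le_one (hT : IsConvexBody T) (hv : volume.real T ≤ 1)
    (c₀ : HasChord T ζ 0) (c₁ : HasChord T (ζ + 1) 1) (c₂ : HasChord T (ζ + 2) 0)
    (ht : t ∈ Icc (0 : ℝ) 1) (c : HasChord T (ζ + t) l) : l ≤ t := by
  have := three_trapezoids_le_volume hT c₀ c c₁ c₂ (by linarith [ht.1]) (by linarith [ht.2])
    (by linarith)
  linarith

lemma hasChord_le_of_one_le (hT : IsConvexBody T) (hv : volume.real T ≤ 1)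
    (c₀ : HasChord T ζ 0) (c₁ : HasChord T (ζ + 1) 1) (c₂ : HasChord T (ζ + 2) 0)
    (ht : t ∈ Icc (1 : ℝ) 2) (c : HasChord T (ζ + t) l) : l ≤ 2 - t := by
  have := three_trapezoids_le_volume hT c₀ c₁ c c₂ (by linarith) (by linarith [ht.1])
    (by linarith [ht.2])
  linarith

end Chords

section Levels

variable {T : Set Plane} {m ζ α δ : ℝ}

lemma pos_of_hasChord (hT : IsConvexBody T) (hv : volume.real T ≤ 1) (hm₀ : 0 < m) (hm₁ : m < 1)
    (c₁ : HasChord T (ζ + α) (1 - m)) (c₂ : HasChord T (ζ + 1 + m) (1 - m))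
    (cD : HasChord T (ζ + δ) 1) : 0 < α := by
  by_contra! hα
  have := mul_le_volume_of_hasChord hT c₁ c₂ cD (by linarith) (by linarith)
  nlinarith [mul_pos hm₀ (sub_pos.2 hm₁)]

lemma le_of_hasChord (hT : IsConvexBody T) (hv : volume.real T ≤ 1) (hm₀ : 0 < m) (hm₁ : m < 1)
    (c₀ : HasChord T ζ 0) (c₂ : HasChord T (ζ + 1 + m) (1 - m))
    (c₃ : HasChord T (ζ + α + 1 + m) 0) (cD : HasChord T (ζ + δ) 1)
    (hα : α ≤ 1 - m) : α ≤ δ := by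
  have hmm := mul_pos hm₀ (sub_pos.2 hm₁)
  by_contra! hδ
  rcases le_or_gt δ 0 with hδ₀ | hδ₀
  · have := trapezoid_le_volume hT cD c₂ (by linarith)
    nlinarith
  · have := three_trapezoids_le_volume hT c₀ cD c₂ c₃ (by linarith) (by linarith) (by linarith)
    nlinarith [mul_pos (sub_pos.2 hδ) (sub_pos.2 hm₁)]

lemma le_one_add_of_hasChord (hT : IsConvexBody T) (hv : volume.real T ≤ 1) (hm₀ : 0 < m)
    (hm₁ : m < 1) (c₀ : HasChord T ζ 0) (c₁ : HasChord T (ζ + α) (1 - m))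
    (c₃ : HasChord T (ζ + α + 1 + m) 0) (cD : HasChord T (ζ + δ) 1)
    (hα : α ≤ 1 - m) : δ ≤ 1 + m := by
  have hmm := mul_pos hm₀ (sub_pos.2 hm₁)
  by_contra! hδ
  rcases le_or_gt (α + 1 + m) δ with hδ₀ | hδ₀
  · have := trapezoid_le_volume hT c₁ cD (by linarith)
    nlinarith
  · have := three_trapezoids_le_volume hT c₀ c₁ cD c₃ (by linarith) (by linarith) (by linarith)
    nlinarith [mul_pos (sub_pos.2 hδ) (sub_pos.2 hm₁)]

lemma levels_eq_of_hasChord (hT : IsConvexBody T) (hv : volume.real T ≤ 1) (hm₀ : 0 < m)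
    (hm₁ : m < 1) (c₀ : HasChord T ζ 0) (c₁ : HasChord T (ζ + α) (1 - m))
    (c₂ : HasChord T (ζ + 1 + m) (1 - m)) (c₃ : HasChord T (ζ + α + 1 + m) 0)
    (cD : HasChord T (ζ + δ) 1) : α = 1 - m ∧ δ = 1 := by
  have hα₀ : 0 < α := pos_of_hasChord hT hv hm₀ hm₁ c₁ c₂ cD
  have hα₁ : α ≤ 1 - m := by
    linarith [mul_le_volume_of_hasChord hT c₀ c₃ cD (by linarith) (by linarith)]
  have hδ₀ := le_of_hasChord hT hv hm₀ hm₁ c₀ c₂ c₃ cD hα₁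
  have hδ₁ := le_one_add_of_hasChord hT hv hm₀ hm₁ c₀ c₁ c₃ cD hα₁
  obtain rfl : α = 1 - m := by
    have := four_trapezoids_le_volume hT c₀ c₁ cD c₂ c₃ (by linarith) (by linarith) (by linarith)
      (by linarith)
    exact hα₁.antisymm (le_of_mul_le_mul_left (by linarith) hm₀)
  have hlow := three_trapezoids_le_volume hT c₀ cD c₂ c₃ (by linarith) (by linarith) (by linarith)
  have hhigh := three_trapezoids_le_volume hT c₀ c₁ cD c₃ (by linarith) (by linarith)
    (by linarith)
  exact ⟨rfl, le_antisymm (le_of_mul_le_mul_left (by linarith) (sub_pos.2 hm₁))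
    (le_of_mul_le_mul_left (by linarith) (sub_pos.2 hm₁))⟩

end Levels

section Rigidity

variable {T : Set Plane} {m μ ν : ℝ} {x : Plane}

-- At the level of each chord of length `1 - m` there is a second one, a section of the hull of
-- the diagonal and a corner, and the two have to coincide.
lemma shifts_eq_zero (hT : IsConvexBody T) (hv : volume.real T ≤ 1) (hm₀ : 0 < m) (hm₁ : m < 1)
    (hx : x ∈ T) (hxd : x + diag ∈ T)
    (hp : x + !₂[1, 0] + μ • diag ∈ T) (hb : x + m • !₂[0, 1] + μ • diag ∈ T)
    (hbd : x + m • !₂[0, 1] + μ • diag + (1 - m) • diag ∈ T)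
    (hp' : x + !₂[0, 1] + ν • diag ∈ T) (hb' : x + m • !₂[1, 0] + ν • diag ∈ T)
    (hbd' : x + m • !₂[1, 0] + ν • diag + (1 - m) • diag ∈ T) : μ = 0 ∧ ν = 0 := by
  have c₀ : HasChord T (level x - 1) 0 := by
    convert hasChord_zero hp' using 1
    simp [level_apply, diag]
    ring
  have c₁ : HasChord T (level x - 1 + 1) 1 := ⟨x, hx, by simpa using hxd, by ring⟩
  have c₂ : HasChord T (level x - 1 + 2) 0 := by
    convert hasChord_zero hp using 1
    simp [level_apply, diag]
    ring
  have hcomb : ∀ {u v}, u ∈ T → v ∈ T → m • u + (1 - m) • v ∈ T := fun hu hv =>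
    hT.2.1 hu hv hm₀.le (sub_nonneg.2 hm₁.le) (by ring)
  have hμ : m * ν - μ = 0 := by
    refine eq_zero_of_hasChord_le (l := 1 - m) (fun l' hl' => ?_) hb hbd ?_ ?_
    · refine hasChord_le_of_le_one hT hv c₀ c₁ c₂ ⟨by linarith, by linarith⟩ (t := 1 - m) ?_
      convert hl' using 1
      simp [level_apply, diag]
      ring
    · convert hcomb hp' hx using 1
      module
    · convert hcomb hp' hxd using 1
      module
  have hν : m * μ - ν = 0 := by
    refine eq_zero_of_hasChord_le (l := 1 - m) (fun l' hl' => ?_) hb' hbd' ?_ ?_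
    · have := hasChord_le_of_one_le hT hv c₀ c₁ c₂ ⟨by linarith, by linarith⟩ (t := 1 + m)
        (l := l') (by convert hl' using 1; simp [level_apply, diag]; ring)
      linarith
    · convert hcomb hp hx using 1
      module
    · convert hcomb hp hxd using 1
      module
  obtain rfl : ν = 0 := (mul_eq_zero.1 (by linear_combination -hν - m * hμ :
    (1 - m * m) * ν = 0)).resolve_left (by nlinarith)
  exact ⟨by linear_combination -hμ, rfl⟩

lemma eq_vadd_unitSquare_of_corners (hT : IsConvexBody T) (hv : volume.real T ≤ 1) (hx : x ∈ T)
    (hx₁ : x + !₂[1, 0] ∈ T) (hxd : x + diag ∈ T) (hx₂ : x + !₂[0, 1] ∈ T) :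
    T = x +ᵥ unitSquare := by
  refine (hT.eq_of_subset_of_volume_le (isCompact_unitSquare.vadd x).isClosed ?_ ?_).symm
  · rw [unitSquare_eq_convexHull, ← one_smul ℝ (convexHull ℝ _)]
    refine vadd_smul_convexHull_subset hT.2.1 ?_
    rintro v (rfl | rfl | rfl | rfl)
    · simpa using hx
    · simpa using hx₁
    · simpa [diag, ← WithLp.toLp_add] using hxd
    · simpa using hx₂
  · rwa [← one_smul ℝ unitSquare, volume_real_vadd_smul, one_pow, one_mul,
      volume_real_unitSquare]

theorem exists_eq_vadd_unitSquare_of_fits (hT : IsConvexBody T) (hv : volume.real T ≤ 1)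
    (hm₀ : 0 < m) (hm₁ : m < 1) (hdiag : Fits T ![0, diag])
    (hfit : Fits T ![(1 - m) • diag, 0, !₂[1, -m]])
    (hfit' : Fits T ![(1 - m) • diag, 0, !₂[-m, 1]]) : ∃ x : Plane, T = x +ᵥ unitSquare := by
  obtain ⟨x, hx, hxd⟩ := fits_segment_iff.1 hdiag
  obtain ⟨b, hb⟩ := hfit
  obtain ⟨b', hb'⟩ := hfit'
  obtain ⟨hbd, hb, hp⟩ : (1 - m) • diag + b ∈ T ∧ b ∈ T ∧ !₂[1, -m] + b ∈ T := by
    simpa [Fin.forall_fin_succ] using hb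
  obtain ⟨hbd', hb', hp'⟩ : (1 - m) • diag + b' ∈ T ∧ b' ∈ T ∧ !₂[-m, 1] + b' ∈ T := by
    simpa [Fin.forall_fin_succ] using hb'
  rw [add_comm] at hxd hbd hbd'
  obtain ⟨hα, hδ⟩ := levels_eq_of_hasChord (ζ := level b' - 1 - m)
    (α := level b - level b' + 1 + m) (δ := level x - level b' + 1 + m) hT hv hm₀ hm₁
    (by convert hasChord_zero hp' using 1; simp [level_apply]; ring)
    ⟨b, hb, hbd, by ring⟩ ⟨b', hb', hbd', by ring⟩
    (by convert hasChord_zero hp using 1; simp [level_apply]; ring)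
    ⟨x, hx, by simpa using hxd, by ring⟩
  obtain ⟨μ, rfl⟩ := eq_add_smul_diag_of_level_eq (v := b) (w := x + m • !₂[0, 1]) (by
    simp [level_apply] at hα hδ ⊢; linarith)
  obtain ⟨ν, rfl⟩ := eq_add_smul_diag_of_level_eq (v := b') (w := x + m • !₂[1, 0]) (by
    simp [level_apply] at hδ ⊢; linarith)
  have hp : x + !₂[1, 0] + μ • diag ∈ T := by
    convert hp using 1
    ext i; fin_cases i <;> simp <;> ring
  have hp' : x + !₂[0, 1] + ν • diag ∈ T := by
    convert hp' using 1
    ext i; fin_cases i <;> simp <;> ring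
  obtain ⟨rfl, rfl⟩ := shifts_eq_zero hT hv hm₀ hm₁ hx hxd hp hb hbd hp' hb' hbd'
  rw [zero_smul, add_zero] at hp hp'
  exact ⟨x, eq_vadd_unitSquare_of_corners hT hv hx hp hxd hp'⟩

end Rigidity

/-! ### Dual parallelograms and trapezoids -/

section Contragredient

variable {E : Type*} [NormedAddCommGroup E] [InnerProductSpace ℝ E] [FiniteDimensional ℝ E]

lemma det_adjoint (f : E →ₗ[ℝ] E) : LinearMap.det (LinearMap.adjoint f) = LinearMap.det f := by
  let b := stdOrthonormalBasis ℝ E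
  rw [← LinearMap.det_toMatrix b.toBasis, LinearMap.toMatrix_adjoint, Matrix.det_conjTranspose,
    LinearMap.det_toMatrix, star_trivial]

/-- The inverse transpose of `φ`, through which the second factor of a Lagrangian product
transforms when the first one is transformed by `φ`. -/
def contragredient (φ : E ≃ₗ[ℝ] E) : E ≃ₗ[ℝ] E :=
  LinearEquiv.ofLinearMap (LinearMap.adjoint (φ.symm : E →ₗ[ℝ] E))
    (LinearMap.adjoint (φ : E →ₗ[ℝ] E))
    (by rw [← LinearMap.adjoint_comp, LinearEquiv.comp_symm, LinearMap.adjoint_id])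
    (by rw [← LinearMap.adjoint_comp, LinearEquiv.symm_comp, LinearMap.adjoint_id])

lemma inner_contragredient (φ : E ≃ₗ[ℝ] E) (v w : E) :
    inner ℝ (contragredient φ v) (φ w) = inner ℝ v w :=
  (LinearMap.adjoint_inner_left _ _ _).trans (by simp)

lemma inner_contragredient_symm (φ : E ≃ₗ[ℝ] E) (v w : E) :
    inner ℝ v ((contragredient φ).symm w) = inner ℝ (φ v) w :=
  LinearMap.adjoint_inner_right _ _ _

lemma det_contragredient_symm (φ : E ≃ₗ[ℝ] E) :
    LinearMap.det ((contragredient φ).symm : E →ₗ[ℝ] E) = LinearMap.det (φ : E →ₗ[ℝ] E) :=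
  det_adjoint _

end Contragredient

lemma linearIndependent_of_cross_ne_zero {u v : Plane} (h : cross u v ≠ 0) :
    LinearIndependent ℝ ![u, v] := by
  refine LinearIndependent.pair_iff.2 fun s t hst => ?_
  have hu : t * cross u v = 0 := by
    simpa only [map_add, map_smul, cross_self, smul_eq_mul, mul_zero, zero_add, map_zero]
      using congrArg (cross u) hst
  have hv : s * cross u v = 0 := by
    simpa only [map_add, map_smul, LinearMap.add_apply, LinearMap.smul_apply, cross_self,
      smul_eq_mul, mul_zero, add_zero, map_zero, LinearMap.zero_apply]
      using congrArg (cross · v) hst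
  exact ⟨(mul_eq_zero.1 hv).resolve_right h, (mul_eq_zero.1 hu).resolve_right h⟩

lemma cross_map_ne_zero (φ : Plane ≃ₗ[ℝ] Plane) : cross (φ !₂[1, 0]) (φ !₂[0, 1]) ≠ 0 := by
  have hbasis : (φ : Plane →ₗ[ℝ] Plane) = basisMap (φ !₂[1, 0]) (φ !₂[0, 1]) := by
    ext1 x
    rw [basisMap_apply, ← map_smul, ← map_smul, ← map_add, LinearEquiv.coe_coe]
    congr 1
    ext i; fin_cases i <;> simp
  rw [← det_basisMap, ← hbasis]
  exact φ.isUnit_det'.ne_zero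

lemma isParallelogram_image_unitSquare (φ : Plane ≃ₗ[ℝ] Plane) :
    IsParallelogram (φ '' unitSquare) := by
  refine ⟨0, φ !₂[1, 0], φ !₂[0, 1], linearIndependent_of_cross_ne_zero (cross_map_ne_zero φ), ?_⟩
  rw [unitSquare_eq_convexHull, ← LinearEquiv.coe_coe, LinearMap.image_convexHull]
  simp [image_insert_eq]

lemma IsConvexBody.vadd_image {S : Set Plane} (hS : IsConvexBody S) (φ : Plane ≃ₗ[ℝ] Plane)
    (s : Plane) : IsConvexBody (s +ᵥ φ '' S) := by
  refine .of_volume_pos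
    ((hS.1.image (φ : Plane →ₗ[ℝ] Plane).continuous_of_finiteDimensional).vadd s)
    ((hS.2.1.linear_image (φ : Plane →ₗ[ℝ] Plane)).vadd s) ?_
  rw [← LinearEquiv.coe_coe, volume_real_vadd_image]
  exact mul_pos (abs_pos.2 φ.isUnit_det'.ne_zero) hS.volume_pos

section Dual

variable {φ : Plane ≃ₗ[ℝ] Plane} {s c₀ : Plane} {a₁ a₂ α m r c : ℝ} {T : Set Plane}

lemma vadd_smul_contragredient_unitSquare (hr : 0 < r) :
    s +ᵥ r • (contragredient φ '' unitSquare) =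
      stripInter (φ !₂[1, 0]) (φ !₂[0, 1]) (inner ℝ (φ !₂[1, 0]) s) (inner ℝ (φ !₂[0, 1]) s) r := by
  have himage : s +ᵥ r • (contragredient φ '' unitSquare) =
      (contragredient φ).symm ⁻¹' ((contragredient φ).symm s +ᵥ r • unitSquare) := by
    ext v
    simp only [mem_preimage, mem_vadd_set_iff_neg_vadd_mem, mem_smul_set_iff_inv_smul_mem₀ hr.ne',
      LinearEquiv.image_eq_preimage_symm, vadd_eq_add, map_add, map_smul, map_neg]
  rw [himage]
  ext v
  rw [mem_preimage, mem_vadd_smul_unitSquare hr]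
  simp only [stripInter, mem_ofPred_eq, ← inner_contragredient_symm, inner_one_zero,
    inner_zero_one]

lemma volume_real_vadd_image_diamond (φ : Plane ≃ₗ[ℝ] Plane) (c₀ : Plane)
    (h₁ : a₁ ∈ Icc (0 : ℝ) 1) (h₂ : a₂ ∈ Icc (0 : ℝ) 1) :
    volume.real (c₀ +ᵥ φ '' diamond a₁ a₂) = |LinearMap.det (φ : Plane →ₗ[ℝ] Plane)| / 2 := by
  rw [← LinearEquiv.coe_coe, volume_real_vadd_image, volume_real_diamond h₁ h₂, mul_one_div]

lemma volume_real_vadd_smul_contragredient_unitSquare (φ : Plane ≃ₗ[ℝ] Plane) (s : Plane)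
    (r : ℝ) : volume.real (s +ᵥ r • (contragredient φ '' unitSquare)) =
      r ^ 2 / |LinearMap.det (φ : Plane →ₗ[ℝ] Plane)| := by
  rw [volume_real_vadd_smul, ← LinearEquiv.coe_coe, measureReal_image_linearMap,
    volume_real_unitSquare, mul_one, ← LinearEquiv.symm_symm (contragredient φ),
    LinearEquiv.det_coe_symm, det_contragredient_symm, abs_inv, div_eq_mul_inv]

lemma fits_vadd_image_segment {S : Set Plane} {d : Plane} (h : Fits S ![0, d])
    (φ : Plane ≃ₗ[ℝ] Plane) (c₀ : Plane) : Fits (c₀ +ᵥ φ '' S) ![0, φ d] := by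
  obtain ⟨u, hu, hud⟩ := fits_segment_iff.1 h
  refine fits_segment_iff.2 ⟨_, vadd_mem_vadd_set (mem_image_of_mem φ hu), ?_⟩
  convert vadd_mem_vadd_set (a := c₀) (mem_image_of_mem φ hud) using 1
  rw [vadd_eq_add, vadd_eq_add, map_add, add_left_comm]

lemma isEHZCapacity_diamond_dual (h₁ : a₁ ∈ Icc (0 : ℝ) 1) (h₂ : a₂ ∈ Icc (0 : ℝ) 1)
    (hr : 0 < r) :
    IsEHZCapacity
      ((c₀ +ᵥ φ '' diamond a₁ a₂) ×ˢ (s +ᵥ r • (contragredient φ '' unitSquare))) r := by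
  have hQ := (isConvexBody_diamond h₁ h₂).vadd_image φ c₀
  have hP := (isConvexBody_unitSquare.vadd_image (contragredient φ) 0).vadd_smul hr s
  rw [zero_vadd] at hP
  have hcross := cross_map_ne_zero φ
  refine isEHZCapacity_of_not_fits hQ hP (W := ![0, r • contragredient φ !₂[1, 0]]) ?_ ?_
    fun z hz γ hγ => ?_
  · refine not_fits_interior_segment (f := φ !₂[1, 0]) (x := inner ℝ (φ !₂[1, 0]) s) (a := r)
      (fun hzero => hcross (by simp [hzero])) (fun v hv => ?_) ?_
    · rw [vadd_smul_contragredient_unitSquare hr] at hv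
      exact hv.1
    · rw [real_inner_smul_right, real_inner_comm, inner_contragredient, inner_one_zero]
      simp
  · refine polygonLength_segment_le (x := r * inner ℝ (contragredient φ !₂[1, 0]) c₀)
      (hQ.2.2.mono interior_subset) ?_
    rintro _ ⟨_, ⟨k, hk, rfl⟩, rfl⟩
    obtain ⟨hk₀, hk₁⟩ := (diamond_subset_unitSquare h₁ h₂ hk).1
    simp only [real_inner_smul_left, vadd_eq_add, inner_add_right, inner_contragredient,
      inner_one_zero]
    constructor <;> nlinarith
  · obtain ⟨q, p, h, hA⟩ := hγ.exists_isCharPair hQ hP hz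
    have hswap := h.swap
    rw [vadd_smul_contragredient_unitSquare hr] at hswap
    have hfit₁ := fits_vadd_image_segment (fits_diamond_horizontal a₁ a₂ 1 0) φ c₀
    have hfit₂ := fits_vadd_image_segment (fits_diamond_vertical a₁ a₂ 1 0) φ c₀
    rw [zero_vadd, one_smul, map_smul] at hfit₁ hfit₂
    have hle := hswap.mul_le_pairing_of_stripInter hcross hQ.2.2 hfit₁ hfit₂
    rw [h.pairing_swap] at hle
    linarith

lemma isEqualityCase_of_isScaledTranslate_dual (h₁ : a₁ ∈ Icc (0 : ℝ) 1)
    (h₂ : a₂ ∈ Icc (0 : ℝ) 1) (h : IsScaledTranslate (contragredient φ '' unitSquare) T) :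
    IsEqualityCase (c₀ +ᵥ φ '' diamond a₁ a₂) T := by
  obtain ⟨r, hr, s, rfl⟩ := h
  have hP := (isConvexBody_unitSquare.vadd_image (contragredient φ) 0).vadd_smul hr s
  rw [zero_vadd] at hP
  have hdet : 0 < |LinearMap.det (φ : Plane →ₗ[ℝ] Plane)| := abs_pos.2 φ.isUnit_det'.ne_zero
  refine ⟨(isConvexBody_diamond h₁ h₂).vadd_image φ c₀, hP, r,
    isEHZCapacity_diamond_dual h₁ h₂ hr, ?_⟩
  rw [volume_real_prod, volume_real_vadd_image_diamond φ c₀ h₁ h₂,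
    volume_real_vadd_smul_contragredient_unitSquare]
  field_simp

lemma polygonLength_contragredient_le {m : ℕ} [NeZero m] {W : Fin m → Plane} {B : Fin m → ℝ}
    (hc : 0 ≤ c) (hW : ∀ i, ∀ k ∈ ({!₂[a₁, 0], !₂[a₁, 1], !₂[0, a₂], !₂[1, a₂]} : Set Plane),
      inner ℝ (W i - W (i + 1)) k ≤ B i) :
    polygonLength (c₀ +ᵥ φ '' diamond a₁ a₂) (fun i => c • contragredient φ (W i)) ≤
      c * ∑ i, B i := by
  have hne : (c₀ +ᵥ φ '' diamond a₁ a₂).Nonempty :=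
    (((insert_nonempty _ _).mono (vertices_subset_diamond a₁ a₂)).image φ).vadd_set
  rw [Finset.mul_sum]
  refine polygonLength_le_sum hne c₀ fun i => ?_
  rintro _ ⟨_, ⟨k, hk, rfl⟩, rfl⟩
  rw [diamond_eq_convexHull] at hk
  simp only [← smul_sub, ← map_sub, vadd_eq_add, add_sub_cancel_left, real_inner_smul_left,
    inner_contragredient]
  exact mul_le_mul_of_nonneg_left (inner_le_of_mem_convexHull (hW i) k hk) hc

lemma IsEHZCapacity.fits_contragredient_symm {m : ℕ} [NeZero m] {W : Fin m → Plane}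
    (hQ : IsConvexBody (c₀ +ᵥ φ '' diamond a₁ a₂)) (hT : IsConvexBody T)
    (hcap : IsEHZCapacity ((c₀ +ᵥ φ '' diamond a₁ a₂) ×ˢ T) c) (hc : 0 < c) (B : Fin m → ℝ)
    (hB : ∑ i, B i = 1)
    (hW : ∀ i, ∀ k ∈ ({!₂[a₁, 0], !₂[a₁, 1], !₂[0, a₂], !₂[1, a₂]} : Set Plane),
      inner ℝ (W i - W (i + 1)) k ≤ B i) :
    Fits (c⁻¹ • ((contragredient φ).symm '' T)) W := by
  obtain ⟨s, hs⟩ := hcap.fits hQ hT (W := fun i => c • contragredient φ (W i))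
    ((polygonLength_contragredient_le hc.le hW).trans_eq (by rw [hB, mul_one]))
  refine ⟨c⁻¹ • (contragredient φ).symm s, fun i => ?_⟩
  convert smul_mem_smul_set (mem_image_of_mem (contragredient φ).symm (hs i)) using 1
  rw [map_add, map_smul, LinearEquiv.symm_apply_apply, smul_add, inv_smul_smul₀ hc.ne']

lemma IsEHZCapacity.fits_diag (hQ : IsConvexBody (c₀ +ᵥ φ '' diamond α α))
    (hT : IsConvexBody T) (hcap : IsEHZCapacity ((c₀ +ᵥ φ '' diamond α α) ×ˢ T) c) (hc : 0 < c) :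
    Fits (c⁻¹ • ((contragredient φ).symm '' T)) ![0, diag] := by
  refine hcap.fits_contragredient_symm hQ hT hc ![-α, 1 + α] (by simp) fun i k hk => ?_
  fin_cases i <;> rcases hk with (rfl | rfl | rfl | rfl) <;> simp [diag, inner_plane, add_comm]

-- The edges of this triangle and of its reflection have total length
-- `(1 - m) * (1 + α) + 2 * (m * α) = 1` with respect to the first factor.
lemma IsEHZCapacity.fits_triangle (hQ : IsConvexBody (c₀ +ᵥ φ '' diamond α α))
    (hT : IsConvexBody T) (hcap : IsEHZCapacity ((c₀ +ᵥ φ '' diamond α α) ×ˢ T) c) (hc : 0 < c)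
    (hm₀ : 0 ≤ m) (hm₁ : m ≤ 1) (hmα : m * (1 - α) = α) :
    Fits (c⁻¹ • ((contragredient φ).symm '' T)) ![(1 - m) • diag, 0, !₂[1, -m]] := by
  have hindex : (2 : Fin 3) + 1 = 0 := rfl
  have hα : 0 ≤ α := nonneg_of_mul_nonneg_left (b := 1 + m) (by linarith) (by linarith)
  refine hcap.fits_contragredient_symm hQ hT hc ![(1 - m) * (1 + α), m * α, m * α]
    (by simp [Fin.sum_univ_three]; linarith) fun i k hk => ?_
  fin_cases i <;> rcases hk with (rfl | rfl | rfl | rfl) <;>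
    simp [hindex, diag, inner_plane] <;> nlinarith [hα]

lemma IsEHZCapacity.fits_triangle_reflected (hQ : IsConvexBody (c₀ +ᵥ φ '' diamond α α))
    (hT : IsConvexBody T) (hcap : IsEHZCapacity ((c₀ +ᵥ φ '' diamond α α) ×ˢ T) c) (hc : 0 < c)
    (hm₀ : 0 ≤ m) (hm₁ : m ≤ 1) (hmα : m * (1 - α) = α) :
    Fits (c⁻¹ • ((contragredient φ).symm '' T)) ![(1 - m) • diag, 0, !₂[-m, 1]] := by
  have hindex : (2 : Fin 3) + 1 = 0 := rfl
  have hα : 0 ≤ α := nonneg_of_mul_nonneg_left (b := 1 + m) (by linarith) (by linarith)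
  refine hcap.fits_contragredient_symm hQ hT hc ![(1 - m) * (1 + α), m * α, m * α]
    (by simp [Fin.sum_univ_three]; linarith) fun i k hk => ?_
  fin_cases i <;> rcases hk with (rfl | rfl | rfl | rfl) <;>
    simp [hindex, diag, inner_plane] <;> nlinarith [hα]

lemma isScaledTranslate_of_normalized_eq (hc : 0 < c) {A : Set Plane}
    (h : c⁻¹ • ((contragredient φ).symm '' T) = s +ᵥ A) :
    IsScaledTranslate (contragredient φ '' A) T := by
  refine ⟨c, hc, c • contragredient φ s, ?_⟩
  have hT : contragredient φ '' (c • (s +ᵥ A)) = T := by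
    rw [← h, smul_inv_smul₀ hc.ne', LinearEquiv.image_symm_eq_preimage,
      image_preimage_eq _ (contragredient φ).surjective]
  simp only [← hT, ← image_vadd, ← image_smul, image_image, vadd_eq_add, map_add, smul_add,
    map_smul]

lemma IsEqualityCase.isScaledTranslate_dual (hα₀ : 0 < α) (hα₁ : α < 1 / 2)
    (h : IsEqualityCase (c₀ +ᵥ φ '' diamond α α) T) :
    IsScaledTranslate (contragredient φ '' unitSquare) T := by
  have hα : α ∈ Icc (0 : ℝ) 1 := ⟨hα₀.le, by linarith⟩
  have hT := h.2.1
  obtain ⟨c, hc, hcap, hv⟩ := h.exists_pos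
  have hvolume : volume.real (c⁻¹ • ((contragredient φ).symm '' T)) = 1 := by
    rw [volume_real_vadd_image_diamond φ c₀ hα hα] at hv
    rw [← zero_vadd Plane (c⁻¹ • _), volume_real_vadd_smul, ← LinearEquiv.coe_coe,
      measureReal_image_linearMap, det_contragredient_symm]
    field_simp
    linarith
  have hbody : IsConvexBody (c⁻¹ • ((contragredient φ).symm '' T)) := by
    simpa only [zero_vadd] using
      (hT.vadd_image (contragredient φ).symm 0).vadd_smul (inv_pos.2 hc) 0
  have hα' : 0 < 1 - α := by linarith
  have hmα : α / (1 - α) * (1 - α) = α := div_mul_cancel₀ _ hα'.ne'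
  have hm₀ : 0 < α / (1 - α) := div_pos hα₀ hα'
  have hm₁ : α / (1 - α) < 1 := by rw [div_lt_one hα']; linarith
  obtain ⟨s, hs⟩ := exists_eq_vadd_unitSquare_of_fits hbody hvolume.le hm₀ hm₁
    (hcap.fits_diag h.1 hT hc) (hcap.fits_triangle h.1 hT hc hm₀.le hm₁.le hmα)
    (hcap.fits_triangle_reflected h.1 hT hc hm₀.le hm₁.le hmα)
  exact isScaledTranslate_of_normalized_eq hc hs

end Dual

lemma exists_convexHull_trapezoid_eq_diamond {a b c d : Plane} {l : ℝ} (hl : 0 < l)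
    (h : c - d = l • (b - a)) (hcross : cross (b - a) (d - a) ≠ 0) :
    ∃ (φ : Plane ≃ₗ[ℝ] Plane) (c₀ : Plane),
      convexHull ℝ {a, b, c, d} = c₀ +ᵥ φ '' diamond (l / (1 + l)) (l / (1 + l)) := by
  set α := l / (1 + l)
  have hl' : 1 + l ≠ 0 := by positivity
  have hαl : α * (1 + l) = l := div_mul_cancel₀ l hl'
  have hdet : LinearMap.det (basisMap (b - d) (a - c)) ≠ 0 := by
    have hc : c = d + l • (b - a) := by rw [← h]; abel
    have hdiagonals : cross (b - d) (a - c) = -(1 + l) * cross (b - a) (d - a) := by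
      simp [hc, cross_apply]; ring
    rw [det_basisMap, hdiagonals]
    exact mul_ne_zero (neg_ne_zero.2 hl') hcross
  let φ := LinearMap.equivOfDetNeZero _ hdet
  have hφ (x : Plane) : φ x = x 0 • (b - d) + x 1 • (a - c) := rfl
  refine ⟨φ, c - α • (b - d), ?_⟩
  have ha : c - α • (b - d) + φ !₂[α, 1] = a := by simp [hφ]; module
  have hb : c - α • (b - d) + φ !₂[1, α] = b := by
    simp [hφ]; linear_combination (norm := module) (1 - α) • h - hαl • (b - a)
  have hc : c - α • (b - d) + φ !₂[α, 0] = c := by simp [hφ]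
  have hd : c - α • (b - d) + φ !₂[0, α] = d := by
    simp [hφ]; linear_combination (norm := module) (1 - α) • h - hαl • (b - a)
  rw [diamond_eq_convexHull, ← LinearEquiv.coe_coe, LinearMap.image_convexHull, ← convexHull_vadd]
  simp only [image_insert_eq, image_singleton, vadd_set_insert, vadd_set_singleton, vadd_eq_add,
    LinearEquiv.coe_coe, ha, hb, hc, hd]
  congr 1
  grind

lemma exists_dualParallelogram_of_lt_one {a b c d : Plane} {l : ℝ} (hl₀ : 0 < l) (hl₁ : l < 1)
    (h : c - d = l • (b - a)) (hcross : cross (b - a) (d - a) ≠ 0) :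
    ∃ P : Set Plane, IsParallelogram P ∧ IsDualParallelogram (convexHull ℝ {a, b, c, d}) P ∧
      ∀ T : Set Plane,
        IsEqualityCase (convexHull ℝ {a, b, c, d}) T ↔ IsScaledTranslate P T := by
  obtain ⟨φ, c₀, hφ⟩ := exists_convexHull_trapezoid_eq_diamond hl₀ h hcross
  have hα₀ : 0 < l / (1 + l) := by positivity
  have hα₁ : l / (1 + l) < 1 / 2 := by
    rw [div_lt_div_iff₀ (by positivity) (by positivity)]; linarith
  have hα : l / (1 + l) ∈ Icc (0 : ℝ) 1 := ⟨hα₀.le, by linarith⟩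
  refine ⟨contragredient φ '' unitSquare, isParallelogram_image_unitSquare _,
    ⟨φ, c₀, _, _, hα, hα, hφ, rfl⟩, fun T => ?_⟩
  rw [hφ]
  exact ⟨fun h => h.isScaledTranslate_dual hα₀ hα₁, isEqualityCase_of_isScaledTranslate_dual hα hα⟩

lemma isParallelogram_convexHull {a b c d : Plane} (h : c - d = b - a)
    (hcross : cross (b - a) (d - a) ≠ 0) : IsParallelogram (convexHull ℝ {a, b, c, d}) := by
  refine ⟨a, b - a, d - a, linearIndependent_of_cross_ne_zero hcross, ?_⟩
  have hc : b + (d - a) = c := by rw [← sub_add_cancel c d, h]; abel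
  rw [add_sub_cancel, add_sub_cancel, hc]

theorem exists_dualParallelogram {Q : Set Plane} (hQ : IsTrapezoid Q) (hQt : ¬ IsTriangle Q)
    (hQp : ¬ IsParallelogram Q) :
    ∃ P : Set Plane, IsParallelogram P ∧ IsDualParallelogram Q P ∧
      ∀ T : Set Plane, IsEqualityCase Q T ↔ IsScaledTranslate P T := by
  obtain ⟨a, b, c, d, hind, ⟨l, hl₀, h⟩, rfl⟩ := hQ.resolve_left hQt
  have hcross : cross (b - a) (d - a) ≠ 0 := doubleArea_ne_zero hind
  rcases lt_trichotomy l 1 with hl | rfl | hl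
  · exact exists_dualParallelogram_of_lt_one hl₀ hl h hcross
  · exact absurd (isParallelogram_convexHull (by rw [h, one_smul]) hcross) hQp
  · have hreverse : ({a, b, c, d} : Set Plane) = {d, c, b, a} := by grind
    rw [hreverse]
    refine exists_dualParallelogram_of_lt_one (inv_pos.2 hl₀) (inv_lt_one_of_one_lt₀ hl) ?_ ?_
    · rw [h, inv_smul_smul₀ hl₀.ne']
    · rw [h, ← neg_sub d a, map_neg, map_smul, LinearMap.smul_apply, smul_eq_mul]
      exact neg_ne_zero.2 (mul_ne_zero hl₀.ne' hcross)

end Viterbo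

end

theorem theorem1p2 :
    (∀ D : Set Viterbo.Plane, Viterbo.IsTriangle D → ∀ T : Set Viterbo.Plane,
      (Viterbo.IsEqualityCase D T ↔
        ∃ S ∈ Viterbo.minimalHulls D, Viterbo.IsScaledTranslate S T)) ∧
    (∀ S : Set Viterbo.Plane, Viterbo.IsAxisParallelSquare S → ∀ T : Set Viterbo.Plane,
      (Viterbo.IsEqualityCase S T ↔
        ∃ a₁ ∈ Set.Icc (0 : ℝ) 1, ∃ a₂ ∈ Set.Icc (0 : ℝ) 1,
          Viterbo.IsScaledTranslate (Viterbo.diamond a₁ a₂) T)) ∧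
    (∀ Q : Set Viterbo.Plane, Viterbo.IsTrapezoid Q → ¬ Viterbo.IsTriangle Q →
      ¬ Viterbo.IsParallelogram Q →
      ∃ P : Set Viterbo.Plane, Viterbo.IsParallelogram P ∧ Viterbo.IsDualParallelogram Q P ∧
        ∀ T : Set Viterbo.Plane,
          (Viterbo.IsEqualityCase Q T ↔ Viterbo.IsScaledTranslate P T)) := by
  refine ⟨fun D hD T => ?_, fun S hS T => ?_, fun Q hQ hQt hQp => ?_⟩
  · obtain ⟨v, hv, rfl⟩ := hD.exists_vertices
    exact Viterbo.isEqualityCase_triangle_iff hv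
  · obtain ⟨x, y, a, ha, rfl⟩ := hS
    exact Viterbo.isEqualityCase_square_iff x y ha
  · exact Viterbo.exists_dualParallelogram hQ hQt hQp
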